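/- Let $x(t)\in t\,\mathbf{Q}[[t]]$ and let $U\subset\mathbf{C}$ be open. A nonzero linear differential operator $L=\sum_{i=0}^n a_i(x)\,(d/dx)^i$ with $a_i\in\overline{\mathbf{Q}}(x)$, $a_n\neq 0$, has a singular point at $\alpha\in\mathbf{C}$ if some $a_i/a_n$ has a pole at $\alpha$; it has trivial local monodromy around $\alpha$ if there are $n$ functions, meromorphic in a neighbourhood of $\alpha$, that form a $\mathbf{C}$-basis of the solutions of $L(g)=0$ on small punctured neighbourhoods of $\alpha$. Let $\mathcal{H}(U,x(t),\mathbf{Z})$ be the set of all $f(x)\in\mathbf{Q}[[x]]$ with $f(x(t))\in\mathbf{Z}[[t]]$ that satisfy $L(f)=0$ for some such $L$ having trivial local monodromy around all of its singular points in $U$. Let $\mathcal{V}(U,x(t),\mathbf{Z})\subset\mathbf{Q}((x))$ be its $\mathbf{Q}(x)$-linear span, put $\mathcal{V}(U,\mathbf{Z}):=\mathcal{V}(U,t,\mathbf{Z})$, and for $p\in\mathbf{Q}(x)$ let $\mathcal{V}_p(U,x(t),\mathbf{Z})\subset\mathbf{Q}((x))$ be the $\mathbf{Q}(p(x))$-linear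 span of $\mathcal{H}(U,x(t),\mathbf{Z})$. **Corollary 2.3.** Let $U\subset\mathbf{C}$ be open with $0\in U$. (1) Suppose that the uniformization radius of $(U,0)$ is strictly greater than $1$; this is the radius $R\in(0,\infty]$ for which there is a holomorphic universal covering map $F$ from $\{|z|<R\}$ onto the connected component of $0$ in $U$ with $F(0)=0$ and $|F'(0)|=1$. Then $\mathcal{V}(U,\mathbf{Z})$ is finite dimensional over $\mathbf{Q}(x)$. (2) Let $p(x)\in\mathbf{Q}(x)\setminus\mathbf{Q}$ have no poles in $U$, let $\varphi$ be a function holomorphic on a neighbourhood of $\overline{D(0,1)}$ with $\varphi(\overline{D(0,1)})\subset U$, $\varphi(0)=0$ and $|\varphi'(0)|>1$, and let $x(t)\in t+t^2\mathbf{Q}[[t]]$ be such that $p(x(t))\in\mathbf{Z}[[t]]$. Then $\mathcal{V}_p(U,x(t),\mathbf{Z})$ is finite dimensional over $\mathbf{Q}(p(x))$ and $$\dim_{\mathbf{Q}(p(x))}\mathcal{V}_p(U,x(t),\mathbf{Z})\le e\cdot\frac{\int_{\mathbf{T}}\log^+|p\circ\varphi|\,\mu_{\mathrm{Haar}}}{\log|\varphi'(0)|},$$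 where $\mathbf{T}$ is the unit circle with its normalized Haar measure $\mu_{\mathrm{Haar}}$. If moreover $M\,x(t)\in\mathbf{Z}[[t]]$ for some nonzero $M\in\mathbf{Q}$ (for example if $x(t)=t$), then $\mathcal{V}(U,x(t),\mathbf{Z})$ is also finite dimensional over $\mathbf{Q}(p(x))$ and its dimension satisfies the same bound. -/

import Mathlib

open scoped ENNReal PowerSeries LaurentSeries RatFunc

noncomputable section

namespace Holonomy

/-- The field of algebraic numbers, as a subfield of `ℂ`. -/
abbrev Qbar : Type := algebraicClosure ℚ ℂ

/-- A nonzero linear differential operator `L = ∑_{i ≤ order} coeff i · (d/dx)^i` over `ℚ̄(x)`,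
written with its nonzero leading coefficient. -/
structure DiffOp where
  order : ℕ
  coeff : Fin (order + 1) → RatFunc Qbar
  lead_ne_zero : coeff (Fin.last order) ≠ 0

namespace DiffOp

/-- `L(f)` for a formal power series `f`. The coefficients of `L` are expanded at `x = 0`, where
they may have poles, so `L(f)` is a formal Laurent series. -/
def applyFormal (L : DiffOp) (f : Qbar⟦X⟧) : Qbar⸨X⸩ :=
  ∑ i, algebraMap (RatFunc Qbar) Qbar⸨X⸩ (L.coeff i) *
    (((PowerSeries.derivative Qbar)^[(i : ℕ)] f : Qbar⟦X⟧) : Qbar⸨X⸩)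

/-- The value of `L(g)` at a point `z` which is not a pole of a coefficient of `L`. -/
def applyAt (L : DiffOp) (g : ℂ → ℂ) (z : ℂ) : ℂ :=
  ∑ i, (L.coeff i).eval (algebraMap Qbar ℂ) z * iteratedDeriv (i : ℕ) g z

/-- `α` is a singular point of `L`: after division by the leading coefficient, some coefficient of
`L` has a pole at `α`. -/
def IsSingularPoint (L : DiffOp) (α : ℂ) : Prop :=
  ∃ i, Polynomial.aeval α (L.coeff i / L.coeff (Fin.last L.order)).denom = 0

/-- `h` is a holomorphic solution of `L` on some punctured neighbourhood of `α`. -/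
def IsSolutionNear (L : DiffOp) (α : ℂ) (h : ℂ → ℂ) : Prop :=
  ∀ᶠ z in nhdsWithin α {α}ᶜ, AnalyticAt ℂ h z ∧ L.applyAt h z = 0

/-- Trivial local monodromy of `L` around `α`: there are functions `g₁, …, gₙ`, `n` the order
of `L`, meromorphic at `α`, which form a `ℂ`-basis of the solutions of `L` on small punctured
neighbourhoods of `α`. -/
def TrivialMonodromyAt (L : DiffOp) (α : ℂ) : Prop :=
  ∃ g : Fin L.order → ℂ → ℂ,
    (∀ j, MeromorphicAt (g j) α) ∧
    (∀ j, L.IsSolutionNear α (g j)) ∧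
    (∀ c : Fin L.order → ℂ,
      (∀ᶠ z in nhdsWithin α {α}ᶜ, ∑ j, c j * g j z = 0) → ∀ j, c j = 0) ∧
    (∀ h : ℂ → ℂ, L.IsSolutionNear α h →
      ∃ c : Fin L.order → ℂ, ∀ᶠ z in nhdsWithin α {α}ᶜ, h z = ∑ j, c j * g j z)

end DiffOp

/-- A power series over `ℚ` all of whose coefficients are integers. -/
def IsIntegralSeries (f : ℚ⟦X⟧) : Prop :=
  ∀ n, ∃ m : ℤ, PowerSeries.coeff n f = m

/-- `𝓗(U, x(t), ℤ)`: the series `f(x) ∈ ℚ⟦x⟧` with `f(x(t)) ∈ ℤ⟦t⟧` that are annihilated by a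
nonzero linear differential operator over `ℚ̄(x)` having trivial local monodromy around all of its
singular points in `U`. (It is meant for `x(t) ∈ tℚ⟦t⟧`, for which the substitution makes sense.) -/
def H (U : Set ℂ) (x : ℚ⟦X⟧) : Set ℚ⟦X⟧ :=
  {f | IsIntegralSeries (f.subst x) ∧
    ∃ L : DiffOp, L.applyFormal (f.map (algebraMap ℚ Qbar)) = 0 ∧
      ∀ α ∈ U, L.IsSingularPoint α → L.TrivialMonodromyAt α}

/-- `𝓥(U, x(t), ℤ)`: the `ℚ(x)`-span of `𝓗(U, x(t), ℤ)` in `ℚ((x))`. -/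
def V (U : Set ℂ) (x : ℚ⟦X⟧) : Submodule (RatFunc ℚ) ℚ⸨X⸩ :=
  Submodule.span (RatFunc ℚ) ((fun f : ℚ⟦X⟧ => (f : ℚ⸨X⸩)) '' H U x)

/-- The subfield `ℚ(p(x))` of `ℚ(x)`. -/
abbrev Qp (p : RatFunc ℚ) : IntermediateField ℚ (RatFunc ℚ) :=
  IntermediateField.adjoin ℚ {p}

/-- The `ℚ(p(x))`-span of `𝓗(U, x(t), ℤ)` in `ℚ((x))`. -/
def Vp (p : RatFunc ℚ) (U : Set ℂ) (x : ℚ⟦X⟧) : Submodule (Qp p) ℚ⸨X⸩ :=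
  Submodule.span (Qp p) ((fun f : ℚ⟦X⟧ => (f : ℚ⸨X⸩)) '' H U x)

/-- `p(x(t))`, for a rational function `p` without pole at `0` and `x(t) ∈ tℚ⟦t⟧`: the denominator
`(p.denom)(x(t))` is then a unit of `ℚ⟦t⟧`. -/
def pullback (p : RatFunc ℚ) (x : ℚ⟦X⟧) : ℚ⟦X⟧ :=
  Polynomial.aeval x p.num * (Polynomial.aeval x p.denom)⁻¹

/-- `F` restricts to a holomorphic universal covering of the connected component of `a` in `U` by
the (simply connected) disc `|z| < R`, `0 < R ≤ ∞`, normalised by `F(0) = a` and `|F'(0)| = 1`. -/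
def IsUniformization (U : Set ℂ) (a : ℂ) (R : ℝ≥0∞) (F : ℂ → ℂ) : Prop :=
  0 < R ∧ DifferentiableOn ℂ F (Metric.eball 0 R) ∧ F 0 = a ∧ ‖deriv F 0‖ = 1 ∧
    ∃ h : Set.MapsTo F (Metric.eball 0 R) (connectedComponentIn U a),
      Function.Surjective h.restrict ∧ IsCoveringMap h.restrict

/-- The uniformization radius of `(U, a)`: the radius `R` (unique by the Schwarz lemma and
Liouville's theorem) of the disc in a normalised universal covering; `∞` if the universal covering
is the whole plane. -/
def uniformizationRadius (U : Set ℂ) (a : ℂ) : ℝ≥0∞ :=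
  sSup {R | ∃ F, IsUniformization U a R F}

/-- The number `e · ∫_𝕋 log⁺ |p ∘ φ| dμ / log |φ'(0)|`, `μ` the normalised Haar measure of the unit
circle `𝕋`. -/
def holonomyBound (p : RatFunc ℚ) (φ : ℂ → ℂ) : ℝ :=
  Real.exp 1 *
    Real.circleAverage (fun z => Real.posLog ‖p.eval (algebraMap ℚ ℂ) (φ z)‖) 0 1 /
    Real.log ‖deriv φ 0‖

end Holonomy

end

section

open Filter Topology

noncomputable section

namespace Holonomy

/-! A generating set bounds the dimension of its span through its independent finite subfamilies
(`finite_span_of_card_le`), so it suffices to bound the length `m` of a `ℚ(p)`-independent family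
`f₁, …, f_m` of generators. Two properties of the generators enter: `fᵢ(x(t))` is integral, and `(Q
fᵢ) ∘ φ` is holomorphic near the closed unit disc for some polynomial `Q ≠ 0`.

The second property is `continuesAlong_of_mem_H`. Every point of `U` carries a full basis of
meromorphic solutions, and as there are finitely many singular points one polynomial `Q` clears all
the poles. A solution multiplied by `Q` and pulled back by `φ` therefore continues locally, hence
over the whole disc, where there is no monodromy (`exists_continuation_comp`). At `0` the formal
solution converges: by the indicial polynomial the formal solution space has dimension at most the
order (`card_le_of_linearIndependent_ker`), so the analytic solutions already fill it.

The numerical bound (`card_mul_log_le`) comes from diophantine approximation in many variables. The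
`mD` series `p ^ s * fᵢ`, `s < D`, are independent over `ℚ`, and so are their products in `d`
separate variables. The box principle gives a nonzero integral combination of these products with
small coefficients, whose Taylor coefficients in total degree below `A` are less than `1` in
absolute value. Consider a nonzero Taylor coefficient of lowest degree. Substituting `x(t_j) = t_j +
⋯` does not change it, so it is an integer; hence it has absolute value at least `1` and its degree
is at least `A`. Substituting `φ(z_j)` multiplies it by `φ'(0)` to the power of its degree, while
Cauchy's estimates bound the result from above (`holonomy_inequality`). To make that bound sharp,
the functions on the disc are first multiplied by `exp (-D q)`, where `Re q` majorizes `log⁺ |p ∘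
φ|` on the circle and `Re q(0)` is almost its mean (`exists_polynomial_re_ge`).

There are at most `(A + d) ^ d / d!` conditions and `(mD) ^ d` unknowns. Since `d ^ d ≤ e ^ d d!`,
one may take `A` close to `θ d D` for any `θ < m / e`; comparing logarithms and passing to the limit
gives the factor `e` (`asymptotic_bound`).

For `𝓥` instead of `𝓥_p`, the series with the two properties above are stable under multiplication
by `M x`, and `ℚ(x) = ℚ(p)[x]`. The statement on the uniformization radius is the case `p = x`,
`x(t) = t`, with `φ` a rescaled uniformization. -/

/-! ### Taylor series of analytic functions -/

/-- The formal Taylor series of `f` at `α`. -/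
def taylor (f : ℂ → ℂ) (α : ℂ) : ℂ⟦X⟧ :=
  PowerSeries.mk fun n => iteratedDeriv n f α / (n.factorial : ℂ)

lemma coeff_taylor (f : ℂ → ℂ) (α : ℂ) (n : ℕ) :
    PowerSeries.coeff n (taylor f α) = iteratedDeriv n f α / (n.factorial : ℂ) := by
  simp [taylor]

lemma constantCoeff_taylor (f : ℂ → ℂ) (α : ℂ) :
    PowerSeries.constantCoeff (taylor f α) = f α := by
  rw [← PowerSeries.coeff_zero_eq_constantCoeff_apply, coeff_taylor]
  simp

lemma taylor_congr {f g : ℂ → ℂ} {α : ℂ} (h : f =ᶠ[𝓝 α] g) : taylor f α = taylor g α := by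
  ext n
  rw [coeff_taylor, coeff_taylor, (h.iteratedDeriv n).eq_of_nhds]

lemma taylor_add {f g : ℂ → ℂ} {α : ℂ} (hf : AnalyticAt ℂ f α) (hg : AnalyticAt ℂ g α) :
    taylor (fun z => f z + g z) α = taylor f α + taylor g α := by
  ext n
  rw [map_add, coeff_taylor, coeff_taylor, coeff_taylor]
  have := iteratedDeriv_add (n := n) hf.contDiffAt hg.contDiffAt
  rw [show (fun z => f z + g z) = f + g from rfl, this, add_div]

lemma taylor_const_mul {f : ℂ → ℂ} {α : ℂ} (c : ℂ) :
    taylor (fun z => c * f z) α = c • taylor f α := by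
  ext n
  rw [map_smul, coeff_taylor, coeff_taylor, iteratedDeriv_const_mul_field, smul_eq_mul, mul_div_assoc]

lemma taylor_zero (α : ℂ) : taylor (fun _ => 0) α = 0 := by
  have := taylor_const_mul (f := fun _ => 0) (α := α) 0
  simpa using this

lemma taylor_sum {ι : Type*} (s : Finset ι) {f : ι → ℂ → ℂ} {α : ℂ}
    (hf : ∀ i ∈ s, AnalyticAt ℂ (f i) α) :
    taylor (fun z => ∑ i ∈ s, f i z) α = ∑ i ∈ s, taylor (f i) α := by
  classical
  induction s using Finset.induction_on with
  | empty => simpa using taylor_zero α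
  | insert a s ha ih =>
    simp only [Finset.sum_insert ha]
    rw [taylor_add (hf a (by simp)), ih fun i hi => hf i (by simp [hi])]
    exact Finset.analyticAt_fun_sum _ fun i hi => hf i (by simp [hi])

lemma taylor_mul {f g : ℂ → ℂ} {α : ℂ} (hf : AnalyticAt ℂ f α) (hg : AnalyticAt ℂ g α) :
    taylor (fun z => f z * g z) α = taylor f α * taylor g α := by
  ext n
  rw [PowerSeries.coeff_mul, coeff_taylor, show (fun z => f z * g z) = f * g from rfl,
    iteratedDeriv_mul hf.contDiffAt hg.contDiffAt,
    Finset.Nat.sum_antidiagonal_eq_sum_range_succ_mk, Finset.sum_div]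
  refine Finset.sum_congr rfl fun i hi => ?_
  have hi' : i ≤ n := by simpa [Nat.lt_succ_iff] using hi
  rw [coeff_taylor, coeff_taylor, Nat.cast_choose ℂ hi']
  have h1 : (n.factorial : ℂ) ≠ 0 := by exact_mod_cast n.factorial_ne_zero
  have h2 : (i.factorial : ℂ) ≠ 0 := by exact_mod_cast i.factorial_ne_zero
  have h3 : ((n - i).factorial : ℂ) ≠ 0 := by exact_mod_cast (n - i).factorial_ne_zero
  field_simp

lemma taylor_const (c α : ℂ) : taylor (fun _ => c) α = PowerSeries.C c := by
  ext n
  rw [coeff_taylor, iteratedDeriv_const, PowerSeries.coeff_C]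
  split_ifs with h <;> simp [h]

lemma taylor_pow {f : ℂ → ℂ} {α : ℂ} (hf : AnalyticAt ℂ f α) (k : ℕ) :
    taylor (fun z => f z ^ k) α = taylor f α ^ k := by
  induction k with
  | zero => simpa using taylor_const 1 α
  | succ k ih => simp only [pow_succ]; rw [taylor_mul (hf.fun_pow k) hf, ih]

lemma taylor_deriv (f : ℂ → ℂ) (α : ℂ) :
    taylor (deriv f) α = PowerSeries.derivative ℂ (taylor f α) := by
  ext n
  rw [PowerSeries.coeff_derivative, coeff_taylor, coeff_taylor, ← iteratedDeriv_succ',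
    Nat.factorial_succ]
  have h1 : (n.factorial : ℂ) ≠ 0 := by exact_mod_cast n.factorial_ne_zero
  have h2 : ((n : ℂ) + 1) ≠ 0 := by exact_mod_cast n.succ_ne_zero
  push_cast
  field_simp

lemma taylor_iteratedDeriv (f : ℂ → ℂ) (α : ℂ) (n : ℕ) :
    taylor (iteratedDeriv n f) α = (PowerSeries.derivative ℂ)^[n] (taylor f α) := by
  induction n with
  | zero => simp
  | succ n ih => rw [iteratedDeriv_succ, taylor_deriv, ih, Function.iterate_succ_apply']

lemma eventually_eq_zero_of_taylor_eq_zero {f : ℂ → ℂ} {α : ℂ} (hf : AnalyticAt ℂ f α)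
    (h : taylor f α = 0) : ∀ᶠ z in 𝓝 α, f z = 0 := by
  rw [← analyticOrderAt_eq_top, ENat.eq_top_iff_forall_ge]
  intro n
  rw [natCast_le_analyticOrderAt_iff_iteratedDeriv_eq_zero hf]
  intro i _
  have := congrArg (PowerSeries.coeff i) h
  rw [coeff_taylor, map_zero, div_eq_zero_iff] at this
  exact this.resolve_right (by exact_mod_cast i.factorial_ne_zero)

lemma taylor_sub_self (α : ℂ) : taylor (fun z => z - α) α = PowerSeries.X := by
  ext n
  rw [coeff_taylor, PowerSeries.coeff_X]
  rcases n with _ | _ | n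
  · simp
  · simp [iteratedDeriv_one]
  · have h1 : deriv (fun z : ℂ => z - α) = fun _ => 1 := by
      ext z; simp
    rw [iteratedDeriv_succ', h1, iteratedDeriv_const]
    simp

lemma taylor_id_zero : taylor (fun z => z) 0 = PowerSeries.X := by
  simpa using taylor_sub_self 0

lemma analyticAt_sub_const (α β : ℂ) : AnalyticAt ℂ (fun z => z - α) β :=
  analyticAt_id.fun_sub analyticAt_const

lemma analyticAt_iteratedDeriv {f : ℂ → ℂ} {α : ℂ} (hf : AnalyticAt ℂ f α) (n : ℕ) :
    AnalyticAt ℂ (iteratedDeriv n f) α := by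
  rw [iteratedDeriv_eq_iterate]
  exact AnalyticAt.iterated_deriv hf n

lemma analyticAt_polynomial_eval (P : Polynomial ℂ) (α : ℂ) : AnalyticAt ℂ (fun z => P.eval z) α :=
  P.differentiable.analyticAt α

lemma taylor_polynomial_zero (P : Polynomial ℂ) :
    taylor (fun z => P.eval z) 0 = (P : ℂ⟦X⟧) := by
  induction P using Polynomial.induction_on' with
  | add p q hp hq =>
    simp only [Polynomial.eval_add, Polynomial.coe_add]
    rw [taylor_add (analyticAt_polynomial_eval _ _) (analyticAt_polynomial_eval _ _), hp, hq]
  | monomial n a =>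
    simp only [Polynomial.eval_monomial]
    rw [taylor_const_mul, taylor_pow (f := fun z => z) analyticAt_id, taylor_id_zero,
      ← Polynomial.C_mul_X_pow_eq_monomial, PowerSeries.smul_eq_C_mul]
    simp

/-- The Cauchy estimates for the Taylor coefficients. -/
lemma norm_coeff_taylor_le {f : ℂ → ℂ} {r C : ℝ} (hr : 0 < r)
    (hf : AnalyticOnNhd ℂ f (Metric.closedBall 0 r)) (hC : ∀ z ∈ Metric.sphere (0 : ℂ) r, ‖f z‖ ≤ C)
    (n : ℕ) : ‖PowerSeries.coeff n (taylor f 0)‖ ≤ C / r ^ n := by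
  have hd : DiffContOnCl ℂ f (Metric.ball 0 r) := by
    refine (hf.differentiableOn.mono ?_).diffContOnCl
    exact Metric.closure_ball_subset_closedBall
  have := Complex.norm_iteratedDeriv_le_of_forall_mem_sphere_norm_le n hr hd hC
  rw [coeff_taylor, norm_div, Complex.norm_natCast, div_le_iff₀ (by positivity)]
  calc _ ≤ _ := this
    _ = _ := by ring

lemma exists_norm_coeff_taylor_le {f : ℂ → ℂ} {α : ℂ} (hf : AnalyticAt ℂ f α) :
    ∃ C R : ℝ, 0 < C ∧ 0 < R ∧ ∀ n, ‖PowerSeries.coeff n (taylor f α)‖ ≤ C * R ^ n := by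
  obtain ⟨r, hr⟩ := hf.hasFPowerSeriesAt
  obtain ⟨ρ, hρ0, hρr⟩ := ENNReal.lt_iff_exists_nnreal_btwn.mp hr.r_pos
  have hρ : (0 : ℝ) < ρ := by exact_mod_cast hρ0
  obtain ⟨C, hC0, hC⟩ :=
    FormalMultilinearSeries.norm_mul_pow_le_of_lt_radius _ (hρr.trans_le hr.r_le)
  refine ⟨C, (ρ : ℝ)⁻¹, hC0, inv_pos.mpr hρ, fun n => ?_⟩
  rw [inv_pow, ← div_eq_mul_inv, le_div_iff₀ (by positivity), coeff_taylor]
  have := hC n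
  rwa [FormalMultilinearSeries.ofScalars_norm] at this

/-- A series with geometrically bounded coefficients is the Taylor series of an analytic
function. -/
lemma exists_analyticAt_taylor_eq {s : ℂ⟦X⟧} {C R : ℝ} (hR : 0 < R)
    (h : ∀ n, ‖PowerSeries.coeff n s‖ ≤ C * R ^ n) (α : ℂ) :
    ∃ f : ℂ → ℂ, AnalyticAt ℂ f α ∧ taylor f α = s := by
  let p := FormalMultilinearSeries.ofScalars ℂ (fun n => PowerSeries.coeff n s)
  have hp : 0 < p.radius := by
    refine lt_of_lt_of_le ?_ (p.le_radius_of_bound C (r := Real.toNNReal R⁻¹) fun n => ?_)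
    · rw [ENNReal.coe_pos]
      exact Real.toNNReal_pos.mpr (inv_pos.mpr hR)
    · rw [FormalMultilinearSeries.ofScalars_norm]
      rw [Real.coe_toNNReal _ (inv_pos.mpr hR).le, inv_pow, ← div_eq_mul_inv, div_le_iff₀ (by positivity)]
      exact h n
  have h1 := (p.hasFPowerSeriesOnBall hp).comp_sub α
  rw [zero_add] at h1
  have h2 := h1.hasFPowerSeriesAt
  refine ⟨_, h2.analyticAt, ?_⟩
  have h3 := h2.eq_formalMultilinearSeries h2.analyticAt.hasFPowerSeriesAt
  have h4 := FormalMultilinearSeries.ofScalars_series_injective (𝕜 := ℂ) (E := ℂ) h3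
  ext n
  rw [coeff_taylor]
  exact (congrFun h4 n).symm

/-- Composition with `φ`, `φ 0 = 0`, followed by multiplication by a series divisible by `X ^ N`,
acts on Taylor coefficients by a lower triangular matrix. -/
lemma coeff_mul_taylor_comp {g φ : ℂ → ℂ} (hg : AnalyticAt ℂ g 0) (hφ : AnalyticAt ℂ φ 0)
    (hφ0 : φ 0 = 0) {N : ℕ} {W : ℂ⟦X⟧} (hW : PowerSeries.X ^ N ∣ W) (n : ℕ) :
    PowerSeries.coeff (n + N) (W * taylor (fun z => g (φ z)) 0) =
      ∑ k ∈ Finset.range (n + 1), PowerSeries.coeff (n + N) (W * taylor φ 0 ^ k) *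
        PowerSeries.coeff k (taylor g 0) := by
  -- Only the terms of `g` of degree at most `n` matter: the remainder contributes a multiple of `W
  -- φ ^ (n + 1)`, which is divisible by `X ^ (n + N + 1)`.
  obtain ⟨r, hr, hgr⟩ := hg.exists_eventuallyEq_sum_add_pow_mul (n + 1)
  have hg' : AnalyticAt ℂ g (φ 0) := by rwa [hφ0]
  have hr' : AnalyticAt ℂ r (φ 0) := by rwa [hφ0]
  have h1 : (fun z => g (φ z)) =ᶠ[𝓝 0] fun z =>
      (∑ k ∈ Finset.range (n + 1), PowerSeries.coeff k (taylor g 0) * φ z ^ k) +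
        φ z ^ (n + 1) * r (φ z) := by
    have h2 : Tendsto φ (𝓝 0) (𝓝 0) := by
      simpa [hφ0] using hφ.continuousAt.tendsto
    filter_upwards [h2.eventually hgr] with z hz
    rw [hz]
    simp [coeff_taylor, div_eq_inv_mul, mul_comm, mul_assoc]
  have hX : PowerSeries.X ∣ taylor φ 0 := by
    rw [PowerSeries.X_dvd_iff, constantCoeff_taylor, hφ0]
  rw [taylor_congr h1, taylor_add, taylor_sum,
    taylor_mul (g := fun z => r (φ z)) (hφ.fun_pow _) (hr'.comp hφ),
    taylor_pow hφ, mul_add, map_add, Finset.mul_sum, map_sum]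
  · have h3 : PowerSeries.coeff (n + N)
        (W * (taylor φ 0 ^ (n + 1) * taylor (fun z => r (φ z)) 0)) = 0 := by
      obtain ⟨W', rfl⟩ := hW
      obtain ⟨ψ, hψ⟩ := hX
      rw [hψ]
      have : PowerSeries.X ^ (n + N + 1) ∣ PowerSeries.X ^ N * W' *
          ((PowerSeries.X * ψ) ^ (n + 1) * taylor (fun z => r (φ z)) 0) :=
        ⟨W' * ψ ^ (n + 1) * taylor (fun z => r (φ z)) 0, by ring⟩
      exact PowerSeries.X_pow_dvd_iff.mp this _ (Nat.lt_succ_self _)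
    rw [h3, add_zero]
    refine Finset.sum_congr rfl fun k _ => ?_
    rw [taylor_const_mul, taylor_pow hφ, mul_smul_comm, map_smul, smul_eq_mul, mul_comm]
  · exact fun i _ => analyticAt_const.mul (hφ.fun_pow i)
  · exact Finset.analyticAt_fun_sum _ fun i _ => analyticAt_const.mul (hφ.fun_pow i)
  · exact (hφ.fun_pow _).mul (hr'.comp hφ)

/-! ### Euler form of a differential operator and the indicial bound on formal solutions -/

/-- The operator `∏_{l < i} (θ - N - l)` on formal power series, where `θ = X d/dX`. It is the
conjugate of `X ^ i (d/dX) ^ i` by `X ^ N`. -/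
def eulerProd (N i : ℕ) : ℂ⟦X⟧ →ₗ[ℂ] ℂ⟦X⟧ where
  toFun h := PowerSeries.mk fun k =>
    (descPochhammer ℂ i).eval ((k : ℂ) - N) * PowerSeries.coeff k h
  map_add' f g := by ext; simp [mul_add]
  map_smul' c f := by ext; simp [mul_left_comm]

lemma coeff_eulerProd (N i k : ℕ) (h : ℂ⟦X⟧) : PowerSeries.coeff k (eulerProd N i h) =
    (descPochhammer ℂ i).eval ((k : ℂ) - N) * PowerSeries.coeff k h := by
  simp [eulerProd]

lemma eulerProd_zero (N : ℕ) (h : ℂ⟦X⟧) : eulerProd N 0 h = h := by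
  ext k; simp [coeff_eulerProd]

lemma eulerProd_succ (N i : ℕ) (h : ℂ⟦X⟧) : eulerProd N (i + 1) h =
    PowerSeries.X * PowerSeries.derivative ℂ (eulerProd N i h) -
      ((N + i : ℕ) : ℂ) • eulerProd N i h := by
  ext k
  rw [map_sub, map_smul, coeff_eulerProd, descPochhammer_succ_eval]
  rcases k with _ | k
  · simp [coeff_eulerProd]; ring
  · rw [PowerSeries.coeff_succ_X_mul, PowerSeries.coeff_derivative, coeff_eulerProd]
    push_cast [smul_eq_mul]
    ring

lemma eulerProd_X_pow_mul (N i : ℕ) (f : ℂ⟦X⟧) : eulerProd N i (PowerSeries.X ^ N * f) =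
    PowerSeries.X ^ (N + i) * (PowerSeries.derivative ℂ)^[i] f := by
  induction i with
  | zero => simp [eulerProd_zero]
  | succ i ih =>
    rw [eulerProd_succ, ih, Function.iterate_succ_apply', Derivation.leibniz,
      Derivation.leibniz_pow, PowerSeries.derivative_X, PowerSeries.smul_eq_C_mul]
    simp only [smul_eq_mul, nsmul_eq_mul, map_natCast, mul_one]
    rcases Nat.eq_zero_or_pos (N + i) with h0 | h0
    · rw [← add_assoc, h0]; simp
    · obtain ⟨m, hm⟩ := Nat.exists_eq_succ_of_ne_zero h0.ne'
      rw [← add_assoc, hm]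
      simp only [Nat.succ_eq_add_one, Nat.add_sub_cancel]
      ring

/-- The operator `∑_{i ≤ n} b i · ∏_{l < i} (θ - N - l)`. -/
def eulerOp (n N : ℕ) (b : ℕ → ℂ⟦X⟧) : ℂ⟦X⟧ →ₗ[ℂ] ℂ⟦X⟧ :=
  ∑ i ∈ Finset.range (n + 1), LinearMap.mulLeft ℂ (b i) ∘ₗ eulerProd N i

lemma eulerOp_apply (n N : ℕ) (b : ℕ → ℂ⟦X⟧) (h : ℂ⟦X⟧) :
    eulerOp n N b h = ∑ i ∈ Finset.range (n + 1), b i * eulerProd N i h := by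
  simp [eulerOp]

lemma coeff_add_mul_of_forall_lt {a b : ℂ⟦X⟧} {r s : ℕ}
    (ha : ∀ k < s, PowerSeries.coeff k a = 0) (hb : ∀ k < r, PowerSeries.coeff k b = 0) :
    PowerSeries.coeff (r + s) (a * b) = PowerSeries.coeff s a * PowerSeries.coeff r b := by
  obtain ⟨a', rfl⟩ := PowerSeries.X_pow_dvd_iff.mpr ha
  obtain ⟨b', rfl⟩ := PowerSeries.X_pow_dvd_iff.mpr hb
  have h1 : PowerSeries.X ^ s * a' * (PowerSeries.X ^ r * b') =
    PowerSeries.X ^ (r + s) * (a' * b') := by ring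
  have h2 := PowerSeries.coeff_X_pow_mul (a' * b') (r + s) 0
  have h3 := PowerSeries.coeff_X_pow_mul a' s 0
  have h4 := PowerSeries.coeff_X_pow_mul b' r 0
  rw [zero_add] at h2 h3 h4
  rw [h1, h2, h3, h4]
  simp

/-- Indicial polynomials do not vanish identically. -/
lemma sum_descPochhammer_ne_zero {n : ℕ} {v : ℕ → ℂ} {j : ℕ} (hj : j ≤ n) (hv : v j ≠ 0) :
    ∑ i ∈ Finset.range (n + 1), Polynomial.C (v i) * descPochhammer ℂ i ≠ 0 := by
  classical
  have hex : ∃ i, v i ≠ 0 := ⟨j, hv⟩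
  have h1 := Nat.find_spec hex
  have h2 : ∀ i < Nat.find hex, v i = 0 := fun i hi => not_not.mp (Nat.find_min hex hi)
  set m := Nat.find hex
  have hm : m ≤ n := (Nat.find_le hv).trans hj
  intro h0
  -- At the least index `m` with `v m ≠ 0` the terms `i < m` vanish by minimality, and the terms `i
  -- > m` because `m (m - 1) ⋯ (m - i + 1) = 0`.
  have h3 := congrArg (Polynomial.eval (m : ℂ)) h0
  rw [Polynomial.eval_finsetSum, Finset.sum_eq_single m] at h3
  · rw [Polynomial.eval_mul, Polynomial.eval_C, descPochhammer_eval_eq_descFactorial,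
      Nat.descFactorial_self, Polynomial.eval_zero] at h3
    exact (mul_ne_zero h1 (by exact_mod_cast m.factorial_ne_zero)) h3
  · intro i _ hi
    rcases lt_or_gt_of_ne hi with h | h
    · simp [h2 i h]
    · rw [Polynomial.eval_mul, descPochhammer_eval_eq_descFactorial,
        Nat.descFactorial_of_lt h]
      simp
  · intro h; exact absurd (Finset.mem_range.mpr (by omega)) h

/-- The lowest exponent `r` of a nonzero element of the kernel makes `r - N` a root of the indicial
polynomial, which is nonzero of degree at most `n`. So recording the coefficients at these at most
`n` exponents is injective on the kernel. -/
lemma card_le_of_linearIndependent_ker {ι : Type*} [Fintype ι] {n N : ℕ} {b : ℕ → ℂ⟦X⟧}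
    (hb : b n ≠ 0) {h : ι → ℂ⟦X⟧} (hli : LinearIndependent ℂ h)
    (hker : ∀ i, eulerOp n N b (h i) = 0) : Fintype.card ι ≤ n := by
  classical
  have hex : ∃ s, ∃ i ≤ n, PowerSeries.coeff s (b i) ≠ 0 := by
    by_contra! hcon
    exact hb (PowerSeries.ext fun s => by simpa using hcon s n le_rfl)
  obtain ⟨j, hj, hjs⟩ := Nat.find_spec hex
  have hmin : ∀ k < Nat.find hex, ∀ i ≤ n, PowerSeries.coeff k (b i) = 0 := fun k hk i hi => by
    by_contra hne
    exact Nat.find_min hex hk ⟨i, hi, hne⟩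
  set s := Nat.find hex
  set ind : Polynomial ℂ := ∑ i ∈ Finset.range (n + 1),
    Polynomial.C (PowerSeries.coeff s (b i)) * descPochhammer ℂ i with hind
  have hind0 : ind ≠ 0 := sum_descPochhammer_ne_zero hj hjs
  have hdeg : ind.natDegree ≤ n := by
    refine Polynomial.natDegree_sum_le_of_forall_le _ _ fun i hi => ?_
    refine (Polynomial.natDegree_C_mul_le _ _).trans ?_
    rw [descPochhammer_natDegree]
    exact Nat.lt_succ_iff.mp (Finset.mem_range.mp hi)
  have hinj : Function.Injective fun r : ℕ => (r : ℂ) - N := fun a b hab => by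
    simpa using hab
  set S : Finset ℕ := ind.roots.toFinset.preimage _ hinj.injOn with hS
  have hScard : S.card ≤ n := by
    calc S.card ≤ ind.roots.toFinset.card := by
          rw [hS, Finset.card_preimage]
          exact Finset.card_filter_le _ _
      _ ≤ ind.roots.card := Multiset.toFinset_card_le _
      _ ≤ ind.natDegree := ind.card_roots'
      _ ≤ n := hdeg
  let ev : ℂ⟦X⟧ →ₗ[ℂ] (S → ℂ) := LinearMap.pi fun r => PowerSeries.coeff (r : ℕ)
  have hlead : ∀ w : ℂ⟦X⟧, eulerOp n N b w = 0 → ev w = 0 → w = 0 := by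
    intro w hw hev
    by_contra hw0
    have hex2 : ∃ r, PowerSeries.coeff r w ≠ 0 := by
      by_contra! hcon
      exact hw0 (PowerSeries.ext fun r => by simpa using hcon r)
    have hr := Nat.find_spec hex2
    have hrmin : ∀ k < Nat.find hex2, PowerSeries.coeff k w = 0 := fun k hk =>
      not_not.mp (Nat.find_min hex2 hk)
    set r := Nat.find hex2
    -- As `s` is the least order among the `b i` and `r` the order of `w`, the coefficient of index
    -- `r + s` sees only leading terms.
    have h1 := congrArg (PowerSeries.coeff (r + s)) hw
    rw [eulerOp_apply, map_sum, map_zero] at h1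
    have h2 : ∑ i ∈ Finset.range (n + 1), PowerSeries.coeff (r + s) (b i * eulerProd N i w) =
        ind.eval ((r : ℂ) - N) * PowerSeries.coeff r w := by
      rw [hind, Polynomial.eval_finsetSum, Finset.sum_mul]
      refine Finset.sum_congr rfl fun i hi => ?_
      rw [coeff_add_mul_of_forall_lt
        (fun k hk => hmin k hk i (Nat.lt_succ_iff.mp (Finset.mem_range.mp hi)))
        (fun k hk => by rw [coeff_eulerProd, hrmin k hk, mul_zero]), coeff_eulerProd,
        Polynomial.eval_mul, Polynomial.eval_C, mul_assoc]
    rw [h2, mul_eq_zero, or_iff_left hr] at h1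
    have hrS : r ∈ S := by
      rw [hS, Finset.mem_preimage, Multiset.mem_toFinset, Polynomial.mem_roots hind0]
      exact h1
    exact hr (congrFun hev ⟨r, hrS⟩)
  have hli2 : LinearIndependent ℂ (ev ∘ h) := by
    refine hli.map ?_
    rw [Submodule.disjoint_def]
    intro w hw hwk
    refine hlead w ?_ hwk
    have : Submodule.span ℂ (Set.range h) ≤ LinearMap.ker (eulerOp n N b) := by
      rw [Submodule.span_le]
      rintro _ ⟨i, rfl⟩
      exact hker i
    exact this hw
  have := hli2.fintype_card_le_finrank
  rw [Module.finrank_fintype_fun_eq_card, Fintype.card_coe] at this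
  exact this.trans hScard

/-- An element outside the span would produce `n + 1` independent elements of the kernel. -/
lemma exists_eq_sum_of_mem_ker {n N : ℕ} {b : ℕ → ℂ⟦X⟧}
    (hb : b n ≠ 0) {h : Fin n → ℂ⟦X⟧} (hli : LinearIndependent ℂ h)
    (hker : ∀ i, eulerOp n N b (h i) = 0) {w : ℂ⟦X⟧} (hw : eulerOp n N b w = 0) :
    ∃ a : Fin n → ℂ, w = ∑ i, a i • h i := by
  by_contra hcon
  have h1 : w ∉ Submodule.span ℂ (Set.range h) := fun hmem => by
    obtain ⟨a, ha⟩ := (Submodule.mem_span_range_iff_exists_fun ℂ).mp hmem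
    exact hcon ⟨a, ha.symm⟩
  have h2 := linearIndependent_finCons.mpr ⟨hli, h1⟩
  have := card_le_of_linearIndependent_ker (N := N) hb h2 (Fin.cases hw hker)
  simp at this

/-! ### Analytic and formal solutions in Euler form -/

/-- `g` is analytic at `z`, and `∑_{i ≤ n} c i · g⁽ⁱ⁾` vanishes at `z`. -/
def PolySol (n : ℕ) (c : ℕ → Polynomial ℂ) (g : ℂ → ℂ) (z : ℂ) : Prop :=
  AnalyticAt ℂ g z ∧ ∑ i ∈ Finset.range (n + 1), (c i).eval z * iteratedDeriv i g z = 0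

/-- The coefficients of the Euler form at `α` of the operator with coefficients `c`. -/
def eulerCoeff (n : ℕ) (c : ℕ → Polynomial ℂ) (α : ℂ) (i : ℕ) : ℂ⟦X⟧ :=
  taylor (fun z => (c i).eval z) α * PowerSeries.X ^ (n - i)

lemma eulerCoeff_ne_zero {n : ℕ} {c : ℕ → Polynomial ℂ} (hc : c n ≠ 0) (α : ℂ) :
    eulerCoeff n c α n ≠ 0 := by
  intro h0
  rw [eulerCoeff, Nat.sub_self, pow_zero, mul_one] at h0
  have h1 := eventually_eq_zero_of_taylor_eq_zero (analyticAt_polynomial_eval _ _) h0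
  refine hc (Polynomial.eq_zero_of_infinite_isRoot _ ?_)
  exact infinite_of_mem_nhds α h1

/-- The product `(z - α) ^ (N + i) * g⁽ⁱ⁾` extends analytically across `α`, because it is obtained
from `k` by the recursion `e ↦ (z - α) e' - (N + i) e`, the same as in `eulerProd_succ`. -/
lemma exists_analyticAt_eulerProd {α : ℂ} {N : ℕ} {k g : ℂ → ℂ} (hk : AnalyticAt ℂ k α)
    (hg : ∀ᶠ z in 𝓝[≠] α, AnalyticAt ℂ g z ∧ k z = (z - α) ^ N * g z) (i : ℕ) :
    ∃ e : ℂ → ℂ, AnalyticAt ℂ e α ∧ taylor e α = eulerProd N i (taylor k α) ∧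
      ∀ᶠ z in 𝓝[≠] α, e z = (z - α) ^ (N + i) * iteratedDeriv i g z := by
  induction i with
  | zero => exact ⟨k, hk, (eulerProd_zero _ _).symm, by
      filter_upwards [hg] with z hz; simpa using hz.2⟩
  | succ i ih =>
    obtain ⟨e, he, het, hez⟩ := ih
    refine ⟨fun z => (z - α) * deriv e z + (-((N + i : ℕ) : ℂ)) * e z,
      ((analyticAt_sub_const α α).fun_mul he.deriv).add (analyticAt_const.fun_mul he), ?_, ?_⟩
    · rw [taylor_add ((analyticAt_sub_const α α).fun_mul he.deriv) (analyticAt_const.fun_mul he),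
        taylor_mul (f := fun z => z - α) (analyticAt_sub_const α α) he.deriv,
        taylor_sub_self, taylor_deriv, taylor_const_mul, het, eulerProd_succ, neg_smul, sub_eq_add_neg]
    · have hez' := eventually_eventually_nhdsWithin.mpr hez
      filter_upwards [hez', hg, hez, self_mem_nhdsWithin] with z hz hgz hez1 hzα
      have h1 : e =ᶠ[𝓝 z] fun z => (z - α) ^ (N + i) * iteratedDeriv i g z := by
        have : 𝓝[{α}ᶜ] z = 𝓝 z := isOpen_compl_singleton.nhdsWithin_eq hzα
        rwa [this] at hz
      have hd : HasDerivAt (fun z => (z - α) ^ (N + i)) (((N + i : ℕ) : ℂ) * (z - α) ^ (N + i - 1) * 1) z :=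
        ((hasDerivAt_id z).sub_const α).pow (N + i)
      have hd2 : HasDerivAt (iteratedDeriv i g) (iteratedDeriv (i + 1) g z) z := by
        rw [iteratedDeriv_succ]
        exact (analyticAt_iteratedDeriv hgz.1 i).differentiableAt.hasDerivAt
      rw [h1.deriv_eq, (hd.fun_mul hd2).deriv, hez1]
      rcases Nat.eq_zero_or_pos (N + i) with h0 | h0
      · rw [← add_assoc, h0]; simp
      · obtain ⟨m, hm⟩ := Nat.exists_eq_succ_of_ne_zero h0.ne'
        rw [← add_assoc, hm]
        simp only [Nat.succ_eq_add_one, Nat.add_sub_cancel]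
        ring

/-- Off `α` the Euler form applied to `k` is `(z - α) ^ (N + n)` times the original equation for
`g`, hence zero; being analytic at `α`, it vanishes there identically. Meromorphic solutions are
thus handled through power series. -/
lemma eulerOp_taylor_eq_zero {n N : ℕ} {c : ℕ → Polynomial ℂ} {α : ℂ} {k g : ℂ → ℂ}
    (hk : AnalyticAt ℂ k α)
    (hg : ∀ᶠ z in 𝓝[≠] α, PolySol n c g z ∧ k z = (z - α) ^ N * g z) :
    eulerOp n N (eulerCoeff n c α) (taylor k α) = 0 := by
  choose e he het hez using exists_analyticAt_eulerProd hk (hg.mono fun z hz => ⟨hz.1.1, hz.2⟩)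
  have hana : ∀ i, AnalyticAt ℂ (fun z => (c i).eval z * (z - α) ^ (n - i)) α := fun i =>
    (analyticAt_polynomial_eval _ _).fun_mul ((analyticAt_sub_const α α).fun_pow _)
  have h1 : eulerOp n N (eulerCoeff n c α) (taylor k α) =
      taylor (fun z => ∑ i ∈ Finset.range (n + 1), (c i).eval z * (z - α) ^ (n - i) * e i z) α := by
    rw [eulerOp_apply, taylor_sum _ fun i _ => (hana i).fun_mul (he i)]
    refine Finset.sum_congr rfl fun i _ => ?_
    rw [taylor_mul (hana i) (he i), het, taylor_mul (analyticAt_polynomial_eval _ _)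
      ((analyticAt_sub_const α α).fun_pow _),
      taylor_pow (f := fun z => z - α) (analyticAt_sub_const α α), taylor_sub_self, eulerCoeff]
  have hF : AnalyticAt ℂ
      (fun z => ∑ i ∈ Finset.range (n + 1), (c i).eval z * (z - α) ^ (n - i) * e i z) α :=
    Finset.analyticAt_fun_sum _ fun i _ => (hana i).fun_mul (he i)
  rw [h1, ← taylor_zero α]
  refine taylor_congr ?_
  refine (hF.frequently_eq_iff_eventually_eq analyticAt_const).mp (Eventually.frequently ?_)
  have hez' : ∀ᶠ z in 𝓝[≠] α, ∀ i ∈ Finset.range (n + 1),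
      e i z = (z - α) ^ (N + i) * iteratedDeriv i g z :=
    (Finset.eventually_all _).mpr fun i _ => hez i
  filter_upwards [hez', hg] with z hz hgz
  have : ∑ i ∈ Finset.range (n + 1), (c i).eval z * (z - α) ^ (n - i) * e i z =
      (z - α) ^ (N + n) * ∑ i ∈ Finset.range (n + 1), (c i).eval z * iteratedDeriv i g z := by
    rw [Finset.mul_sum]
    refine Finset.sum_congr rfl fun i hi => ?_
    have hin : i ≤ n := Nat.lt_succ_iff.mp (Finset.mem_range.mp hi)
    rw [hz i hi, show N + n = (n - i) + (N + i) by omega, pow_add]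
    ring
  rw [this, hgz.1.2, mul_zero]

lemma eulerOp_formal_eq_zero {n N : ℕ} {c : ℕ → Polynomial ℂ} {f : ℂ⟦X⟧}
    (hf : ∑ i ∈ Finset.range (n + 1), (c i : ℂ⟦X⟧) * (PowerSeries.derivative ℂ)^[i] f = 0) :
    eulerOp n N (eulerCoeff n c 0) (PowerSeries.X ^ N * f) = 0 := by
  have h1 : eulerOp n N (eulerCoeff n c 0) (PowerSeries.X ^ N * f) = PowerSeries.X ^ (N + n) *
      ∑ i ∈ Finset.range (n + 1), (c i : ℂ⟦X⟧) * (PowerSeries.derivative ℂ)^[i] f := by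
    rw [eulerOp_apply, Finset.mul_sum]
    refine Finset.sum_congr rfl fun i hi => ?_
    have hin : i ≤ n := Nat.lt_succ_iff.mp (Finset.mem_range.mp hi)
    rw [eulerProd_X_pow_mul, eulerCoeff, taylor_polynomial_zero,
      show N + n = (n - i) + (N + i) by omega, pow_add]
    ring
  rw [h1, hf, mul_zero]

lemma linearIndependent_taylor {ι : Type*} [Fintype ι] {k : ι → ℂ → ℂ} {α : ℂ}
    (hk : ∀ i, AnalyticAt ℂ (k i) α)
    (hind : ∀ a : ι → ℂ, (∀ᶠ z in 𝓝 α, ∑ i, a i * k i z = 0) → ∀ i, a i = 0) :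
    LinearIndependent ℂ fun i => taylor (k i) α := by
  rw [Fintype.linearIndependent_iff]
  intro a ha
  refine hind a (eventually_eq_zero_of_taylor_eq_zero
    (Finset.analyticAt_fun_sum _ fun i _ => analyticAt_const.fun_mul (hk i)) ?_)
  rw [taylor_sum _ fun i _ => analyticAt_const.fun_mul (hk i)]
  simpa only [taylor_const_mul] using ha

/-! ### Local existence of solutions at nonsingular points -/

/-- The Taylor coefficients of the solution of the linear system `F' = A F`, `F(0) = y`, where `A`
has the Taylor coefficients `A 0, A 1, …`. -/
def systemCoeff {ι : Type*} [Fintype ι] (A : ℕ → ι → ι → ℂ) (y : ι → ℂ) : ℕ → ι → ℂ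
  | 0 => y
  | k + 1 => fun a => (∑ j : Fin (k + 1), ∑ b, A j a b * systemCoeff A y (k - j) b) / (k + 1)
  termination_by k => k
  decreasing_by omega

/-- Majorant method: each of the `k + 1` values of `j` contributes at most `card ι * M * C * K ^ k`,
and the division by `k + 1` in the recursion cancels their number. -/
lemma norm_systemCoeff_le {ι : Type*} [Fintype ι] {A : ℕ → ι → ι → ℂ} {y : ι → ℂ}
    {C M K : ℝ} (hC : 0 ≤ C) (hM : 0 ≤ M) (hA : ∀ j a b, ‖A j a b‖ ≤ M * K ^ j) (hy : ∀ a, ‖y a‖ ≤ C)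
    (hK : Fintype.card ι * M ≤ K) (hK0 : 0 ≤ K) (k : ℕ) (a : ι) : ‖systemCoeff A y k a‖ ≤ C * K ^ k := by
  induction k using Nat.strong_induction_on generalizing a with
  | _ k ih =>
    rcases k with _ | k
    · rw [systemCoeff]; simpa using hy a
    · rw [systemCoeff, norm_div]
      have hk : ‖((k : ℂ) + 1)‖ = k + 1 := by
        rw [← Nat.cast_succ, Complex.norm_natCast]; push_cast; rfl
      rw [hk, div_le_iff₀ (by positivity)]
      calc ‖∑ j : Fin (k + 1), ∑ b, A j a b * systemCoeff A y (k - j) b‖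
          ≤ ∑ j : Fin (k + 1), ∑ b : ι, M * C * K ^ k := by
            refine norm_sum_le_of_le _ fun j _ => norm_sum_le_of_le _ fun b _ => ?_
            have hj : (j : ℕ) ≤ k := Nat.lt_succ_iff.mp j.2
            rw [norm_mul]
            calc _ ≤ (M * K ^ (j : ℕ)) * (C * K ^ (k - j)) :=
                  mul_le_mul (hA _ _ _) (ih _ (by omega) _) (norm_nonneg _) (by positivity)
              _ = M * C * (K ^ (j : ℕ) * K ^ (k - j)) := by ring
              _ = _ := by rw [← pow_add, Nat.add_sub_cancel' hj]
        _ = (Fintype.card ι * M) * (C * K ^ k * (k + 1)) := by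
            simp only [Finset.sum_const, Finset.card_univ, Fintype.card_fin, nsmul_eq_mul]
            push_cast; ring
        _ ≤ K * (C * K ^ k * (k + 1)) := by gcongr
        _ = _ := by ring

/-- Local existence of holomorphic solutions of linear systems of differential equations. -/
lemma exists_system_solution {ι : Type*} [Fintype ι] {A : ι → ι → ℂ → ℂ} {α : ℂ}
    (hA : ∀ a b, AnalyticAt ℂ (A a b) α) (y : ι → ℂ) :
    ∃ F : ι → ℂ → ℂ, (∀ a, AnalyticAt ℂ (F a) α) ∧ (∀ a, F a α = y a) ∧
      ∀ a, ∀ᶠ z in 𝓝 α, deriv (F a) z = ∑ b, A a b z * F b z := by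
  choose C R hC hR hbound using fun a b => exists_norm_coeff_taylor_le (hA a b)
  set M : ℝ := ∑ a, ∑ b, C a b with hM
  have hM0 : 0 ≤ M := Finset.sum_nonneg fun a _ => Finset.sum_nonneg fun b _ => (hC a b).le
  have hCM : ∀ a b, C a b ≤ M := fun a b =>
    (Finset.single_le_sum (f := fun b => C a b) (fun b _ => (hC a b).le) (Finset.mem_univ b)).trans
      (Finset.single_le_sum (f := fun a => ∑ b, C a b)
        (fun a _ => Finset.sum_nonneg fun b _ => (hC a b).le) (Finset.mem_univ a))
  -- `K` must dominate `card ι * M`, for the recursion, and every `R a b`, for the coefficients of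
  -- the system; the `1` keeps it positive.
  set K : ℝ := Fintype.card ι * M + ∑ a, ∑ b, R a b + 1 with hK
  have hR0 : 0 ≤ ∑ a, ∑ b, R a b :=
    Finset.sum_nonneg fun a _ => Finset.sum_nonneg fun b _ => (hR a b).le
  have hcM : 0 ≤ Fintype.card ι * M := by positivity
  have hRK : ∀ a b, R a b ≤ K := fun a b => by
    have := (Finset.single_le_sum (f := fun b => R a b) (fun b _ => (hR a b).le)
      (Finset.mem_univ b)).trans (Finset.single_le_sum (f := fun a => ∑ b, R a b)
        (fun a _ => Finset.sum_nonneg fun b _ => (hR a b).le) (Finset.mem_univ a))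
    linarith
  have hK0 : 0 < K := by linarith
  let A' : ℕ → ι → ι → ℂ := fun j a b => PowerSeries.coeff j (taylor (A a b) α)
  have hbd : ∀ k a, ‖systemCoeff A' y k a‖ ≤ (∑ a, ‖y a‖) * K ^ k := fun k a => by
    refine norm_systemCoeff_le (M := M) (by positivity) hM0 (fun j a b => (hbound a b j).trans ?_)
      (fun a => Finset.single_le_sum (f := fun a => ‖y a‖) (fun a _ => norm_nonneg _)
        (Finset.mem_univ a)) (by linarith) hK0.le k a
    have h1 := (hR a b).le
    have h2 := hRK a b
    have h3 := hCM a b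
    gcongr
  choose F hF hFt using fun a => exists_analyticAt_taylor_eq
    (s := PowerSeries.mk fun k => systemCoeff A' y k a) hK0
    (fun k => by rw [PowerSeries.coeff_mk]; exact hbd k a) α
  refine ⟨F, hF, fun a => ?_, fun a => ?_⟩
  · rw [← constantCoeff_taylor (F a) α, hFt, ← PowerSeries.coeff_zero_eq_constantCoeff_apply,
      PowerSeries.coeff_mk, systemCoeff]
  · have hS : AnalyticAt ℂ (fun z => ∑ b, A a b z * F b z) α :=
      Finset.analyticAt_fun_sum _ fun b _ => (hA a b).fun_mul (hF b)
    have hT : taylor (fun z => deriv (F a) z + (-1) * ∑ b, A a b z * F b z) α = 0 := by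
      rw [taylor_add (hF a).deriv (analyticAt_const.fun_mul hS), taylor_const_mul, taylor_deriv,
        taylor_sum _ fun b _ => (hA a b).fun_mul (hF b), neg_one_smul, ← sub_eq_add_neg, sub_eq_zero]
      ext k
      rw [PowerSeries.coeff_derivative, hFt, PowerSeries.coeff_mk, systemCoeff, map_sum,
        div_mul_cancel₀ _ (by exact_mod_cast k.succ_ne_zero), Finset.sum_comm]
      refine Finset.sum_congr rfl fun b _ => ?_
      rw [taylor_mul (hA a b) (hF b), PowerSeries.coeff_mul, hFt,
        Finset.Nat.sum_antidiagonal_eq_sum_range_succ_mk,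
        Finset.sum_range (fun i => PowerSeries.coeff i (taylor (A a b) α) *
          PowerSeries.coeff (k - i) (PowerSeries.mk fun k => systemCoeff A' y k b))]
      simp [A']
    filter_upwards [eventually_eq_zero_of_taylor_eq_zero
      ((hF a).deriv.fun_add (analyticAt_const.fun_mul hS)) hT] with z hz
    linear_combination hz

/-- At a nonsingular point, a linear differential equation of order `n` has `n` linearly
independent holomorphic solutions. -/
lemma exists_solutions_of_nonsingular {n : ℕ} {c : ℕ → Polynomial ℂ} {α : ℂ} {ρ : ℕ → ℂ → ℂ}
    (hρ : ∀ i < n, AnalyticAt ℂ (ρ i) α)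
    (hc : ∀ i < n, ∀ᶠ z in 𝓝 α, (c i).eval z = ρ i z * (c n).eval z) :
    ∃ h : Fin n → ℂ → ℂ, (∀ j, AnalyticAt ℂ (h j) α) ∧
      (∀ j, ∀ᶠ z in 𝓝 α, PolySol n c (h j) z) ∧
      ∀ a : Fin n → ℂ, (∀ᶠ z in 𝓝 α, ∑ j, a j * h j z = 0) → ∀ j, a j = 0 := by
  rcases n with _ | m
  · exact ⟨fun j => j.elim0, fun j => j.elim0, fun j => j.elim0, fun a _ j => j.elim0⟩
  -- The companion matrix: row `a < m` says `F_a' = F_(a+1)`, and the last row is the equation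
  -- itself.
  let A : Fin (m + 1) → Fin (m + 1) → ℂ → ℂ := fun a b =>
    if (a : ℕ) = m then fun z => -ρ b z else if (b : ℕ) = a + 1 then fun _ => 1 else fun _ => 0
  have hA : ∀ a b, AnalyticAt ℂ (A a b) α := fun a b => by
    simp only [A]
    split_ifs
    · exact (hρ b b.2).fun_neg
    · exact analyticAt_const
    · exact analyticAt_const
  choose F hF hF0 hF' using fun j : Fin (m + 1) =>
    exists_system_solution hA (Pi.single j (1 : ℂ))
  have hiter : ∀ j, ∀ i (hi : i < m + 1), iteratedDeriv i (F j 0) =ᶠ[𝓝 α] F j ⟨i, hi⟩ := by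
    intro j i
    induction i with
    | zero => intro hi; simp
    | succ i ih =>
      intro hi
      have h1 := (ih (by omega)).deriv
      rw [iteratedDeriv_succ]
      filter_upwards [h1, hF' j ⟨i, by omega⟩] with z hz hz2
      rw [hz, hz2, Finset.sum_eq_single ⟨i + 1, hi⟩]
      · have : i ≠ m := by omega
        simp [A, this]
      · intro b _ hb
        have h2 : (b : ℕ) ≠ i + 1 := fun h => hb (Fin.ext h)
        have : i ≠ m := by omega
        simp [A, this, h2]
      · simp
  have htop : ∀ j, ∀ᶠ z in 𝓝 α, iteratedDeriv (m + 1) (F j 0) z =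
      ∑ b : Fin (m + 1), -ρ b z * F j b z := by
    intro j
    have h1 := (hiter j m (by omega)).deriv
    rw [iteratedDeriv_succ]
    filter_upwards [h1, hF' j ⟨m, by omega⟩] with z hz hz2
    rw [hz, hz2]
    simp [A]
  refine ⟨fun j => F j 0, fun j => hF j 0, fun j => ?_, fun a ha => ?_⟩
  · have hall : ∀ᶠ z in 𝓝 α, ∀ i : Fin (m + 1), iteratedDeriv i (F j 0) z = F j i z :=
      eventually_all.mpr fun i => hiter j i i.2
    have hcall : ∀ᶠ z in 𝓝 α, ∀ i : Fin (m + 1), (c i).eval z = ρ i z * (c (m + 1)).eval z :=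
      eventually_all.mpr fun i => hc i i.2
    filter_upwards [htop j, hall, hcall, (hF j 0).eventually_analyticAt] with z h1 h2 h3 h4
    refine ⟨h4, ?_⟩
    rw [Finset.sum_range_succ, h1, Finset.sum_range (fun i => (c i).eval z * iteratedDeriv i (F j 0) z),
      Finset.mul_sum, ← Finset.sum_add_distrib]
    refine Finset.sum_eq_zero fun i _ => ?_
    rw [h2, h3]
    ring
  -- The initial vector of the `j`th solution is the `j`th unit vector, so the Taylor coefficient of
  -- index `i` isolates `a i`.
  · intro i
    have h1 : (fun z => ∑ j, a j * F j 0 z) =ᶠ[𝓝 α] fun _ => 0 := ha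
    have h2 := congrArg (PowerSeries.coeff (i : ℕ)) (taylor_congr h1)
    rw [taylor_sum _ fun j _ => analyticAt_const.fun_mul (hF j 0), taylor_zero, map_sum, map_zero] at h2
    have h3 : ∀ j, PowerSeries.coeff (i : ℕ) (taylor (fun z => a j * F j 0 z) α) =
        a j * ((Pi.single j (1 : ℂ) : Fin (m + 1) → ℂ) i / ((i : ℕ).factorial : ℂ)) := fun j => by
      rw [taylor_const_mul, map_smul, coeff_taylor, (hiter j i i.2).eq_of_nhds, hF0, smul_eq_mul]
    rw [Finset.sum_congr rfl fun j _ => h3 j, Finset.sum_eq_single i] at h2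
    · rw [Pi.single_eq_same, mul_eq_zero] at h2
      exact h2.resolve_right (by
        exact div_ne_zero one_ne_zero (by exact_mod_cast (i : ℕ).factorial_ne_zero))
    · intro j _ hj
      rw [Pi.single_eq_of_ne hj.symm]; simp
    · simp

/-! ### Analytic continuation over the closed disc -/

/-- Extensions from two centres agree where their balls meet: the midpoint of the centres lies in
both balls and, by convexity, in the old disc, where both equal `M`. The identity theorem does the
rest. -/
lemma exists_continuation_step {S : (ℂ → ℂ) → ℂ → Prop} (hSan : ∀ M z, S M z → AnalyticAt ℂ M z)
    (hScongr : ∀ M M' z, M =ᶠ[𝓝 z] M' → S M z → S M' z) {δ : ℝ} (hδ : 0 < δ)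
    (hext : ∀ w ∈ Metric.closedBall (0 : ℂ) 1, ∀ M, S M w →
      ∃ M', (∀ v ∈ Metric.ball w δ, S M' v) ∧ M' =ᶠ[𝓝 w] M)
    {r : ℝ} (hr0 : 0 < r) (hr1 : r ≤ 1) {M : ℂ → ℂ} (hM : ∀ z ∈ Metric.ball (0 : ℂ) r, S M z) :
    ∃ M', (∀ z ∈ Metric.ball (0 : ℂ) (r + δ / 2), S M' z) ∧ M' =ᶠ[𝓝 0] M := by
  have hsub : Metric.ball (0 : ℂ) r ⊆ Metric.closedBall 0 1 :=
    Metric.ball_subset_closedBall.trans (Metric.closedBall_subset_closedBall hr1)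
  choose! s hs hsM using fun z (hz : z ∈ Metric.ball (0 : ℂ) r) => hext z (hsub hz) M (hM z hz)
  have hagree : ∀ z ∈ Metric.ball (0 : ℂ) r,
      Set.EqOn (s z) M (Metric.ball z δ ∩ Metric.ball 0 r) := fun z hz =>
    AnalyticOnNhd.eqOn_of_preconnected_of_eventuallyEq (fun v hv => hSan _ _ (hs z hz v hv.1))
      (fun v hv => hSan _ _ (hM v hv.2))
      ((convex_ball z δ).inter (convex_ball 0 r)).isPreconnected
      ⟨Metric.mem_ball_self hδ, hz⟩ (hsM z hz)
  have hagree2 : ∀ z ∈ Metric.ball (0 : ℂ) r, ∀ z' ∈ Metric.ball (0 : ℂ) r,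
      Set.EqOn (s z) (s z') (Metric.ball z δ ∩ Metric.ball z' δ) := by
    intro z hz z' hz' v hv
    set m := midpoint ℝ z z' with hm
    have hm0 : m ∈ Metric.ball (0 : ℂ) r := (convex_ball _ _).midpoint_mem hz hz'
    have hzz : dist z z' < 2 * δ := by
      have h1 := Metric.mem_ball'.mp hv.1
      have h2 := Metric.mem_ball.mp hv.2
      linarith [dist_triangle z v z']
    have hmz : m ∈ Metric.ball z δ := by
      rw [Metric.mem_ball, hm, dist_midpoint_left, Real.norm_ofNat]; linarith
    have hmz' : m ∈ Metric.ball z' δ := by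
      rw [Metric.mem_ball, hm, dist_midpoint_right, Real.norm_ofNat]; linarith
    refine AnalyticOnNhd.eqOn_of_preconnected_of_eventuallyEq
      (fun v hv => hSan _ _ (hs z hz v hv.1)) (fun v hv => hSan _ _ (hs z' hz' v hv.2))
      ((convex_ball z δ).inter (convex_ball z' δ)).isPreconnected ⟨hmz, hmz'⟩ ?_ hv
    filter_upwards [Metric.isOpen_ball.mem_nhds hmz, Metric.isOpen_ball.mem_nhds hmz',
      Metric.isOpen_ball.mem_nhds hm0] with u hu hu' hu0
    rw [hagree z hz ⟨hu, hu0⟩, hagree z' hz' ⟨hu', hu0⟩]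
  -- Scaling by `t` maps the larger disc into the old one and moves each point by less than `δ / 2`,
  -- so `t * w` serves as a centre whose extension is defined at `w`.
  set t : ℝ := r / (r + δ / 2) with ht
  have hrδ : 0 < r + δ / 2 := by linarith
  have ht0 : 0 < t := div_pos hr0 hrδ
  have ht1 : 1 - t = (δ / 2) / (r + δ / 2) := by rw [ht]; field_simp; ring
  have hc : ∀ w ∈ Metric.ball (0 : ℂ) (r + δ / 2), (t : ℂ) * w ∈ Metric.ball (0 : ℂ) r ∧
      w ∈ Metric.ball ((t : ℂ) * w) δ := by
    intro w hw
    rw [mem_ball_zero_iff] at hw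
    constructor
    · rw [mem_ball_zero_iff, norm_mul, Complex.norm_real, Real.norm_of_nonneg ht0.le]
      calc t * ‖w‖ < t * (r + δ / 2) := by gcongr
        _ = r := by rw [ht]; field_simp
    · have hpos : 0 < 1 - t := by rw [ht1]; positivity
      rw [Metric.mem_ball, dist_eq_norm, show w - t * w = ((1 - t : ℝ) : ℂ) * w by push_cast; ring,
        norm_mul, Complex.norm_real, Real.norm_of_nonneg hpos.le]
      calc (1 - t) * ‖w‖ < (1 - t) * (r + δ / 2) := by gcongr
        _ = δ / 2 := by rw [ht1]; field_simp
        _ < δ := by linarith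
  have hloc : ∀ w ∈ Metric.ball (0 : ℂ) (r + δ / 2),
      s (t * w) =ᶠ[𝓝 w] fun w => s (t * w) w := by
    intro w hw
    filter_upwards [Metric.isOpen_ball.mem_nhds hw, Metric.isOpen_ball.mem_nhds (hc w hw).2]
      with v hv hv2
    exact hagree2 _ (hc w hw).1 _ (hc v hv).1 ⟨hv2, (hc v hv).2⟩
  refine ⟨fun w => s (t * w) w, fun w hw =>
    hScongr _ _ _ (hloc w hw) (hs _ (hc w hw).1 _ (hc w hw).2), ?_⟩
  have h0 := (hloc 0 (Metric.mem_ball_self hrδ)).symm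
  have h1 := hsM 0 (Metric.mem_ball_self hr0)
  rw [mul_zero] at h0
  exact h0.trans h1

/-- Analytic continuation over the closed unit disc of germs that continue locally. -/
lemma exists_continuation {S : (ℂ → ℂ) → ℂ → Prop} (hSan : ∀ M z, S M z → AnalyticAt ℂ M z)
    (hScongr : ∀ M M' z, M =ᶠ[𝓝 z] M' → S M z → S M' z)
    (hext : ∀ z ∈ Metric.closedBall (0 : ℂ) 1, ∃ ρ > 0, ∀ w ∈ Metric.ball z ρ, ∀ M, S M w →
      ∃ M', (∀ v ∈ Metric.ball z ρ, S M' v) ∧ M' =ᶠ[𝓝 w] M)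
    {M₀ : ℂ → ℂ} (h0 : S M₀ 0) :
    ∃ M, (∀ z ∈ Metric.closedBall (0 : ℂ) 1, S M z) ∧ M =ᶠ[𝓝 0] M₀ := by
  choose! ρ hρ hext using hext
  -- A Lebesgue number makes the radius of local extension uniform, so finitely many steps of length
  -- `δ / 2` pass the unit circle.
  obtain ⟨δ, hδ, hcov⟩ := lebesgue_number_lemma_of_metric
    (c := fun z : Metric.closedBall (0 : ℂ) 1 => Metric.ball (z : ℂ) (ρ z))
    (isCompact_closedBall (0 : ℂ) 1) (fun _ => Metric.isOpen_ball)
    (fun z hz => Set.mem_iUnion.mpr ⟨⟨z, hz⟩, Metric.mem_ball_self (hρ z hz)⟩)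
  have hext' : ∀ w ∈ Metric.closedBall (0 : ℂ) 1, ∀ M, S M w →
      ∃ M', (∀ v ∈ Metric.ball w δ, S M' v) ∧ M' =ᶠ[𝓝 w] M := by
    intro w hw M hM
    obtain ⟨⟨z, hz⟩, hsub⟩ := hcov w hw
    obtain ⟨M', hM', hg⟩ := hext z hz w (hsub (Metric.mem_ball_self hδ)) M hM
    exact ⟨M', fun v hv => hM' v (hsub hv), hg⟩
  have hind : ∀ k : ℕ, ∃ r : ℝ, 0 < r ∧ (1 < r ∨ k * (δ / 2) ≤ r) ∧
      ∃ M, (∀ z ∈ Metric.ball (0 : ℂ) r, S M z) ∧ M =ᶠ[𝓝 0] M₀ := by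
    intro k
    induction k with
    | zero =>
      obtain ⟨M, hM, hg⟩ := hext' 0 (by simp) M₀ h0
      exact ⟨δ, hδ, Or.inr (by simpa using hδ.le), M, hM, hg⟩
    | succ k ih =>
      obtain ⟨r, hr, hrk, M, hM, hg⟩ := ih
      rcases lt_or_ge 1 r with h1 | h1
      · exact ⟨r, hr, Or.inl h1, M, hM, hg⟩
      · obtain ⟨M', hM', hg'⟩ := exists_continuation_step hSan hScongr hδ hext' hr h1 hM
        refine ⟨r + δ / 2, by linarith, Or.inr ?_, M', hM', hg'.trans hg⟩
        have := hrk.resolve_left (not_lt.mpr h1)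
        push_cast
        linarith
  obtain ⟨k, hk⟩ := exists_nat_gt (1 / (δ / 2))
  obtain ⟨r, -, hrk, M, hM, hg⟩ := hind k
  have hr1 : 1 < r := by
    refine hrk.elim id fun h => lt_of_lt_of_le ?_ h
    rwa [div_lt_iff₀ (by linarith)] at hk
  exact ⟨M, fun z hz => hM z (Metric.closedBall_subset_ball hr1 hz), hg⟩

/-! ### Solutions with cleared poles and their continuation along `φ` -/

lemma PolySol.congr {n : ℕ} {c : ℕ → Polynomial ℂ} {g g' : ℂ → ℂ} {z : ℂ} (h : PolySol n c g z)
    (hg : g =ᶠ[𝓝 z] g') : PolySol n c g' z := by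
  refine ⟨h.1.congr hg, ?_⟩
  rw [← h.2]
  exact Finset.sum_congr rfl fun i _ => by rw [(hg.iteratedDeriv i).eq_of_nhds]

lemma eventually_nhdsNE_polySol_congr {n : ℕ} {c : ℕ → Polynomial ℂ} {g g' : ℂ → ℂ} {α : ℂ}
    (h : ∀ᶠ z in 𝓝[≠] α, PolySol n c g z) (hg : ∀ᶠ z in 𝓝[≠] α, g z = g' z) :
    ∀ᶠ z in 𝓝[≠] α, PolySol n c g' z := by
  filter_upwards [h, eventually_eventually_nhdsWithin.mpr hg, self_mem_nhdsWithin] with z hz hz2 hz3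
  rw [isOpen_compl_singleton.nhdsWithin_eq hz3] at hz2
  exact hz.congr hz2

lemma PolySol.sum {ι : Type*} [Fintype ι] {n : ℕ} {c : ℕ → Polynomial ℂ} {g : ι → ℂ → ℂ} {z : ℂ}
    (h : ∀ j, PolySol n c (g j) z) (a : ι → ℂ) : PolySol n c (fun z => ∑ j, a j * g j z) z := by
  refine ⟨Finset.analyticAt_fun_sum _ fun j _ => analyticAt_const.fun_mul (h j).1, ?_⟩
  have h1 : ∀ i, iteratedDeriv i (fun z => ∑ j, a j * g j z) z =
      ∑ j, a j * iteratedDeriv i (g j) z := fun i => by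
    rw [iteratedDeriv_fun_sum fun j _ => (analyticAt_const.fun_mul (h j).1).contDiffAt]
    exact Finset.sum_congr rfl fun j _ => iteratedDeriv_const_mul_field _ _
  calc _ = ∑ j, a j * ∑ i ∈ Finset.range (n + 1), (c i).eval z * iteratedDeriv i (g j) z := by
        simp only [h1, Finset.mul_sum]
        rw [Finset.sum_comm]
        exact Finset.sum_congr rfl fun j _ => Finset.sum_congr rfl fun i _ => by ring
    _ = 0 := Finset.sum_eq_zero fun j _ => by rw [(h j).2, mul_zero]

lemma eventually_nhdsNE_eval_ne_zero {Q : Polynomial ℂ} (hQ : Q ≠ 0) (α : ℂ) :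
    ∀ᶠ z in 𝓝[≠] α, Q.eval z ≠ 0 := by
  have h1 : ({z | Q.IsRoot z} \ {α}).Finite :=
    (Polynomial.finite_setOfPred_isRoot hQ).subset Set.sdiff_subset
  have h2 := h1.isClosed.isOpen_compl.mem_nhds (x := α) (by simp)
  filter_upwards [nhdsWithin_le_nhds h2, self_mem_nhdsWithin] with z hz hz2 h0
  exact hz ⟨h0, hz2⟩

/-- Solutions `h / Q` with `h` analytic at `β` lie in the span of any `n` independent ones. -/
lemma exists_eventuallyEq_sum {n : ℕ} {c : ℕ → Polynomial ℂ} (hc : c n ≠ 0) {Q : Polynomial ℂ}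
    (hQ : Q ≠ 0) {β : ℂ} {h : Fin n → ℂ → ℂ} (hh : ∀ j, AnalyticAt ℂ (h j) β)
    (hsol : ∀ j, ∀ᶠ z in 𝓝[≠] β, PolySol n c (fun z => h j z / Q.eval z) z)
    (hind : ∀ a : Fin n → ℂ, (∀ᶠ z in 𝓝 β, ∑ j, a j * h j z = 0) → ∀ j, a j = 0)
    {k : ℂ → ℂ} (hk : AnalyticAt ℂ k β)
    (hksol : ∀ᶠ z in 𝓝[≠] β, PolySol n c (fun z => k z / Q.eval z) z) :
    ∃ a : Fin n → ℂ, k =ᶠ[𝓝 β] fun z => ∑ j, a j * h j z := by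
  -- With `Q = (z - β) ^ N * R` and `R(β) ≠ 0`, the function `u / R = (z - β) ^ N * (u / Q)` is
  -- analytic at `β`, as the Euler form with shift `N` requires.
  obtain ⟨R, hR, hRβ⟩ := Polynomial.exists_eq_pow_rootMultiplicity_mul_and_not_dvd Q hQ β
  set N := Q.rootMultiplicity β
  have hRe : R.eval β ≠ 0 := fun h => hRβ (Polynomial.dvd_iff_isRoot.mpr h)
  have hRa := analyticAt_polynomial_eval R β
  have hRnz : ∀ᶠ z in 𝓝 β, R.eval z ≠ 0 := hRa.continuousAt.eventually_ne hRe
  have hker : ∀ u : ℂ → ℂ, AnalyticAt ℂ u β →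
      (∀ᶠ z in 𝓝[≠] β, PolySol n c (fun z => u z / Q.eval z) z) →
      eulerOp n N (eulerCoeff n c β) (taylor (fun z => u z / R.eval z) β) = 0 := by
    intro u hu husol
    refine eulerOp_taylor_eq_zero (hu.fun_div hRa hRe) (g := fun z => u z / Q.eval z) ?_
    filter_upwards [husol, nhdsWithin_le_nhds hRnz, self_mem_nhdsWithin] with z hz hz2 hz3
    refine ⟨hz, ?_⟩
    have : z - β ≠ 0 := sub_ne_zero.mpr hz3
    have hQz : Q.eval z = (z - β) ^ N * R.eval z := by rw [hR]; simp
    rw [hQz]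
    field_simp
  have hli : LinearIndependent ℂ fun j => taylor (fun z => h j z / R.eval z) β := by
    refine linearIndependent_taylor (fun j => (hh j).fun_div hRa hRe) fun a ha => hind a ?_
    filter_upwards [ha, hRnz] with z hz hz2
    simp only [← mul_div_assoc] at hz
    rw [← Finset.sum_div, div_eq_zero_iff] at hz
    exact hz.resolve_right hz2
  obtain ⟨a, ha⟩ := exists_eq_sum_of_mem_ker (eulerCoeff_ne_zero hc β) hli
    (fun j => hker _ (hh j) (hsol j)) (hker k hk hksol)
  refine ⟨a, ?_⟩
  have hsum : AnalyticAt ℂ (fun z => ∑ j, a j * (h j z / R.eval z)) β :=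
    Finset.analyticAt_fun_sum _ fun j _ => analyticAt_const.fun_mul ((hh j).fun_div hRa hRe)
  have hT : taylor (fun z => k z / R.eval z + (-1) * ∑ j, a j * (h j z / R.eval z)) β = 0 := by
    rw [taylor_add (hk.fun_div hRa hRe) (analyticAt_const.fun_mul hsum), taylor_const_mul,
      taylor_sum _ fun j _ => analyticAt_const.fun_mul ((hh j).fun_div hRa hRe), ha]
    simp only [taylor_const_mul]
    simp
  filter_upwards [hRnz, eventually_eq_zero_of_taylor_eq_zero
    ((hk.fun_div hRa hRe).fun_add (analyticAt_const.fun_mul hsum)) hT] with z hz hz2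
  simp only [← mul_div_assoc] at hz2
  rw [← Finset.sum_div, neg_one_mul, ← sub_eq_add_neg, ← sub_div, div_eq_zero_iff] at hz2
  exact sub_eq_zero.mp (hz2.resolve_right hz)

/-- A basis of solutions near `α` is a basis of solutions near all `β` in some ball around `α`. -/
lemma exists_ball_basis {n : ℕ} {c : ℕ → Polynomial ℂ} (hc : c n ≠ 0) {Q : Polynomial ℂ}
    (hQ : Q ≠ 0) {α : ℂ} {h : Fin n → ℂ → ℂ} (hh : ∀ j, AnalyticAt ℂ (h j) α)
    (hsol : ∀ j, ∀ᶠ z in 𝓝[≠] α, PolySol n c (fun z => h j z / Q.eval z) z)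
    (hind : ∀ a : Fin n → ℂ, (∀ᶠ z in 𝓝 α, ∑ j, a j * h j z = 0) → ∀ j, a j = 0) :
    ∃ ρ > 0, (∀ j, AnalyticOnNhd ℂ (h j) (Metric.ball α ρ)) ∧
      (∀ j, ∀ β ∈ Metric.ball α ρ, ∀ᶠ z in 𝓝[≠] β, PolySol n c (fun z => h j z / Q.eval z) z) ∧
      ∀ β ∈ Metric.ball α ρ, ∀ k : ℂ → ℂ, AnalyticAt ℂ k β →
        (∀ᶠ z in 𝓝[≠] β, PolySol n c (fun z => k z / Q.eval z) z) →
        ∃ a : Fin n → ℂ, k =ᶠ[𝓝 β] fun z => ∑ j, a j * h j z := by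
  have h1 : ∀ᶠ z in 𝓝 α, ∀ j, AnalyticAt ℂ (h j) z ∧
      (z ≠ α → PolySol n c (fun z => h j z / Q.eval z) z) :=
    eventually_all.mpr fun j => (hh j).eventually_analyticAt.and
      (eventually_nhdsWithin_iff.mp (hsol j))
  obtain ⟨ρ, hρ, hball⟩ := Metric.eventually_nhds_iff_ball.mp h1
  have han : ∀ j, AnalyticOnNhd ℂ (h j) (Metric.ball α ρ) := fun j z hz => (hball z hz j).1
  have hps : ∀ j, ∀ β ∈ Metric.ball α ρ, ∀ᶠ z in 𝓝[≠] β,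
      PolySol n c (fun z => h j z / Q.eval z) z := by
    intro j β hβ
    by_cases hβα : β = α
    · rw [hβα]; exact hsol j
    · filter_upwards [nhdsWithin_le_nhds (Metric.isOpen_ball.mem_nhds hβ),
        nhdsWithin_le_nhds (isOpen_ne.mem_nhds hβα)] with z hz hz2
      exact (hball z hz j).2 hz2
  refine ⟨ρ, hρ, han, hps, fun β hβ k hk hksol =>
    exists_eventuallyEq_sum hc hQ (fun j => han j β hβ) (fun j => hps j β hβ) (fun a ha => ?_) hk hksol⟩
  refine hind a ?_
  -- A relation near `β` propagates through the ball to `α` by the identity theorem.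
  have hz := AnalyticOnNhd.eqOn_zero_of_preconnected_of_eventuallyEq_zero
    (f := fun z => ∑ j, a j * h j z)
    (fun z hz => Finset.analyticAt_fun_sum _ fun j _ => analyticAt_const.fun_mul (han j z hz))
    (convex_ball α ρ).isPreconnected hβ ha
  filter_upwards [Metric.ball_mem_nhds α hρ] with z hz'
  exact hz hz'

/-- Continuation of a solution `h / Q` along `φ`. -/
lemma exists_continuation_comp {n : ℕ} {c : ℕ → Polynomial ℂ} (hc : c n ≠ 0) {Q : Polynomial ℂ}
    (hQ : Q ≠ 0) {U : Set ℂ} (hbasis : ∀ α ∈ U, ∃ h : Fin n → ℂ → ℂ, (∀ j, AnalyticAt ℂ (h j) α) ∧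
      (∀ j, ∀ᶠ z in 𝓝[≠] α, PolySol n c (fun z => h j z / Q.eval z) z) ∧
      ∀ a : Fin n → ℂ, (∀ᶠ z in 𝓝 α, ∑ j, a j * h j z = 0) → ∀ j, a j = 0)
    {φ : ℂ → ℂ} (hφ : AnalyticOnNhd ℂ φ (Metric.closedBall 0 1))
    (hφU : Set.MapsTo φ (Metric.closedBall 0 1) U) {k : ℂ → ℂ} (hk : AnalyticAt ℂ k (φ 0))
    (hksol : ∀ᶠ z in 𝓝[≠] (φ 0), PolySol n c (fun z => k z / Q.eval z) z) :
    ∃ M, AnalyticOnNhd ℂ M (Metric.closedBall 0 1) ∧ M =ᶠ[𝓝 0] fun z => k (φ z) := by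
  -- The condition is put on a germ `k` at `φ z` in the target, so `φ` need not be inverted and may
  -- have critical points.
  let S : (ℂ → ℂ) → ℂ → Prop := fun M z => AnalyticAt ℂ φ z ∧ ∃ k, AnalyticAt ℂ k (φ z) ∧
    (∀ᶠ z in 𝓝[≠] (φ z), PolySol n c (fun z => k z / Q.eval z) z) ∧ M =ᶠ[𝓝 z] fun z => k (φ z)
  have hSan : ∀ M z, S M z → AnalyticAt ℂ M z := by
    rintro M z ⟨hφz, k, hk, -, hM⟩
    exact (hk.comp hφz).congr hM.symm
  suffices hext : ∀ z ∈ Metric.closedBall (0 : ℂ) 1, ∃ ρ > 0, ∀ w ∈ Metric.ball z ρ, ∀ M, S M w →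
      ∃ M', (∀ v ∈ Metric.ball z ρ, S M' v) ∧ M' =ᶠ[𝓝 w] M by
    obtain ⟨M, hM, hg⟩ := exists_continuation hSan
      (fun M M' z hMM' ⟨hφz, k, hk, hks, hM⟩ => ⟨hφz, k, hk, hks, hMM'.symm.trans hM⟩) hext
      (M₀ := fun z => k (φ z)) ⟨hφ 0 (by simp), k, hk, hksol, EventuallyEq.rfl⟩
    exact ⟨M, fun z hz => hSan _ _ (hM z hz), hg⟩
  intro z hz
  obtain ⟨h, hh, hsol, hind⟩ := hbasis _ (hφU hz)
  obtain ⟨ρ, hρ, han, hps, hspan⟩ := exists_ball_basis hc hQ hh hsol hind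
  obtain ⟨ε, hε, hball⟩ := Metric.eventually_nhds_iff_ball.mp ((hφ z hz).eventually_analyticAt.and
    ((hφ z hz).continuousAt.eventually (Metric.ball_mem_nhds _ hρ)))
  refine ⟨ε, hε, ?_⟩
  rintro w hw M ⟨hφw, k, hk, hks, hM⟩
  obtain ⟨a, ha⟩ := hspan _ (hball w hw).2 k hk hks
  refine ⟨fun z => ∑ j, a j * h j (φ z), fun v hv => ⟨(hball v hv).1, fun z => ∑ j, a j * h j z,
    ?_, ?_, EventuallyEq.rfl⟩, ?_⟩
  · exact Finset.analyticAt_fun_sum _ fun j _ => analyticAt_const.fun_mul (han j _ (hball v hv).2)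
  · filter_upwards [eventually_all.mpr fun j => hps j _ (hball v hv).2] with u hu
    refine (PolySol.sum hu a).congr (Eventually.of_forall fun x => ?_)
    simp only [Finset.sum_div, mul_div_assoc]
  · refine EventuallyEq.trans ?_ hM.symm
    filter_upwards [hφw.continuousAt.eventually ha] with v hv
    exact hv.symm

/-! ### Meromorphic continuation of the elements of `𝓗` along `φ` -/

lemma iterate_derivative_map {R S : Type*} [CommRing R] [CommRing S] (σ : R →+* S) (f : R⟦X⟧)
    (n : ℕ) : (PowerSeries.derivative S)^[n] (f.map σ) =
      ((PowerSeries.derivative R)^[n] f).map σ := by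
  induction n with
  | zero => rfl
  | succ n ih =>
    rw [Function.iterate_succ_apply', Function.iterate_succ_apply', ih]
    ext k
    simp [PowerSeries.coeff_derivative]

/-- Clearing denominators in a differential operator over `ℚ̄(x)`. -/
lemma DiffOp.exists_polynomial_coeff (L : DiffOp) : ∃ c : ℕ → Polynomial ℂ, c L.order ≠ 0 ∧
    (∀ α g, L.IsSolutionNear α g → ∀ᶠ z in 𝓝[≠] α, PolySol L.order c g z) ∧
    (∀ f : Qbar⟦X⟧, L.applyFormal f = 0 → ∑ i ∈ Finset.range (L.order + 1),
      (c i : ℂ⟦X⟧) * (PowerSeries.derivative ℂ)^[i] (f.map (algebraMap Qbar ℂ)) = 0) ∧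
    ∀ α, ¬ L.IsSingularPoint α → ∃ ρ : ℕ → ℂ → ℂ, (∀ i < L.order, AnalyticAt ℂ (ρ i) α) ∧
      ∀ i < L.order, ∀ᶠ z in 𝓝 α, (c i).eval z = ρ i z * (c L.order).eval z := by
  classical
  -- `b` is a common denominator, and `c' i` is `b * L.coeff i` as a polynomial.
  obtain ⟨⟨b, hb⟩, hintg⟩ := IsLocalization.exist_integer_multiples
    (nonZeroDivisors (Polynomial Qbar)) Finset.univ L.coeff
  have hb0 : b ≠ 0 := nonZeroDivisors.ne_zero hb
  choose c' hc' using fun i => hintg i (Finset.mem_univ i)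
  have hc'' : ∀ i, algebraMap (Polynomial Qbar) (RatFunc Qbar) (c' i) =
      algebraMap (Polynomial Qbar) (RatFunc Qbar) b * L.coeff i := fun i => by
    rw [hc' i, ← Algebra.smul_def]
  have hinj := IsFractionRing.injective (Polynomial Qbar) (RatFunc Qbar)
  have hcd : ∀ i, c' i * (L.coeff i).denom = b * (L.coeff i).num := fun i => by
    apply hinj
    have h1 : algebraMap (Polynomial Qbar) (RatFunc Qbar) (L.coeff i).denom ≠ 0 :=
      (map_ne_zero_iff _ hinj).mpr (L.coeff i).denom_ne_zero
    have h2 := RatFunc.num_div_denom (L.coeff i)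
    rw [map_mul, map_mul, hc'', mul_assoc]
    congr 1
    nth_rewrite 1 [← h2]
    exact div_mul_cancel₀ _ h1
  have hlast0 : c' (Fin.last _) ≠ 0 := fun h => by
    have := hc'' (Fin.last _)
    rw [h, map_zero] at this
    exact (mul_ne_zero ((map_ne_zero_iff _ hinj).mpr hb0) L.lead_ne_zero) this.symm
  let c : ℕ → Polynomial ℂ := fun i =>
    if h : i < L.order + 1 then (c' ⟨i, h⟩).map (algebraMap Qbar ℂ) else 0
  have hcfin : ∀ i : Fin (L.order + 1), c i = (c' i).map (algebraMap Qbar ℂ) := fun i => by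
    simp only [c, i.2, dif_pos]
  have hcn : c L.order = (c' (Fin.last _)).map (algebraMap Qbar ℂ) := hcfin (Fin.last _)
  refine ⟨c, ?_, ?_, ?_, ?_⟩
  · rw [hcn]
    exact (Polynomial.map_ne_zero_iff (algebraMap Qbar ℂ).injective).mpr hlast0
  · intro α g hg
    have hden : ∀ᶠ z in 𝓝[≠] α, ∀ i, ((L.coeff i).denom.map (algebraMap Qbar ℂ)).eval z ≠ 0 :=
      eventually_all.mpr fun i => eventually_nhdsNE_eval_ne_zero
        ((Polynomial.map_ne_zero_iff (algebraMap Qbar ℂ).injective).mpr (L.coeff i).denom_ne_zero) α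
    filter_upwards [hg, hden] with z hz hz2
    refine ⟨hz.1, ?_⟩
    rw [Finset.sum_range (fun i => (c i).eval z * iteratedDeriv i g z)]
    have h1 : ∀ i : Fin (L.order + 1), (c i).eval z =
        (b.map (algebraMap Qbar ℂ)).eval z * (L.coeff i).eval (algebraMap Qbar ℂ) z := by
      intro i
      have h2 := congrArg (fun P => (P.map (algebraMap Qbar ℂ)).eval z) (hcd i)
      simp only [Polynomial.map_mul, Polynomial.eval_mul] at h2
      rw [hcfin, RatFunc.eval, ← Polynomial.eval_map, ← Polynomial.eval_map, ← mul_div_assoc,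
        eq_div_iff (hz2 i), h2]
    have h3 := hz.2
    rw [DiffOp.applyAt] at h3
    calc _ = (b.map (algebraMap Qbar ℂ)).eval z *
          ∑ i, (L.coeff i).eval (algebraMap Qbar ℂ) z * iteratedDeriv (i : ℕ) g z := by
          rw [Finset.mul_sum]
          exact Finset.sum_congr rfl fun i _ => by rw [h1, mul_assoc]
      _ = 0 := by rw [h3, mul_zero]
  · intro f hf
    have h1 : ∑ i, (c' i : Qbar⟦X⟧) * (PowerSeries.derivative Qbar)^[(i : ℕ)] f = 0 := by
      have hinj2 : Function.Injective (HahnSeries.ofPowerSeries ℤ Qbar) :=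
        HahnSeries.ofPowerSeries_injective
      apply hinj2
      rw [map_zero, map_sum]
      have h2 := congrArg (fun w => algebraMap (RatFunc Qbar) Qbar⸨X⸩
        (algebraMap (Polynomial Qbar) (RatFunc Qbar) b) * w) hf
      simp only [mul_zero, DiffOp.applyFormal, Finset.mul_sum] at h2
      rw [← h2]
      refine Finset.sum_congr rfl fun i _ => ?_
      rw [map_mul, ← mul_assoc,
        ← map_mul (algebraMap (RatFunc Qbar) Qbar⸨X⸩) _ (L.coeff i), ← hc'']
      congr 1
      exact RatFunc.coe_coe (c' i)
    have h3 := congrArg (PowerSeries.map (algebraMap Qbar ℂ)) h1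
    rw [map_zero, map_sum] at h3
    rw [Finset.sum_range (fun i => (c i : ℂ⟦X⟧) *
      (PowerSeries.derivative ℂ)^[i] (f.map (algebraMap Qbar ℂ))), ← h3]
    refine Finset.sum_congr rfl fun i _ => ?_
    rw [map_mul, iterate_derivative_map, hcfin, Polynomial.polynomial_map_coe]
  · intro α hα
    -- The leading polynomial `c L.order` may vanish at a nonsingular point, so the quotients `r i`
    -- by the leading coefficient are taken in reduced form; their denominators do not vanish at
    -- `α`.
    let r : ℕ → RatFunc Qbar := fun i =>
      if h : i < L.order + 1 then L.coeff ⟨i, h⟩ / L.coeff (Fin.last _) else 0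
    have hr : ∀ i (h : i < L.order), (Polynomial.map (algebraMap Qbar ℂ) (r i).denom).eval α ≠ 0 := by
      intro i h h0
      refine hα ⟨⟨i, by omega⟩, ?_⟩
      have h' : i < L.order + 1 := by omega
      rw [Polynomial.aeval_def, ← Polynomial.eval_map]
      simpa only [r, h', dif_pos] using h0
    have hpoly : ∀ i (h : i < L.order), c i * (r i).denom.map (algebraMap Qbar ℂ) =
        c L.order * (r i).num.map (algebraMap Qbar ℂ) := by
      intro i h
      have h' : i < L.order + 1 := by omega
      have h1 : c' ⟨i, h'⟩ * (r i).denom = c' (Fin.last _) * (r i).num := by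
        apply hinj
        have h1 : algebraMap (Polynomial Qbar) (RatFunc Qbar) (r i).denom ≠ 0 :=
          (map_ne_zero_iff _ hinj).mpr (r i).denom_ne_zero
        have h2 := RatFunc.num_div_denom (r i)
        rw [div_eq_iff h1] at h2
        have h3 : r i * L.coeff (Fin.last _) = L.coeff ⟨i, h'⟩ := by
          simp only [r, h', dif_pos]
          exact div_mul_cancel₀ _ L.lead_ne_zero
        rw [map_mul, map_mul, hc'', hc'', h2, ← h3]
        ring
      have h2 := congrArg (Polynomial.map (algebraMap Qbar ℂ)) h1
      rw [Polynomial.map_mul, Polynomial.map_mul, ← hcn, ← hcfin] at h2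
      exact h2
    refine ⟨fun i z => ((r i).num.map (algebraMap Qbar ℂ)).eval z /
      ((r i).denom.map (algebraMap Qbar ℂ)).eval z, fun i hi =>
      (analyticAt_polynomial_eval _ _).fun_div (analyticAt_polynomial_eval _ _) (hr i hi),
      fun i hi => ?_⟩
    filter_upwards [(analyticAt_polynomial_eval _ _).continuousAt.eventually_ne (hr i hi)] with z hz
    have h1 := congrArg (Polynomial.eval z) (hpoly i hi)
    rw [Polynomial.eval_mul, Polynomial.eval_mul] at h1
    rw [div_mul_eq_mul_div, eq_div_iff hz, h1, mul_comm]

lemma DiffOp.finite_isSingularPoint (L : DiffOp) : {α | L.IsSingularPoint α}.Finite := by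
  have h1 : {α | L.IsSingularPoint α} = ⋃ i, {α : ℂ |
      (((L.coeff i / L.coeff (Fin.last L.order)).denom).map (algebraMap Qbar ℂ)).IsRoot α} := by
    ext α
    simp [DiffOp.IsSingularPoint, Polynomial.IsRoot, Polynomial.eval_map, Polynomial.aeval_def]
  rw [h1]
  exact Set.finite_iUnion fun i => Polynomial.finite_setOfPred_isRoot
    ((Polynomial.map_ne_zero_iff (algebraMap Qbar ℂ).injective).mpr (RatFunc.denom_ne_zero _))

/-- If all local solutions at points of `U` are meromorphic, a single polynomial clears their
poles. -/
lemma exists_polynomial_basis {n : ℕ} {c : ℕ → Polynomial ℂ} {U : Set ℂ} {s : Set ℂ}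
    (hs : s.Finite)
    (hU : ∀ α ∈ U, ∃ g : Fin n → ℂ → ℂ, (∀ j, MeromorphicAt (g j) α) ∧
      (α ∉ s → ∀ j, AnalyticAt ℂ (g j) α) ∧ (∀ j, ∀ᶠ z in 𝓝[≠] α, PolySol n c (g j) z) ∧
      ∀ a : Fin n → ℂ, (∀ᶠ z in 𝓝[≠] α, ∑ j, a j * g j z = 0) → ∀ j, a j = 0) :
    ∃ Q : Polynomial ℂ, Q ≠ 0 ∧ ∀ α ∈ U, ∃ h : Fin n → ℂ → ℂ, (∀ j, AnalyticAt ℂ (h j) α) ∧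
      (∀ j, ∀ᶠ z in 𝓝[≠] α, PolySol n c (fun z => h j z / Q.eval z) z) ∧
      ∀ a : Fin n → ℂ, (∀ᶠ z in 𝓝 α, ∑ j, a j * h j z = 0) → ∀ j, a j = 0 := by
  classical
  choose! g hmer han hsol hind using hU
  choose! e he using hmer
  -- The sum of the pole orders at `α` exceeds each of them. Points of `s` outside `U` get arbitrary
  -- exponents, which only add harmless factors to `Q`.
  let N : ℂ → ℕ := fun α => ∑ j, e α j
  let Q : Polynomial ℂ := ∏ α ∈ hs.toFinset, (Polynomial.X - Polynomial.C α) ^ N α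
  have hQ0 : Q ≠ 0 := Finset.prod_ne_zero_iff.mpr fun α _ =>
    pow_ne_zero _ (Polynomial.X_sub_C_ne_zero α)
  have key : ∀ α ∈ U, ∀ j, ∃ h : ℂ → ℂ, AnalyticAt ℂ h α ∧ ∀ z, h z = Q.eval z * g α j z := by
    intro α hα j
    refine ⟨fun z => Q.eval z * g α j z, ?_, fun z => rfl⟩
    by_cases hαs : α ∈ s
    · have hmem : α ∈ hs.toFinset := hs.mem_toFinset.mpr hαs
      have hQ : ∀ z, Q.eval z * g α j z =
          ((∏ β ∈ hs.toFinset.erase α, (Polynomial.X - Polynomial.C β) ^ N β).eval z *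
            (z - α) ^ (N α - e α j)) * ((z - α) ^ e α j • g α j z) := by
        intro z
        have hle : e α j ≤ N α :=
          Finset.single_le_sum (f := fun j => e α j) (fun _ _ => Nat.zero_le _) (Finset.mem_univ j)
        have hpow : (z - α) ^ N α = (z - α) ^ (N α - e α j) * (z - α) ^ e α j := by
          rw [← pow_add, Nat.sub_add_cancel hle]
        have h1 : Q.eval z = (z - α) ^ N α *
            (∏ β ∈ hs.toFinset.erase α, (Polynomial.X - Polynomial.C β) ^ N β).eval z := by
          simp only [Q]
          rw [← Finset.mul_prod_erase _ _ hmem, Polynomial.eval_mul]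
          simp
        rw [h1, hpow, smul_eq_mul]
        ring
      simp only [hQ]
      exact ((analyticAt_polynomial_eval _ _).fun_mul ((analyticAt_sub_const α α).fun_pow _)).fun_mul
        (he α hα j)
    · exact (analyticAt_polynomial_eval _ _).fun_mul (han α hα hαs j)
  choose! h hh hhg using key
  refine ⟨Q, hQ0, fun α hα => ⟨h α, hh α hα, fun j => ?_, fun a ha => hind α hα a ?_⟩⟩
  · refine eventually_nhdsNE_polySol_congr (hsol α hα j) ?_
    filter_upwards [eventually_nhdsNE_eval_ne_zero hQ0 α] with z hz
    rw [hhg α hα, mul_div_cancel_left₀ _ hz]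
  · filter_upwards [nhdsWithin_le_nhds ha, eventually_nhdsNE_eval_ne_zero hQ0 α] with z hz hz2
    have h1 : ∑ j, a j * h α j z = Q.eval z * ∑ j, a j * g α j z := by
      rw [Finset.mul_sum]
      exact Finset.sum_congr rfl fun j _ => by rw [hhg α hα]; ring
    rw [h1] at hz
    exact (mul_eq_zero.mp hz).resolve_left hz2

/-- A formal solution at `0` converges if `0` carries a full basis of meromorphic solutions. -/
lemma exists_analyticAt_of_formal_solution {n : ℕ} {c : ℕ → Polynomial ℂ} (hc : c n ≠ 0)
    {Q : Polynomial ℂ} (hQ : Q ≠ 0) {h : Fin n → ℂ → ℂ} (hh : ∀ j, AnalyticAt ℂ (h j) 0)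
    (hsol : ∀ j, ∀ᶠ z in 𝓝[≠] 0, PolySol n c (fun z => h j z / Q.eval z) z)
    (hind : ∀ a : Fin n → ℂ, (∀ᶠ z in 𝓝 0, ∑ j, a j * h j z = 0) → ∀ j, a j = 0) {f : ℂ⟦X⟧}
    (hf : ∑ i ∈ Finset.range (n + 1), (c i : ℂ⟦X⟧) * (PowerSeries.derivative ℂ)^[i] f = 0) :
    ∃ F : ℂ → ℂ, AnalyticAt ℂ F 0 ∧ taylor F 0 = f ∧ ∀ᶠ z in 𝓝 0, PolySol n c F z := by
  obtain ⟨R, hR, hRβ⟩ := Polynomial.exists_eq_pow_rootMultiplicity_mul_and_not_dvd Q hQ 0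
  set N := Q.rootMultiplicity 0
  have hRe : R.eval 0 ≠ 0 := fun h => hRβ (Polynomial.dvd_iff_isRoot.mpr h)
  have hRa := analyticAt_polynomial_eval R 0
  have hRnz : ∀ᶠ z in 𝓝 0, R.eval z ≠ 0 := hRa.continuousAt.eventually_ne hRe
  have hka : ∀ j, AnalyticAt ℂ (fun z => h j z / R.eval z) 0 := fun j => (hh j).fun_div hRa hRe
  have hker : ∀ j, eulerOp n N (eulerCoeff n c 0) (taylor (fun z => h j z / R.eval z) 0) = 0 := by
    intro j
    refine eulerOp_taylor_eq_zero (hka j) (g := fun z => h j z / Q.eval z) ?_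
    filter_upwards [hsol j, nhdsWithin_le_nhds hRnz, self_mem_nhdsWithin] with z hz hz2 hz3
    refine ⟨hz, ?_⟩
    have : z - 0 ≠ 0 := sub_ne_zero.mpr hz3
    have hQz : Q.eval z = (z - 0) ^ N * R.eval z := by rw [hR]; simp
    rw [hQz]
    field_simp
  have hli : LinearIndependent ℂ fun j => taylor (fun z => h j z / R.eval z) 0 := by
    refine linearIndependent_taylor hka fun a ha => hind a ?_
    filter_upwards [ha, hRnz] with z hz hz2
    simp only [← mul_div_assoc] at hz
    rw [← Finset.sum_div, div_eq_zero_iff] at hz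
    exact hz.resolve_right hz2
  -- The formal series `X ^ N * f` lies in a kernel already spanned by Taylor series of analytic
  -- functions, hence converges; dividing by `z ^ N` gives `F`.
  obtain ⟨a, ha⟩ := exists_eq_sum_of_mem_ker (eulerCoeff_ne_zero hc 0) hli hker
    (eulerOp_formal_eq_zero (N := N) hf)
  set k : ℂ → ℂ := fun z => ∑ j, a j * (h j z / R.eval z) with hk
  have hkan : AnalyticAt ℂ k 0 :=
    Finset.analyticAt_fun_sum _ fun j _ => analyticAt_const.fun_mul (hka j)
  have hkt : taylor k 0 = PowerSeries.X ^ N * f := by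
    rw [ha, hk, taylor_sum _ fun j _ => analyticAt_const.fun_mul (hka j)]
    simp only [taylor_const_mul]
  obtain ⟨F, hF, hkF⟩ := (natCast_le_analyticOrderAt hkan (n := N)).mp (by
    rw [natCast_le_analyticOrderAt_iff_iteratedDeriv_eq_zero hkan]
    intro i hi
    have h1 := congrArg (PowerSeries.coeff i) hkt
    rw [coeff_taylor, PowerSeries.coeff_X_pow_mul', if_neg (by omega), div_eq_zero_iff] at h1
    exact h1.resolve_right (by exact_mod_cast i.factorial_ne_zero))
  have hFt : taylor F 0 = f := by
    have h1 : PowerSeries.X ^ N * taylor F 0 = PowerSeries.X ^ N * f := by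
      rw [← hkt, ← taylor_sub_self 0, ← taylor_pow (analyticAt_sub_const 0 0),
        ← taylor_mul ((analyticAt_sub_const 0 0).fun_pow N) hF]
      exact (taylor_congr hkF).symm
    exact mul_left_cancel₀ (pow_ne_zero _ PowerSeries.X_ne_zero) h1
  refine ⟨F, hF, hFt, ?_⟩
  have hana : ∀ i ∈ Finset.range (n + 1), AnalyticAt ℂ (fun z => (c i).eval z * iteratedDeriv i F z) 0 :=
    fun i _ => (analyticAt_polynomial_eval _ _).fun_mul (analyticAt_iteratedDeriv hF i)
  filter_upwards [hF.eventually_analyticAt, eventually_eq_zero_of_taylor_eq_zero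
    (Finset.analyticAt_fun_sum _ hana) (by
      rw [taylor_sum _ hana, ← hf]
      refine Finset.sum_congr rfl fun i _ => ?_
      rw [taylor_mul (analyticAt_polynomial_eval _ _) (analyticAt_iteratedDeriv hF i),
        taylor_polynomial_zero, taylor_iteratedDeriv, hFt])] with z h1 h2
  exact ⟨h1, h2⟩

/-- `f` converges near `0`, and, up to a polynomial multiple, `f ∘ φ` extends to a holomorphic
function on a neighbourhood of the closed unit disc. -/
def ContinuesAlong (φ : ℂ → ℂ) (f : ℚ⟦X⟧) : Prop :=
  ∃ F : ℂ → ℂ, AnalyticAt ℂ F 0 ∧ taylor F 0 = f.map (algebraMap ℚ ℂ) ∧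
    ∃ Q : Polynomial ℂ, Q ≠ 0 ∧ ∃ M, AnalyticOnNhd ℂ M (Metric.closedBall 0 1) ∧
      M =ᶠ[𝓝 0] fun z => Q.eval (φ z) * F (φ z)

/-- At singular points of `U` a meromorphic basis is given by trivial monodromy, elsewhere by local
existence. One polynomial clears all poles, the formal solution converges at `0`, and its product
with `Q` continues along `φ`. -/
lemma continuesAlong_of_mem_H {U : Set ℂ} (h0 : (0 : ℂ) ∈ U) {x f : ℚ⟦X⟧} (hf : f ∈ H U x)
    {φ : ℂ → ℂ} (hφ : AnalyticOnNhd ℂ φ (Metric.closedBall 0 1))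
    (hφU : Set.MapsTo φ (Metric.closedBall 0 1) U) (hφ0 : φ 0 = 0) : ContinuesAlong φ f := by
  obtain ⟨-, L, hLf, hL⟩ := hf
  obtain ⟨c, hc, hcsol, hcf, hcns⟩ := L.exists_polynomial_coeff
  obtain ⟨Q, hQ, hbasis⟩ := exists_polynomial_basis (n := L.order) (c := c) (U := U)
    L.finite_isSingularPoint (fun α hα => by
      by_cases hs : L.IsSingularPoint α
      · obtain ⟨g, hg1, hg2, hg3, -⟩ := hL α hα hs
        exact ⟨g, hg1, fun h => absurd hs h, fun j => hcsol α _ (hg2 j), hg3⟩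
      · obtain ⟨ρ, hρ, hρc⟩ := hcns α hs
        obtain ⟨h, hh1, hh2, hh3⟩ := exists_solutions_of_nonsingular hρ hρc
        refine ⟨h, fun j => (hh1 j).meromorphicAt, fun _ => hh1,
          fun j => nhdsWithin_le_nhds (hh2 j), fun a ha => hh3 a ?_⟩
        have hS : AnalyticAt ℂ (fun z => ∑ j, a j * h j z) α :=
          Finset.analyticAt_fun_sum _ fun j _ => analyticAt_const.fun_mul (hh1 j)
        exact (hS.frequently_eq_iff_eventually_eq analyticAt_const).mp ha.frequently)
  obtain ⟨h, hh, hsol, hind⟩ := hbasis 0 h0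
  obtain ⟨F, hF, hFt, hFsol⟩ := exists_analyticAt_of_formal_solution hc hQ hh hsol hind
    (hcf _ hLf)
  refine ⟨F, hF, ?_, Q, hQ, ?_⟩
  · rw [hFt]
    ext n
    simp only [PowerSeries.coeff_map]
    exact (IsScalarTower.algebraMap_apply ℚ Qbar ℂ _).symm
  · refine exists_continuation_comp hc hQ hbasis hφ hφU (k := fun z => Q.eval z * F z) ?_ ?_
    · rw [hφ0]; exact (analyticAt_polynomial_eval _ _).fun_mul hF
    · rw [hφ0]
      refine eventually_nhdsNE_polySol_congr (nhdsWithin_le_nhds hFsol) ?_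
      filter_upwards [eventually_nhdsNE_eval_ne_zero hQ 0] with z hz
      rw [mul_div_cancel_left₀ _ hz]

/-! ### Tensor powers, the box principle and the holonomy inequality -/

/-- The coefficient of `∏ x_j ^ n_j` in `∑_I a_I ∏_j g_{I_j}(x_j)`. -/
def tensorCoeff {K S : Type*} [CommSemiring K] [Fintype S] {d : ℕ} (g : S → ℕ → K)
    (a : (Fin d → S) → K) (n : Fin d → ℕ) : K :=
  ∑ I : Fin d → S, a I * ∏ j, g (I j) (n j)

/-- Tensor powers of linearly independent series are linearly independent. -/
lemma eq_zero_of_tensorCoeff_eq_zero {K S : Type*} [Field K] [Fintype S] {g : S → ℕ → K}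
    (hg : LinearIndependent K g) {d : ℕ} {a : (Fin d → S) → K}
    (h : ∀ n, tensorCoeff g a n = 0) : a = 0 := by
  induction d with
  | zero =>
    ext I
    have := h 0
    rw [tensorCoeff, Fintype.sum_eq_single I fun J hJ => absurd (Subsingleton.elim J I) hJ] at this
    simpa using this
  | succ d ih =>
    -- For fixed exponents in the other variables, the coefficients form a linear relation between
    -- the `g s` in the first variable, so every slice vanishes.
    have key : ∀ s : S, ∀ n : Fin d → ℕ, tensorCoeff g (fun I => a (Fin.cons s I)) n = 0 := by
      intro s n
      rw [Fintype.linearIndependent_iff] at hg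
      refine hg (fun s => tensorCoeff g (fun I => a (Fin.cons s I)) n) ?_ s
      ext k
      have h1 := h (Fin.cons k n)
      rw [tensorCoeff, ← (Fin.consEquiv fun _ => S).sum_comp, Fintype.sum_prod_type] at h1
      rw [Finset.sum_apply, Pi.zero_apply, ← h1]
      refine Finset.sum_congr rfl fun t _ => ?_
      rw [Pi.smul_apply, smul_eq_mul, tensorCoeff, Finset.sum_mul]
      refine Finset.sum_congr rfl fun I _ => ?_
      rw [Fin.prod_univ_succ]
      have h2 : (Fin.consEquiv fun _ => S) (t, I) = (Fin.cons t I : Fin (d + 1) → S) := rfl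
      simp only [h2, Fin.cons_zero, Fin.cons_succ]
      ring
    ext I
    have := congrFun (ih (key (I 0))) (Fin.tail I)
    simpa using this

/-- A lower triangular change of variables multiplies a lowest degree coefficient by the product of
the diagonal entries. -/
lemma tensorCoeff_triangular {K S : Type*} [CommRing K] [Fintype S] {g g' : S → ℕ → K}
    {t : ℕ → ℕ → K} (hg : ∀ s n, g' s n = ∑ k ∈ Finset.range (n + 1), t n k * g s k) {d : ℕ}
    (a : (Fin d → S) → K) (n : Fin d → ℕ)
    (hlow : ∀ k : Fin d → ℕ, ∑ j, k j < ∑ j, n j → tensorCoeff g a k = 0) :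
    tensorCoeff g' a n = (∏ j, t (n j) (n j)) * tensorCoeff g a n := by
  have h1 : tensorCoeff g' a n = ∑ k ∈ Fintype.piFinset fun j => Finset.range (n j + 1),
      (∏ j, t (n j) (k j)) * tensorCoeff g a k := by
    simp only [tensorCoeff, hg, Finset.prod_univ_sum, Finset.mul_sum]
    rw [Finset.sum_comm]
    refine Finset.sum_congr rfl fun k _ => Finset.sum_congr rfl fun I _ => ?_
    rw [Finset.prod_mul_distrib]
    ring
  rw [h1, Finset.sum_eq_single n]
  · intro k hk hkn
    have hle : ∀ j, k j ≤ n j := fun j =>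
      Nat.lt_succ_iff.mp (Finset.mem_range.mp (Fintype.mem_piFinset.mp hk j))
    rw [hlow k, mul_zero]
    refine Finset.sum_lt_sum (fun j _ => hle j) ?_
    by_contra! hcon
    exact hkn (funext fun j => le_antisymm (hle j) (hcon j (Finset.mem_univ j)))
  · intro h
    exact absurd (Fintype.mem_piFinset.mpr fun j => Finset.mem_range.mpr (Nat.lt_succ_self _)) h

/-- Dirichlet's box principle: few linear forms take small values at a small integral vector. -/
lemma exists_int_vec_small {ι κ : Type*} [Fintype ι] [Fintype κ] {B : κ → ι → ℝ} {T : ℕ} {Y : ℝ}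
    (hB : ∀ k i, |B k i| ≤ Y) (hY : 1 ≤ Fintype.card ι * Y)
    (hcard : ((T + 1 : ℝ) * (2 * (Fintype.card ι * Y))) ^ Fintype.card κ <
      (T + 1 : ℝ) ^ Fintype.card ι) :
    ∃ a : ι → ℤ, a ≠ 0 ∧ (∀ i, |a i| ≤ T) ∧ ∀ k, |∑ i, (a i : ℝ) * B k i| < 1 := by
  classical
  set W : ℝ := Fintype.card ι * Y with hW
  set X : ℝ := T * W with hX
  let F : (ι → Fin (T + 1)) → κ → ℤ := fun u k => ⌊∑ i, ((u i : ℕ) : ℝ) * B k i⌋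
  have hX0 : 0 ≤ X := by positivity
  have hmaps : ∀ u ∈ (Finset.univ : Finset (ι → Fin (T + 1))),
      F u ∈ Fintype.piFinset fun _ : κ => Finset.Icc ⌊-X⌋ ⌊X⌋ := by
    intro u _
    rw [Fintype.mem_piFinset]
    intro k
    have habs : |∑ i, ((u i : ℕ) : ℝ) * B k i| ≤ X := by
      calc |∑ i, ((u i : ℕ) : ℝ) * B k i| ≤ ∑ i : ι, (T : ℝ) * Y := by
            refine (Finset.abs_sum_le_sum_abs _ _).trans (Finset.sum_le_sum fun i _ => ?_)
            rw [abs_mul, Nat.abs_cast]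
            have h1 : ((u i : ℕ) : ℝ) ≤ T := by exact_mod_cast Nat.lt_succ_iff.mp (u i).2
            exact mul_le_mul h1 (hB k i) (abs_nonneg _) (Nat.cast_nonneg _)
        _ = X := by simp [hX, hW]; ring
    rw [abs_le] at habs
    exact Finset.mem_Icc.mpr ⟨Int.floor_mono habs.1, Int.floor_mono habs.2⟩
  -- The interval contains at most `2 X + 2` integers, and `1 ≤ W` absorbs the `2`.
  have hIcc : ((Finset.Icc ⌊-X⌋ ⌊X⌋).card : ℝ) ≤ (T + 1 : ℝ) * (2 * W) := by
    rw [Int.card_Icc]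
    have h1 : ⌊-X⌋ ≤ ⌊X⌋ + 1 := by
      have : ⌊-X⌋ ≤ ⌊X⌋ := Int.floor_mono (by linarith)
      omega
    have h2 : (((⌊X⌋ + 1 - ⌊-X⌋).toNat : ℤ) : ℝ) = ⌊X⌋ + 1 - ⌊-X⌋ := by
      rw [Int.toNat_of_nonneg (by linarith)]; push_cast; ring
    rw [Int.cast_natCast] at h2
    rw [h2]
    have h3 := Int.floor_le X
    have h4 := Int.lt_floor_add_one (-X)
    have h5 : (T + 1 : ℝ) * (2 * W) = 2 * X + 2 * W := by rw [hX]; ring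
    rw [h5]
    linarith
  have hlt : (Fintype.piFinset fun _ : κ => Finset.Icc ⌊-X⌋ ⌊X⌋).card <
      (Finset.univ : Finset (ι → Fin (T + 1))).card := by
    rw [Fintype.card_piFinset, Finset.prod_const, Finset.card_univ, Finset.card_univ, Fintype.card_fun, Fintype.card_fin]
    have : ((Finset.Icc ⌊-X⌋ ⌊X⌋).card : ℝ) ^ Fintype.card κ < (T + 1 : ℝ) ^ Fintype.card ι :=
      (pow_le_pow_left₀ (Nat.cast_nonneg _) hIcc _).trans_lt hcard
    exact_mod_cast this
  obtain ⟨u, -, v, -, huv, hF⟩ := Finset.exists_ne_map_eq_of_card_lt_of_maps_to hlt hmaps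
  refine ⟨fun i => ((u i : ℕ) : ℤ) - ((v i : ℕ) : ℤ), fun h0 => huv ?_, fun i => ?_, fun k => ?_⟩
  · ext i
    have := congrFun h0 i
    simp only [Pi.zero_apply] at this
    omega
  · have h1 := (u i).2
    have h2 := (v i).2
    change |((u i : ℕ) : ℤ) - ((v i : ℕ) : ℤ)| ≤ T
    rw [abs_le]
    constructor <;> omega
  · have := Int.abs_sub_lt_one_of_floor_eq_floor (congrFun hF k)
    rw [← Finset.sum_sub_distrib] at this
    calc _ = |∑ i, (((u i : ℕ) : ℝ) * B k i - ((v i : ℕ) : ℝ) * B k i)| := by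
          congr 1
          refine Finset.sum_congr rfl fun i _ => ?_
          push_cast
          ring
      _ < 1 := this

/-- The exponents `n ∈ ℕ ^ d` of total degree less than `A`. -/
def lowDegree (d A : ℕ) : Finset (Fin d → ℕ) :=
  (Fintype.piFinset fun _ => Finset.range A).filter fun n => ∑ j, n j < A

lemma mem_lowDegree {d A : ℕ} {n : Fin d → ℕ} : n ∈ lowDegree d A ↔ ∑ j, n j < A := by
  rw [lowDegree, Finset.mem_filter, Fintype.mem_piFinset, and_iff_right_iff_imp]
  intro h j
  exact Finset.mem_range.mpr
    ((Finset.single_le_sum (f := n) (fun _ _ => Nat.zero_le _) (Finset.mem_univ j)).trans_lt h)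

/-- A slack variable turns the inequality on the total degree into an equation in `d + 1` variables;
stars and bars then gives a binomial coefficient. -/
lemma card_lowDegree_le (d A : ℕ) :
    ((lowDegree d A).card : ℝ) ≤ ((A + d : ℕ) : ℝ) ^ d / (d.factorial : ℝ) := by
  rcases A with _ | A
  · have : lowDegree d 0 = ∅ := Finset.eq_empty_of_forall_notMem fun n hn => by
      simpa using mem_lowDegree.mp hn
    rw [this]
    simp
    positivity
  have h1 : (lowDegree d (A + 1)).card ≤
      (Finset.finsuppAntidiag (Finset.univ : Finset (Fin (d + 1))) A).card := by
    refine Finset.card_le_card_of_injOn (fun n => Finsupp.equivFunOnFinite.symm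
      (Fin.cons (A - ∑ j, n j) n : Fin (d + 1) → ℕ)) (fun n hn => ?_) ?_
    · have h2 := mem_lowDegree.mp hn
      have h3 : ∑ j, n j ≤ A := by omega
      rw [Finset.mem_coe, Finset.mem_finsuppAntidiag]
      refine ⟨?_, Finset.subset_univ _⟩
      simp [Fin.sum_univ_succ, Nat.sub_add_cancel h3]
    · intro n _ n' _ hnn
      have h2 := Finsupp.equivFunOnFinite.symm.injective hnn
      exact (Fin.cons_inj.mp h2).2
  rw [Finset.card_finsuppAntidiag_nat_eq_choose, Finset.card_univ, Fintype.card_fin] at h1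
  have h2 : (d + 1 + A - 1).choose A = (d + A).choose d := by
    rw [show d + 1 + A - 1 = d + A by omega, ← Nat.choose_symm (Nat.le_add_right d A)]
    congr 1; simp
  rw [h2] at h1
  calc ((lowDegree d (A + 1)).card : ℝ) ≤ ((d + A).choose d : ℝ) := by exact_mod_cast h1
    _ ≤ ((d + A : ℕ) : ℝ) ^ d / (d.factorial : ℝ) := Nat.choose_le_pow_div d (d + A)
    _ ≤ _ := by
      have h3 : ((d + A : ℕ) : ℝ) ≤ ((A + 1 + d : ℕ) : ℝ) := by exact_mod_cast (by omega)
      exact div_le_div_of_nonneg_right (pow_le_pow_left₀ (Nat.cast_nonneg _) h3 d)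
        (Nat.cast_nonneg _)

/-- The combination of the box principle, the integrality of the coefficients in the first
coordinate system, and the size of the coefficients in the second one. -/
lemma holonomy_inequality {S : Type*} [Fintype S] [Nonempty S] {g : S → ℕ → ℚ}
    (hli : LinearIndependent ℚ g) {d A K : ℕ} (hA : 0 < A) (hK : 0 < K) {t : ℕ → ℕ → ℚ}
    (ht : ∀ n, t n n = 1)
    (hintg : ∀ s n, ∃ z : ℤ, ∑ k ∈ Finset.range (n + 1), t n k * g s k = z)
    {C R : ℝ} (hC : 1 ≤ C) (hR : 1 ≤ R) (hg : ∀ s n, |(g s n : ℝ)| ≤ C * R ^ n)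
    (hcard : (lowDegree d A).card * (K + 1) ≤ Fintype.card S ^ d)
    {g' : S → ℕ → ℂ} {t' : ℕ → ℕ → ℂ}
    (hg' : ∀ s n, g' s n = ∑ k ∈ Finset.range (n + 1), t' n k * (g s k : ℂ)) {w lam : ℂ}
    (ht' : ∀ n, t' n n = w * lam ^ n) (hlam : 1 ≤ ‖lam‖) {C' : ℝ} (hC' : ∀ s n, ‖g' s n‖ ≤ C') :
    ‖w‖ ^ d * ‖lam‖ ^ A ≤ (Fintype.card S : ℝ) ^ d *
      (2 * ((Fintype.card S : ℝ) ^ d * (C ^ d * R ^ A))) ^ (1 / K : ℝ) * C' ^ d := by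
  classical
  set N : ℕ := Fintype.card S ^ d with hN
  have hNcard : Fintype.card (Fin d → S) = N := by simp [hN]
  have hN1 : 1 ≤ N := Nat.one_le_pow _ _ Fintype.card_pos
  have hN1' : (1 : ℝ) ≤ N := by exact_mod_cast hN1
  have hY1 : 1 ≤ C ^ d * R ^ A := one_le_mul_of_one_le_of_one_le (one_le_pow₀ hC) (one_le_pow₀ hR)
  set Y : ℝ := 2 * (N * (C ^ d * R ^ A)) with hY
  have hY0 : 1 ≤ N * (C ^ d * R ^ A) := one_le_mul_of_one_le_of_one_le hN1' hY1
  have hYpos : 0 < Y := by linarith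
  -- The size of the box: `Y < (T + 1) ^ K` is what the box principle needs when there are at least
  -- `K + 1` times as many unknowns as conditions.
  set T : ℕ := ⌊Y ^ (1 / K : ℝ)⌋₊ with hT
  have hTle : (T : ℝ) ≤ Y ^ (1 / K : ℝ) := Nat.floor_le (by positivity)
  have hYT : Y < (T + 1 : ℝ) ^ K := by
    have h1 : Y ^ (1 / K : ℝ) < T + 1 := Nat.lt_floor_add_one _
    calc Y = (Y ^ (1 / K : ℝ)) ^ K := by
          rw [← Real.rpow_natCast, ← Real.rpow_mul hYpos.le, one_div,
            inv_mul_cancel₀ (by exact_mod_cast hK.ne'), Real.rpow_one]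
      _ < _ := pow_lt_pow_left₀ h1 (by positivity) hK.ne'
  have hlow0 : (lowDegree d A).card ≠ 0 :=
    Finset.card_ne_zero_of_mem (a := 0) (mem_lowDegree.mpr (by simpa using hA))
  obtain ⟨a, ha0, haT, hsmall⟩ := exists_int_vec_small (ι := Fin d → S) (κ := lowDegree d A)
    (B := fun n I => ∏ j, (g (I j) ((n : Fin d → ℕ) j) : ℝ)) (T := T) (Y := C ^ d * R ^ A)
    (fun n I => by
      rw [Finset.abs_prod]
      calc ∏ j, |(g (I j) ((n : Fin d → ℕ) j) : ℝ)| ≤ ∏ j, C * R ^ (n : Fin d → ℕ) j :=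
            Finset.prod_le_prod (fun _ _ => abs_nonneg _) fun j _ => hg _ _
        _ = C ^ d * R ^ ∑ j, (n : Fin d → ℕ) j := by
            rw [Finset.prod_mul_distrib, Finset.prod_pow_eq_pow_sum]; simp
        _ ≤ C ^ d * R ^ A := by
            gcongr
            exact (mem_lowDegree.mp n.2).le) (by rw [hNcard]; exact hY0)
    (by
      rw [hNcard, Fintype.card_coe, ← hY, mul_pow]
      calc (T + 1 : ℝ) ^ (lowDegree d A).card * Y ^ (lowDegree d A).card
          < (T + 1 : ℝ) ^ (lowDegree d A).card * ((T + 1 : ℝ) ^ K) ^ (lowDegree d A).card := by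
            gcongr
        _ = (T + 1 : ℝ) ^ ((lowDegree d A).card * (K + 1)) := by
            rw [← pow_mul, ← pow_add]; ring_nf
        _ ≤ (T + 1 : ℝ) ^ N := by
            gcongr
            linarith [(Nat.cast_nonneg T : (0 : ℝ) ≤ T)])
  let c : (Fin d → ℕ) → ℚ := tensorCoeff g fun I => (a I : ℚ)
  have hex : ∃ D, ∃ n, ∑ j, n j = D ∧ c n ≠ 0 := by
    by_contra! hcon
    have := eq_zero_of_tensorCoeff_eq_zero hli (a := fun I => (a I : ℚ)) fun n => hcon _ n rfl
    exact ha0 (funext fun I => by simpa using congrFun this I)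
  obtain ⟨n₀, hn₀, hc₀⟩ := Nat.find_spec hex
  have hmin : ∀ k : Fin d → ℕ, ∑ j, k j < ∑ j, n₀ j → c k = 0 := fun k hk => by
    by_contra hne
    exact Nat.find_min hex (hn₀ ▸ hk) ⟨k, rfl, hne⟩
  -- Passing to the integral coordinates multiplies a lowest coefficient by diagonal entries, all
  -- equal to `1`; in those coordinates it is visibly an integer.
  have hinteger : ∃ z : ℤ, c n₀ = z := by
    choose z hz using hintg
    have h1 := tensorCoeff_triangular (g' := fun s n => (z s n : ℚ)) (fun s n => (hz s n).symm)
      (fun I => (a I : ℚ)) n₀ hmin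
    simp only [ht, Finset.prod_const_one, one_mul] at h1
    refine ⟨∑ I, a I * ∏ j, z (I j) (n₀ j), ?_⟩
    change tensorCoeff g _ n₀ = _
    rw [← h1, tensorCoeff]
    push_cast
    rfl
  have hone : (1 : ℝ) ≤ |(c n₀ : ℝ)| := by
    obtain ⟨z, hz⟩ := hinteger
    rw [hz] at hc₀ ⊢
    have hz0 : z ≠ 0 := by exact_mod_cast hc₀
    have := Int.one_le_abs hz0
    rw [Rat.cast_intCast]
    exact_mod_cast this
  -- A coefficient of degree below `A` would have absolute value less than `1`, against `hone`.
  have hAn : A ≤ ∑ j, n₀ j := by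
    by_contra! hlt
    have h1 := hsmall ⟨n₀, mem_lowDegree.mpr hlt⟩
    have h2 : (∑ I, (a I : ℝ) * ∏ j, (g (I j) (n₀ j) : ℝ)) = (c n₀ : ℝ) := by
      simp only [c, tensorCoeff]; push_cast; rfl
    rw [h2] at h1
    linarith
  -- In the second coordinates the same coefficient is multiplied by `w ^ d * lam ^ (∑ n₀)`, which
  -- makes it large.
  have htri := tensorCoeff_triangular (g := fun s n => (g s n : ℂ)) (g' := g') hg'
    (fun I => (a I : ℂ)) n₀ (fun k hk => by
      have h1 := congrArg (fun q : ℚ => (q : ℂ)) (hmin k hk)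
      simp only [c, tensorCoeff] at h1
      push_cast at h1
      exact h1)
  have hcc : tensorCoeff (fun s n => (g s n : ℂ)) (fun I => (a I : ℂ)) n₀ = (c n₀ : ℂ) := by
    simp only [c, tensorCoeff]; push_cast; rfl
  have hnorm : ‖(c n₀ : ℂ)‖ = |(c n₀ : ℝ)| := by
    rw [← Complex.ofReal_ratCast, Complex.norm_real, Real.norm_eq_abs]
  have hC'0 : 0 ≤ C' := (norm_nonneg _).trans (hC' (Classical.arbitrary S) 0)
  calc ‖w‖ ^ d * ‖lam‖ ^ A ≤ ‖w‖ ^ d * ‖lam‖ ^ ∑ j, n₀ j := by gcongr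
    _ = ‖∏ j, t' (n₀ j) (n₀ j)‖ * 1 := by
        simp only [ht', Finset.prod_mul_distrib, Finset.prod_pow_eq_pow_sum, norm_mul, norm_pow]
        simp
    _ ≤ ‖∏ j, t' (n₀ j) (n₀ j)‖ * ‖(c n₀ : ℂ)‖ := by rw [hnorm]; gcongr
    _ = ‖tensorCoeff g' (fun I => (a I : ℂ)) n₀‖ := by rw [htri, hcc, norm_mul]
    _ ≤ ∑ I : Fin d → S, Y ^ (1 / K : ℝ) * C' ^ d := by
        refine norm_sum_le_of_le _ fun I _ => ?_
        rw [norm_mul, norm_prod]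
        have h1 : ‖(a I : ℂ)‖ ≤ Y ^ (1 / K : ℝ) := by
          refine le_trans ?_ hTle
          rw [Complex.norm_intCast]
          exact_mod_cast haT I
        have h2 : ∏ j, ‖g' (I j) (n₀ j)‖ ≤ C' ^ d := by
          calc _ ≤ ∏ _j : Fin d, C' := Finset.prod_le_prod (fun _ _ => norm_nonneg _) fun j _ => hC' _ _
            _ = _ := by simp
        exact mul_le_mul h1 h2 (Finset.prod_nonneg fun _ _ => norm_nonneg _) (by positivity)
    _ = _ := by
        rw [Finset.sum_const, Finset.card_univ, hNcard, nsmul_eq_mul, hY, hN]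
        push_cast
        ring

/-! ### Harmonic majorants on the unit circle -/

/-- Conjugation preserves real parts and turns negative frequencies into positive ones, so the real
part of a trigonometric polynomial is that of an ordinary polynomial. -/
lemma exists_polynomial_re_eq {w : C(AddCircle (2 * Real.pi), ℂ)}
    (hw : w ∈ Submodule.span ℂ (Set.range (@fourier (2 * Real.pi)))) (c : ℂ) :
    ∃ q : Polynomial ℂ, ∀ θ, (c * w θ).re = (q.eval (AddCircle.toCircle θ : ℂ)).re := by
  induction hw using Submodule.span_induction generalizing c with
  | mem w hw =>
    obtain ⟨n, rfl⟩ := hw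
    obtain ⟨k, rfl | rfl⟩ := Int.eq_nat_or_neg n
    · refine ⟨Polynomial.C c * Polynomial.X ^ k, fun θ => ?_⟩
      simp [fourier_apply, AddCircle.toCircle_nsmul]
    · refine ⟨Polynomial.C (starRingEnd ℂ c) * Polynomial.X ^ k, fun θ => ?_⟩
      rw [fourier_neg, ← Complex.conj_re]
      simp [fourier_apply, AddCircle.toCircle_nsmul]
  | zero => exact ⟨0, fun θ => by simp⟩
  | add x y _ _ hx hy =>
    obtain ⟨q, hq⟩ := hx c
    obtain ⟨q', hq'⟩ := hy c
    exact ⟨q + q', fun θ => by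
      rw [ContinuousMap.add_apply, mul_add, Complex.add_re, hq, hq', Polynomial.eval_add,
        Complex.add_re]⟩
  | smul a x _ hx =>
    obtain ⟨q, hq⟩ := hx (c * a)
    exact ⟨q, fun θ => by rw [← hq, ContinuousMap.smul_apply, smul_eq_mul, mul_assoc]⟩

lemma circleAverage_re_polynomial (q : Polynomial ℂ) :
    Real.circleAverage (fun z => (q.eval z).re) 0 1 = (q.eval 0).re := by
  have h1 : CircleIntegrable (fun z => q.eval z) 0 1 :=
    q.continuous.continuousOn.circleIntegrable zero_le_one
  have h2 := Complex.reCLM.circleAverage_comp_comm h1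
  have h3 : Real.circleAverage (fun z => q.eval z) 0 1 = q.eval 0 :=
    DiffContOnCl.circleAverage q.differentiable.diffContOnCl
  rw [h3] at h2
  exact h2

/-- A continuous function on the unit circle has a harmonic majorant whose value at the centre
exceeds the mean of the function by arbitrarily little. -/
lemma exists_polynomial_re_ge {u : ℂ → ℝ} (hu : ContinuousOn u (Metric.sphere 0 1)) {ε : ℝ}
    (hε : 0 < ε) : ∃ q : Polynomial ℂ, (∀ z ∈ Metric.sphere (0 : ℂ) 1, u z ≤ (q.eval z).re) ∧
      (q.eval 0).re ≤ Real.circleAverage u 0 1 + ε := by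
  have : Fact (0 < 2 * Real.pi) := ⟨Real.two_pi_pos⟩
  have hcirc : Continuous fun θ : AddCircle (2 * Real.pi) => (AddCircle.toCircle θ : ℂ) :=
    continuous_subtype_val.comp AddCircle.continuous_toCircle
  have hcont : Continuous fun θ : AddCircle (2 * Real.pi) => u (AddCircle.toCircle θ : ℂ) :=
    hu.comp_continuous hcirc fun θ =>
      mem_sphere_zero_iff_norm.mpr (Circle.norm_coe _)
  let v : C(AddCircle (2 * Real.pi), ℂ) :=
    ⟨fun θ => (u (AddCircle.toCircle θ : ℂ) : ℂ), Complex.continuous_ofReal.comp hcont⟩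
  have hmem : v ∈ closure ((Submodule.span ℂ (Set.range (@fourier (2 * Real.pi))) :
      Submodule ℂ C(AddCircle (2 * Real.pi), ℂ)) : Set C(AddCircle (2 * Real.pi), ℂ)) := by
    rw [← Submodule.topologicalClosure_coe, span_fourier_closure_eq_top]
    trivial
  obtain ⟨w, hw, hvw⟩ := Metric.mem_closure_iff.mp hmem (ε / 2) (by linarith)
  obtain ⟨q, hq⟩ := exists_polynomial_re_eq hw 1
  have happrox : ∀ z ∈ Metric.sphere (0 : ℂ) 1, |u z - (q.eval z).re| ≤ ε / 2 := by
    intro z hz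
    obtain ⟨θ, hθ⟩ : ∃ θ : AddCircle (2 * Real.pi), (AddCircle.toCircle θ : ℂ) = z := by
      refine ⟨(Complex.arg z : ℝ), ?_⟩
      rw [AddCircle.toCircle_apply_mk, Circle.coe_exp]
      have h1 : ‖z‖ = 1 := by simpa using hz
      have h2 := Complex.norm_mul_exp_arg_mul_I z
      rw [h1, Complex.ofReal_one, one_mul] at h2
      rw [div_self Real.two_pi_pos.ne', one_mul, h2]
    have h1 : dist (v θ) (w θ) ≤ ε / 2 := (ContinuousMap.dist_apply_le_dist θ).trans hvw.le
    have h2 : u z - (q.eval z).re = (v θ - w θ).re := by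
      have h3 := hq θ
      rw [one_mul, hθ] at h3
      rw [Complex.sub_re, h3]
      simp [v, hθ]
    rw [h2]
    rw [dist_eq_norm] at h1
    exact (Complex.abs_re_le_norm _).trans h1
  -- Half of `ε` lifts the approximation above `u`; the other half pays for the difference of the
  -- means.
  refine ⟨q + Polynomial.C ((ε / 2 : ℝ) : ℂ), fun z hz => ?_, ?_⟩
  · have := (abs_le.mp (happrox z hz)).2
    rw [Polynomial.eval_add, Polynomial.eval_C, Complex.add_re, Complex.ofReal_re]
    linarith
  · rw [Polynomial.eval_add, Polynomial.eval_C, Complex.add_re, Complex.ofReal_re,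
      ← circleAverage_re_polynomial]
    have hci : CircleIntegrable u 0 1 := hu.circleIntegrable zero_le_one
    have hcq : CircleIntegrable (fun z => (q.eval z).re) 0 1 :=
      (Complex.continuous_re.comp q.continuous).continuousOn.circleIntegrable zero_le_one
    have hcc : CircleIntegrable (fun _ : ℂ => ε / 2) 0 1 :=
      continuousOn_const.circleIntegrable zero_le_one
    have h1 : Real.circleAverage (fun z => (q.eval z).re) 0 1 ≤
        Real.circleAverage (fun z => u z + ε / 2) 0 1 := by
      refine Real.circleAverage_mono hcq (hci.add hcc) fun z hz => ?_
      rw [abs_one] at hz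
      have := (abs_le.mp (happrox z hz)).1
      linarith
    rw [Real.circleAverage_fun_add hci hcc, Real.circleAverage_const] at h1
    linarith

/-! ### Choice of parameters -/

lemma nonpos_of_eventually_mul_le_log {a b c : ℝ}
    (h : ∀ᶠ D : ℕ in atTop, a * D ≤ b * Real.log D + c) : a ≤ 0 := by
  have h1 : Tendsto (fun x : ℝ => Real.log x / x) atTop (𝓝 0) := by
    simpa using Real.isLittleO_log_id_atTop.tendsto_div_nhds_zero
  have h2 : Tendsto (fun D : ℕ => b * (Real.log D / D) + c / D) atTop (𝓝 (b * 0 + 0)) :=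
    ((h1.comp tendsto_natCast_atTop_atTop).const_mul b).add (tendsto_const_div_atTop_nhds_zero_nat c)
  rw [mul_zero, add_zero] at h2
  refine ge_of_tendsto h2 ?_
  filter_upwards [h, eventually_gt_atTop 0] with D hD hD0
  have hD0' : (0 : ℝ) < D := by exact_mod_cast hD0
  rw [← mul_div_assoc, ← add_div, le_div_iff₀ hD0']
  exact hD

/-- A single term of the exponential series at `d`. This is the origin of the factor `e` in the
holonomy bound. -/
lemma pow_le_exp_mul_factorial (d : ℕ) : (d : ℝ) ^ d ≤ Real.exp 1 ^ d * (d.factorial : ℝ) := by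
  have h1 := Real.pow_div_factorial_le_exp (d : ℝ) (Nat.cast_nonneg d) d
  rw [div_le_iff₀ (by positivity)] at h1
  rwa [← Real.exp_nat_mul, mul_one]

/-- The choice of parameters in the holonomy bound. -/
lemma asymptotic_bound {m : ℕ} (hm : 0 < m) {l E b₁ b₂ c₁ c₂ : ℝ} (hb₂ : 0 ≤ b₂)
    (hl : 0 < l)
    (h : ∀ d A K D : ℕ, 0 < d → 0 < A → 0 < K → 0 < D →
      ((A + d : ℕ) : ℝ) ^ d * (K + 1) ≤ (d.factorial : ℝ) * (m * D : ℝ) ^ d →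
      A * l ≤ d * D * E + 1 / K * (Real.log 2 + d * Real.log (m * D) + d * c₁ + d * D * b₁ + A * b₂)
        + d * Real.log (m * D) + d * c₂) :
    m * l ≤ Real.exp 1 * E := by
  have hm' : (0 : ℝ) < m := by exact_mod_cast hm
  have he := Real.exp_pos 1
  -- `θ` stands for `A / (d D)`. The ratio `q = m / (e θ) > 1` measures the surplus of unknowns; `d`
  -- is chosen with `q ^ d > K + 1`, and then `D` tends to infinity.
  have step : ∀ θ : ℝ, 0 < θ → θ < m / Real.exp 1 → ∀ K : ℕ, 0 < K →
      θ * l ≤ E + (b₁ + θ * b₂) / K := by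
    intro θ hθ hθm K hK
    have hK' : (0 : ℝ) < K := by exact_mod_cast hK
    set q : ℝ := m / (Real.exp 1 * θ) with hq
    have hq1 : 1 < q := by
      rw [hq, lt_div_iff₀ (by positivity), one_mul]
      rwa [lt_div_iff₀ he, mul_comm] at hθm
    obtain ⟨d, hd⟩ := pow_unbounded_of_one_lt ((K : ℝ) + 1) hq1
    have hd0 : 0 < d := by
      rcases Nat.eq_zero_or_pos d with h0 | h0
      · rw [h0, pow_zero] at hd; linarith
      · exact h0
    have hd' : (0 : ℝ) < d := by exact_mod_cast hd0
    have hlarge : ∀ᶠ D : ℕ in atTop, (d : ℝ) + 2 ≤ θ * d * D := by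
      have : Tendsto (fun D : ℕ => θ * d * (D : ℝ)) atTop atTop :=
        tendsto_natCast_atTop_atTop.const_mul_atTop (by positivity)
      exact this.eventually_ge_atTop _
    have hfin := nonpos_of_eventually_mul_le_log
      (a := θ * d * l - d * E - 1 / K * (d * b₁ + θ * d * b₂)) (b := d / K + d)
      (c := (d + 1) * l + 1 / K * (Real.log 2 + d * Real.log m + d * c₁) + d * Real.log m + d * c₂)
      (by
        filter_upwards [hlarge, eventually_gt_atTop 0] with D hD hD0
        have hD' : (0 : ℝ) < D := by exact_mod_cast hD0
        have hx0 : 0 ≤ θ * d * D := by positivity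
        have hfl := Nat.floor_le hx0
        have hfl2 := Nat.lt_floor_add_one (θ * d * D)
        -- The degree used is `⌊θ d D⌋ - d`, written `A + 1` to be positive; removing `d`
        -- compensates the shift in `(A + d) ^ d`.
        have hdfl : d + 1 ≤ ⌊θ * d * D⌋₊ := Nat.le_floor (by push_cast; linarith)
        obtain ⟨A, hA⟩ := Nat.exists_eq_add_of_le' hdfl
        have hA1 : ((A + 1 : ℕ) : ℝ) + d ≤ θ * d * D := by
          rw [hA] at hfl; push_cast at hfl ⊢; linarith
        have hA2 : θ * d * D - d - 1 ≤ ((A + 1 : ℕ) : ℝ) := by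
          rw [hA] at hfl2; push_cast at hfl2 ⊢; linarith
        have hA3 : ((A + 1 : ℕ) : ℝ) ≤ θ * d * D := by linarith
        have hcond : ((A + 1 + d : ℕ) : ℝ) ^ d * (K + 1) ≤ (d.factorial : ℝ) * (m * D : ℝ) ^ d := by
          calc ((A + 1 + d : ℕ) : ℝ) ^ d * (K + 1) ≤ (θ * d * D) ^ d * q ^ d := by
                have : ((A + 1 + d : ℕ) : ℝ) ≤ θ * d * D := by push_cast at hA1 ⊢; linarith
                exact mul_le_mul (pow_le_pow_left₀ (Nat.cast_nonneg _) this d) hd.le (by positivity)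
                  (by positivity)
            _ = (d : ℝ) ^ d * ((m * D) ^ d / Real.exp 1 ^ d) := by
                rw [← mul_pow, ← div_pow, ← mul_pow, hq]
                congr 1
                field_simp
            _ ≤ (Real.exp 1 ^ d * (d.factorial : ℝ)) * ((m * D) ^ d / Real.exp 1 ^ d) := by
                gcongr
                exact pow_le_exp_mul_factorial d
            _ = _ := by field_simp
        have key := h d (A + 1) K D hd0 (Nat.succ_pos _) hK hD0 hcond
        rw [Real.log_mul hm'.ne' hD'.ne'] at key
        have e1 : (θ * d * D - d - 1) * l ≤ ((A + 1 : ℕ) : ℝ) * l := by gcongr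
        have e2 : 1 / (K : ℝ) * (((A + 1 : ℕ) : ℝ) * b₂) ≤ 1 / (K : ℝ) * (θ * d * D * b₂) := by
          gcongr
        have e3 : (d / K + d) * Real.log D = 1 / K * (d * Real.log D) + d * Real.log D := by ring
        rw [e3]
        linarith)
    have h2 : d * (θ * l - E - (b₁ + θ * b₂) / K) ≤ 0 := by
      calc _ = θ * d * l - d * E - 1 / K * (d * b₁ + θ * d * b₂) := by ring
        _ ≤ 0 := hfin
    have h3 := nonpos_of_mul_nonpos_right h2 hd'
    linarith
  have step2 : ∀ θ : ℝ, 0 < θ → θ < m / Real.exp 1 → θ * l ≤ E := by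
    intro θ hθ hθm
    have h1 : Tendsto (fun K : ℕ => E + (b₁ + θ * b₂) / K) atTop (𝓝 (E + 0)) :=
      (tendsto_const_div_atTop_nhds_zero_nat _).const_add E
    rw [add_zero] at h1
    refine ge_of_tendsto h1 ?_
    filter_upwards [eventually_gt_atTop 0] with K hK using step θ hθ hθm K hK
  have step3 : m / Real.exp 1 * l ≤ E := by
    have hpos : 0 < m / Real.exp 1 := by positivity
    have h1 : Tendsto (fun θ : ℝ => θ * l) (𝓝[<] (m / Real.exp 1)) (𝓝 (m / Real.exp 1 * l)) :=
      ((continuous_id.mul continuous_const).tendsto _).mono_left nhdsWithin_le_nhds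
    refine le_of_tendsto h1 ?_
    filter_upwards [self_mem_nhdsWithin, nhdsWithin_le_nhds (lt_mem_nhds hpos)] with θ h1 h2
    exact step2 θ h2 h1
  rw [div_mul_eq_mul_div, div_le_iff₀ he] at step3
  linarith

/-! ### The holonomy bound for finite families -/

lemma IsIntegralSeries.mul {f g : ℚ⟦X⟧} (hf : IsIntegralSeries f) (hg : IsIntegralSeries g) :
    IsIntegralSeries (f * g) := by
  intro n
  choose a ha using hf
  choose b hb using hg
  refine ⟨∑ ij ∈ Finset.HasAntidiagonal.antidiagonal n, a ij.1 * b ij.2, ?_⟩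
  rw [PowerSeries.coeff_mul]
  push_cast
  exact Finset.sum_congr rfl fun ij _ => by rw [ha, hb]

lemma IsIntegralSeries.one : IsIntegralSeries 1 := fun n =>
  ⟨if n = 0 then 1 else 0, by rw [PowerSeries.coeff_one]; split_ifs <;> simp⟩

lemma IsIntegralSeries.pow {f : ℚ⟦X⟧} (hf : IsIntegralSeries f) (k : ℕ) :
    IsIntegralSeries (f ^ k) := by
  induction k with
  | zero => simpa using IsIntegralSeries.one
  | succ k ih => rw [pow_succ]; exact ih.mul hf

lemma hasSubst_of_coeff_zero {x : ℚ⟦X⟧} (hx : PowerSeries.coeff 0 x = 0) : PowerSeries.HasSubst x :=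
  PowerSeries.HasSubst.of_constantCoeff_zero' (by simpa using hx)

lemma coeff_X_mul_pow_self {R : Type*} [CommRing R] (y : R⟦X⟧) (n : ℕ) :
    PowerSeries.coeff n ((PowerSeries.X * y) ^ n) = PowerSeries.constantCoeff y ^ n := by
  have h := PowerSeries.coeff_X_pow_mul (y ^ n) n 0
  rw [zero_add] at h
  rw [mul_pow, h]
  simp

lemma coeff_one_X_mul {R : Type*} [CommRing R] (y : R⟦X⟧) :
    PowerSeries.coeff 1 (PowerSeries.X * y) = PowerSeries.constantCoeff y := by
  have h := PowerSeries.coeff_succ_X_mul 0 y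
  rw [zero_add] at h
  rw [h]
  simp

lemma coeff_subst_eq_sum {x : ℚ⟦X⟧} (hx : PowerSeries.coeff 0 x = 0) (f : ℚ⟦X⟧) (n : ℕ) :
    PowerSeries.coeff n (f.subst x : ℚ⟦X⟧) =
      ∑ k ∈ Finset.range (n + 1), PowerSeries.coeff n (x ^ k) * PowerSeries.coeff k f := by
  rw [PowerSeries.coeff_subst' (hasSubst_of_coeff_zero hx),
    finsum_eq_sum_of_support_subset _ (s := Finset.range (n + 1))]
  · exact Finset.sum_congr rfl fun k _ => by rw [smul_eq_mul, mul_comm]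
  · intro k hk
    by_contra hkn
    have hkn' : n < k := by simpa using hkn
    refine hk ?_
    obtain ⟨y, rfl⟩ := PowerSeries.X_dvd_iff.mpr (by simpa using hx)
    have hdvd : PowerSeries.X ^ k ∣ (PowerSeries.X * y) ^ k := ⟨y ^ k, by ring⟩
    simp only [PowerSeries.X_pow_dvd_iff.mp hdvd n hkn', smul_zero]

lemma exists_norm_le_on_closedBall {f : ℂ → ℂ} {r : ℝ}
    (hf : AnalyticOnNhd ℂ f (Metric.closedBall 0 r)) :
    ∃ C : ℝ, 1 ≤ C ∧ ∀ z ∈ Metric.closedBall (0 : ℂ) r, ‖f z‖ ≤ C := by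
  obtain ⟨C, hC⟩ := (isCompact_closedBall (0 : ℂ) r).exists_bound_of_continuousOn hf.continuousOn
  exact ⟨max 1 C, le_max_left _ _, fun z hz => (hC z hz).trans (le_max_right _ _)⟩

/-- The coefficients of `p ^ k * f i` grow at most like `C * B ^ k * R ^ n`. -/
lemma exists_coeff_bound {m : ℕ} {F : Fin m → ℂ → ℂ} {P : ℂ → ℂ} (hF : ∀ i, AnalyticAt ℂ (F i) 0)
    (hP : AnalyticAt ℂ P 0) : ∃ C B R : ℝ, 1 ≤ C ∧ 1 ≤ B ∧ 1 ≤ R ∧ ∀ i k n,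
      ‖PowerSeries.coeff n (taylor (fun z => P z ^ k * F i z) 0)‖ ≤ C * B ^ k * R ^ n := by
  obtain ⟨ε, hε, hball⟩ := Metric.eventually_nhds_iff_ball.mp
    (hP.eventually_analyticAt.and (eventually_all.mpr fun i => (hF i).eventually_analyticAt))
  set r : ℝ := min (ε / 2) 1 with hr
  have hr0 : 0 < r := lt_min (by linarith) one_pos
  have hr1 : r ≤ 1 := min_le_right _ _
  have hsub : Metric.closedBall (0 : ℂ) r ⊆ Metric.ball 0 ε :=
    Metric.closedBall_subset_ball ((min_le_left _ _).trans_lt (by linarith))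
  have hPa : AnalyticOnNhd ℂ P (Metric.closedBall 0 r) := fun z hz => (hball z (hsub hz)).1
  have hFa : ∀ i, AnalyticOnNhd ℂ (F i) (Metric.closedBall 0 r) := fun i z hz =>
    (hball z (hsub hz)).2 i
  obtain ⟨B, hB1, hB⟩ := exists_norm_le_on_closedBall hPa
  choose C hC1 hC using fun i => exists_norm_le_on_closedBall (hFa i)
  have hCi : ∀ i, C i ≤ 1 + ∑ i, C i := fun i => by
    have := Finset.single_le_sum (f := C) (fun i _ => zero_le_one.trans (hC1 i)) (Finset.mem_univ i)
    linarith
  have hCs : 0 ≤ ∑ i, C i := Finset.sum_nonneg fun i _ => zero_le_one.trans (hC1 i)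
  refine ⟨1 + ∑ i, C i, B, r⁻¹, by linarith, hB1, (one_le_inv₀ hr0).mpr hr1, fun i k n => ?_⟩
  have := norm_coeff_taylor_le (f := fun z => P z ^ k * F i z) (C := (1 + ∑ i, C i) * B ^ k) hr0
    (fun z hz => ((hPa z hz).fun_pow k).fun_mul (hFa i z hz)) (fun z hz => by
      have hz' := Metric.sphere_subset_closedBall hz
      rw [norm_mul, norm_pow, mul_comm]
      exact mul_le_mul ((hC i z hz').trans (hCi i))
        (pow_le_pow_left₀ (norm_nonneg _) (hB z hz') k) (by positivity) (by linarith)) n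
  rwa [inv_pow, ← div_eq_mul_inv]

/-- A common polynomial multiplier for finitely many continuations. -/
lemma exists_common_continuation {m : ℕ} {φ : ℂ → ℂ}
    (hφ : AnalyticOnNhd ℂ φ (Metric.closedBall 0 1)) {f : Fin m → ℚ⟦X⟧}
    (hf : ∀ i, ContinuesAlong φ (f i)) : ∃ (F : Fin m → ℂ → ℂ) (Q : Polynomial ℂ)
      (M : Fin m → ℂ → ℂ), Q ≠ 0 ∧ (∀ i, AnalyticAt ℂ (F i) 0) ∧
      (∀ i, taylor (F i) 0 = (f i).map (algebraMap ℚ ℂ)) ∧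
      (∀ i, AnalyticOnNhd ℂ (M i) (Metric.closedBall 0 1)) ∧
      ∀ i, M i =ᶠ[𝓝 0] fun z => Q.eval (φ z) * F i (φ z) := by
  classical
  choose F hF hFt Q hQ M hM hMF using hf
  refine ⟨F, ∏ i, Q i, fun i z => (∏ j ∈ Finset.univ.erase i, Q j).eval (φ z) * M i z,
    Finset.prod_ne_zero_iff.mpr fun i _ => hQ i, hF, hFt, fun i z hz =>
    AnalyticAt.fun_mul ?_ (hM i z hz), fun i => ?_⟩
  · exact (analyticAt_polynomial_eval (∏ j ∈ Finset.univ.erase i, Q j) (φ z)).comp (hφ z hz)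
  · filter_upwards [hMF i] with z hz
    rw [hz, ← Finset.mul_prod_erase _ _ (Finset.mem_univ i), Polynomial.eval_mul]
    ring

lemma le_exp_posLog (x : ℝ) (hx : 0 ≤ x) : x ≤ Real.exp (Real.posLog x) := by
  rcases hx.eq_or_lt with rfl | h
  · exact (Real.exp_pos _).le
  · calc x = Real.exp (Real.log x) := (Real.exp_log h).symm
      _ ≤ _ := Real.exp_le_exp.mpr (le_max_right _ _)

/-- The diagonal of the triangular matrix describing composition with `φ` and multiplication by `φ ^
N * V`; it has the form `w * lam ^ n` required by `holonomy_inequality`. -/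
lemma coeff_diag {φ V : ℂ⟦X⟧} (hφ : PowerSeries.X ∣ φ) (N n : ℕ) :
    PowerSeries.coeff (n + N) (φ ^ N * V * φ ^ n) =
      PowerSeries.coeff 1 φ ^ N * PowerSeries.constantCoeff V * PowerSeries.coeff 1 φ ^ n := by
  obtain ⟨ψ, rfl⟩ := hφ
  have h0 := PowerSeries.coeff_X_pow_mul (ψ ^ N * V * ψ ^ n) (n + N) 0
  have h1 : PowerSeries.coeff 1 (PowerSeries.X * ψ) = PowerSeries.constantCoeff ψ :=
    coeff_one_X_mul ψ
  rw [zero_add] at h0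
  rw [show (PowerSeries.X * ψ) ^ N * V * (PowerSeries.X * ψ) ^ n =
    PowerSeries.X ^ (n + N) * (ψ ^ N * V * ψ ^ n) by ring, h0, h1]
  simp

/-- The holonomy bound for a finite family. -/
theorem card_mul_log_le {m : ℕ} {f : Fin m → ℚ⟦X⟧} {p x : ℚ⟦X⟧} {φ P : ℂ → ℂ}
    (hφ : AnalyticOnNhd ℂ φ (Metric.closedBall 0 1)) (hφ0 : φ 0 = 0) (hφ' : 1 < ‖deriv φ 0‖)
    (hx0 : PowerSeries.coeff 0 x = 0) (hx1 : PowerSeries.coeff 1 x = 1)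
    (hfint : ∀ i, IsIntegralSeries ((f i).subst x)) (hpint : IsIntegralSeries (p.subst x))
    (hf : ∀ i, ContinuesAlong φ (f i)) (hP : AnalyticAt ℂ P 0)
    (hPt : taylor P 0 = p.map (algebraMap ℚ ℂ))
    (hPφ : AnalyticOnNhd ℂ (fun z => P (φ z)) (Metric.closedBall 0 1))
    (hli : LinearIndependent ℚ fun s : Fin m × ℕ => p ^ s.2 * f s.1) :
    m * Real.log ‖deriv φ 0‖ ≤
      Real.exp 1 * Real.circleAverage (fun z => Real.posLog ‖P (φ z)‖) 0 1 := by
  have hl : 0 < Real.log ‖deriv φ 0‖ := Real.log_pos hφ'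
  have hlam0 : 0 < ‖deriv φ 0‖ := by linarith
  have havg0 : 0 ≤ Real.circleAverage (fun z => Real.posLog ‖P (φ z)‖) 0 1 :=
    Real.circleAverage_nonneg_of_nonneg fun z _ => Real.posLog_nonneg
  rcases Nat.eq_zero_or_pos m with hm | hm
  · rw [hm]; simp only [Nat.cast_zero, zero_mul]; positivity
  obtain ⟨F, Q, M, hQ, hF, hFt, hM, hMF⟩ := exists_common_continuation hφ hf
  obtain ⟨C, B, R, hC1, hB1, hR1, hbound⟩ := exists_coeff_bound hF hP
  obtain ⟨C', hC'1, hC'⟩ : ∃ C' : ℝ, 1 ≤ C' ∧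
      ∀ i, ∀ z ∈ Metric.closedBall (0 : ℂ) 1, ‖M i z‖ ≤ C' := by
    choose C hC1 hC using fun i => exists_norm_le_on_closedBall (hM i)
    have hCs : 0 ≤ ∑ i, C i := Finset.sum_nonneg fun i _ => zero_le_one.trans (hC1 i)
    refine ⟨1 + ∑ i, C i, by linarith, fun i z hz => (hC i z hz).trans ?_⟩
    have := Finset.single_le_sum (f := C) (fun i _ => zero_le_one.trans (hC1 i)) (Finset.mem_univ i)
    linarith
  -- A zero of `Q` at `0` is split off and becomes an index shift by `N`; the rest, nonzero at `0`,
  -- keeps the diagonal entries nonzero.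
  obtain ⟨Q₁, hQ₁, hQ₁d⟩ := Polynomial.exists_eq_pow_rootMultiplicity_mul_and_not_dvd Q hQ 0
  set N := Q.rootMultiplicity 0
  have hQ₁0 : Q₁.eval 0 ≠ 0 := fun h => hQ₁d (Polynomial.dvd_iff_isRoot.mpr h)
  have hφ00 : AnalyticAt ℂ φ 0 := hφ 0 (by simp)
  have hu : ContinuousOn (fun z => Real.posLog ‖P (φ z)‖) (Metric.sphere 0 1) :=
    Real.continuous_posLog.comp_continuousOn
      (hPφ.continuousOn.norm.mono Metric.sphere_subset_closedBall)
  suffices hε : ∀ ε > 0, m * Real.log ‖deriv φ 0‖ ≤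
      Real.exp 1 * (Real.circleAverage (fun z => Real.posLog ‖P (φ z)‖) 0 1 + ε) by
    have h1 : Tendsto (fun ε : ℝ => Real.exp 1 *
        (Real.circleAverage (fun z => Real.posLog ‖P (φ z)‖) 0 1 + ε)) (𝓝[>] 0)
        (𝓝 (Real.exp 1 * (Real.circleAverage (fun z => Real.posLog ‖P (φ z)‖) 0 1 + 0))) :=
      (Continuous.tendsto (by fun_prop) _).mono_left nhdsWithin_le_nhds
    rw [add_zero] at h1
    refine ge_of_tendsto h1 ?_
    filter_upwards [self_mem_nhdsWithin] with ε hε' using hε ε hε'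
  intro ε hε
  obtain ⟨q, hq, hq0⟩ := exists_polynomial_re_ge hu hε
  refine le_trans (b := Real.exp 1 * (q.eval 0).re) ?_
    (mul_le_mul_of_nonneg_left hq0 (Real.exp_pos 1).le)
  refine asymptotic_bound hm (b₁ := Real.log B) (b₂ := Real.log R) (c₁ := Real.log C)
    (c₂ := Real.log C' - N * Real.log ‖deriv φ 0‖ - Real.log ‖Q₁.eval 0‖)
    (Real.log_nonneg hR1) hl ?_
  intro d A K D hd hA hK hD hcond
  have hm' : (0 : ℝ) < m := by exact_mod_cast hm
  have hD' : (0 : ℝ) < D := by exact_mod_cast hD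
  have : Nonempty (Fin m × Fin D) := ⟨⟨⟨0, hm⟩, ⟨0, hD⟩⟩⟩
  have hcardS : Fintype.card (Fin m × Fin D) = m * D := by simp
  let g : Fin m × Fin D → ℕ → ℚ := fun s n => PowerSeries.coeff n (p ^ (s.2 : ℕ) * f s.1)
  have hgli : LinearIndependent ℚ g := by
    have h1 : LinearIndependent ℚ fun s : Fin m × Fin D => p ^ (s.2 : ℕ) * f s.1 :=
      hli.comp (fun s : Fin m × Fin D => (s.1, (s.2 : ℕ))) fun s t hst => by
        simp only [Prod.mk.injEq] at hst
        exact Prod.ext hst.1 (Fin.ext hst.2)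
    exact h1.map' (LinearMap.pi fun n => PowerSeries.coeff n) (LinearMap.ker_eq_bot.mpr
      fun a b hab => PowerSeries.ext fun n => congrFun hab n)
  have htay : ∀ s : Fin m × Fin D, taylor (fun z => P z ^ (s.2 : ℕ) * F s.1 z) 0 =
      (p ^ (s.2 : ℕ) * f s.1).map (algebraMap ℚ ℂ) := fun s => by
    rw [taylor_mul (hP.fun_pow _) (hF s.1), taylor_pow hP, hPt, hFt, map_mul, map_pow]
  have hgtay : ∀ s n, PowerSeries.coeff n (taylor (fun z => P z ^ (s.2 : ℕ) * F s.1 z) 0) =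
      (g s n : ℂ) := fun s n => by
    rw [htay, PowerSeries.coeff_map]; rfl
  -- On the circle `|G|` compensates `|P ∘ φ| ^ s` for every `s < D`, which makes the Cauchy bound
  -- independent of `D`; the price is the small value `|G(0)| = exp (-D Re q(0))`.
  let G : ℂ → ℂ := fun z => Complex.exp (-(D * q.eval z))
  have hG : ∀ z, AnalyticAt ℂ G z := fun z =>
    (analyticAt_const.fun_mul (analyticAt_polynomial_eval q z)).fun_neg.cexp
  have hGnorm : ∀ z, ‖G z‖ = Real.exp (-(D * (q.eval z).re)) := fun z => by
    simp [G, Complex.norm_exp]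
  let V : ℂ → ℂ := fun z => Q₁.eval (φ z) * G z
  have hV : AnalyticAt ℂ V 0 :=
    AnalyticAt.fun_mul ((analyticAt_polynomial_eval Q₁ (φ 0)).comp hφ00) (hG 0)
  let W : ℂ⟦X⟧ := taylor φ 0 ^ N * taylor V 0
  have hXφ : PowerSeries.X ∣ taylor φ 0 := by
    rw [PowerSeries.X_dvd_iff, constantCoeff_taylor, hφ0]
  have hXW : PowerSeries.X ^ N ∣ W := Dvd.dvd.mul_right (pow_dvd_pow_of_dvd hXφ N) _
  let v : Fin m × Fin D → ℂ → ℂ := fun s z => M s.1 z * P (φ z) ^ (s.2 : ℕ) * G z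
  have hv : ∀ s, AnalyticOnNhd ℂ (v s) (Metric.closedBall 0 1) := fun s z hz =>
    ((hM s.1 z hz).fun_mul ((hPφ z hz).fun_pow _)).fun_mul (hG z)
  have hvtay : ∀ s, taylor (v s) 0 =
      W * taylor (fun z => (fun y => P y ^ (s.2 : ℕ) * F s.1 y) (φ z)) 0 := fun s => by
    have hcomp : AnalyticAt ℂ (fun z => P (φ z) ^ (s.2 : ℕ) * F s.1 (φ z)) 0 := by
      have h1 : AnalyticAt ℂ (fun y => P y ^ (s.2 : ℕ) * F s.1 y) (φ 0) := by
        rw [hφ0]; exact (hP.fun_pow _).fun_mul (hF s.1)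
      exact h1.comp hφ00
    have h2 : v s =ᶠ[𝓝 0] fun z => φ z ^ N * V z * (P (φ z) ^ (s.2 : ℕ) * F s.1 (φ z)) := by
      filter_upwards [hMF s.1] with z hz
      have h3 : Q.eval (φ z) = φ z ^ N * Q₁.eval (φ z) := by rw [hQ₁]; simp
      simp only [v, V, hz, h3]
      ring
    rw [taylor_congr h2, taylor_mul ((hφ00.fun_pow N).fun_mul hV) hcomp,
      taylor_mul (hφ00.fun_pow N) hV, taylor_pow hφ00]
  have hdφ : PowerSeries.coeff 1 (taylor φ 0) = deriv φ 0 := by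
    rw [coeff_taylor, iteratedDeriv_one]; simp
  have hineq := holonomy_inequality (S := Fin m × Fin D) hgli (d := d) hA hK
    (t := fun n k => PowerSeries.coeff n (x ^ k))
    (fun n => by
      obtain ⟨y, rfl⟩ := PowerSeries.X_dvd_iff.mpr (by simpa using hx0)
      rw [coeff_one_X_mul] at hx1
      rw [coeff_X_mul_pow_self, hx1, one_pow])
    (fun s n => by
      have h1 : IsIntegralSeries ((p ^ (s.2 : ℕ) * f s.1).subst x) := by
        rw [PowerSeries.subst_mul (hasSubst_of_coeff_zero hx0),
          PowerSeries.subst_pow (hasSubst_of_coeff_zero hx0)]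
        exact (hpint.pow _).mul (hfint s.1)
      obtain ⟨z, hz⟩ := h1 n
      rw [coeff_subst_eq_sum hx0] at hz
      exact ⟨z, hz⟩)
    -- The powers of `p` cost a factor exponential in `D`; under the exponent `1 / K` it disappears
    -- as `K` grows.
    (C := C * B ^ D) (R := R) (one_le_mul_of_one_le_of_one_le hC1 (one_le_pow₀ hB1)) hR1
    (fun s n => by
      have h1 := hbound s.1 s.2 n
      rw [hgtay, ← Complex.ofReal_ratCast, Complex.norm_real, Real.norm_eq_abs] at h1
      refine h1.trans ?_
      have := s.2.2.le
      gcongr)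
    (by
      rw [hcardS]
      have h1 := card_lowDegree_le d A
      rw [le_div_iff₀ (by positivity)] at h1
      have h2 : ((lowDegree d A).card : ℝ) * (d.factorial : ℝ) * (K + 1) ≤
          (d.factorial : ℝ) * (m * D : ℝ) ^ d :=
        (mul_le_mul_of_nonneg_right h1 (by positivity)).trans hcond
      have h3 : ((lowDegree d A).card : ℝ) * (K + 1) ≤ (m * D : ℝ) ^ d := by
        refine le_of_mul_le_mul_left ?_ (by positivity : (0 : ℝ) < (d.factorial : ℝ))
        linarith
      exact_mod_cast h3)
    (g' := fun s n => PowerSeries.coeff (n + N) (taylor (v s) 0))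
    (t' := fun n k => PowerSeries.coeff (n + N) (W * taylor φ 0 ^ k))
    (fun s n => by
      rw [hvtay, coeff_mul_taylor_comp ((hP.fun_pow _).fun_mul (hF s.1)) hφ00 hφ0 hXW]
      exact Finset.sum_congr rfl fun k _ => by rw [hgtay])
    (w := deriv φ 0 ^ N * V 0) (lam := deriv φ 0)
    (fun n => by
      have h1 := coeff_diag (V := taylor V 0) hXφ N n
      rw [hdφ, constantCoeff_taylor] at h1
      exact h1) hφ'.le (C' := C')
    (fun s n => by
      have h1 := norm_coeff_taylor_le one_pos (hv s) (C := C') (fun z hz => by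
        have hz' := Metric.sphere_subset_closedBall hz
        have h2 : ‖P (φ z)‖ ^ (s.2 : ℕ) ≤ Real.exp (D * (q.eval z).re) := by
          have hre : 0 ≤ (q.eval z).re := Real.posLog_nonneg.trans (hq z hz)
          calc ‖P (φ z)‖ ^ (s.2 : ℕ) ≤ Real.exp (q.eval z).re ^ (s.2 : ℕ) :=
                pow_le_pow_left₀ (norm_nonneg _) ((le_exp_posLog _ (norm_nonneg _)).trans
                  (Real.exp_le_exp.mpr (hq z hz))) _
            _ ≤ Real.exp (q.eval z).re ^ D :=
                pow_le_pow_right₀ (Real.one_le_exp hre) s.2.2.le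
            _ = _ := by rw [← Real.exp_nat_mul]
        calc ‖v s z‖ = ‖M s.1 z‖ * (‖P (φ z)‖ ^ (s.2 : ℕ) * Real.exp (-(D * (q.eval z).re))) := by
              simp only [v, norm_mul, norm_pow, hGnorm]; ring
          _ ≤ C' * (Real.exp (D * (q.eval z).re) * Real.exp (-(D * (q.eval z).re))) := by
              gcongr
              exact hC' s.1 z hz'
          _ = C' := by rw [← Real.exp_add]; simp) (n + N)
      simpa using h1)
  have hV0 : ‖V 0‖ = ‖Q₁.eval 0‖ * Real.exp (-(D * (q.eval 0).re)) := by
    simp only [V, hφ0, norm_mul, hGnorm]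
  have hQ₁n : 0 < ‖Q₁.eval 0‖ := norm_pos_iff.mpr hQ₁0
  have hCpos : 0 < C := by linarith
  have hBpos : 0 < B := by linarith
  have hRpos : 0 < R := by linarith
  have hC'pos : 0 < C' := by linarith
  rw [hcardS, norm_mul, norm_pow, hV0] at hineq
  have hlog := Real.log_le_log (by positivity) hineq
  have hmD : ((m * D : ℕ) : ℝ) = m * D := by push_cast; ring
  have hmDpos : (0 : ℝ) < m * D := by positivity
  rw [hmD] at hlog
  have hL : Real.log ((‖deriv φ 0‖ ^ N * (‖Q₁.eval 0‖ * Real.exp (-(D * (q.eval 0).re)))) ^ d *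
      ‖deriv φ 0‖ ^ A) = d * (N * Real.log ‖deriv φ 0‖ + (Real.log ‖Q₁.eval 0‖ +
        -(D * (q.eval 0).re))) + A * Real.log ‖deriv φ 0‖ := by
    rw [Real.log_mul (by positivity) (by positivity), Real.log_pow, Real.log_pow,
      Real.log_mul (by positivity) (by positivity), Real.log_pow,
      Real.log_mul (by positivity) (by positivity), Real.log_exp]
  have hRt : Real.log ((m * D : ℝ) ^ d *
      (2 * ((m * D : ℝ) ^ d * ((C * B ^ D) ^ d * R ^ A))) ^ (1 / K : ℝ) * C' ^ d) =
      d * Real.log (m * D) + 1 / K * (Real.log 2 + (d * Real.log (m * D) +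
        (d * (Real.log C + D * Real.log B) + A * Real.log R))) + d * Real.log C' := by
    rw [Real.log_mul (by positivity) (by positivity), Real.log_mul (by positivity) (by positivity),
      Real.log_rpow (by positivity), Real.log_mul (by positivity) (by positivity),
      Real.log_mul (by positivity) (by positivity), Real.log_mul (by positivity) (by positivity)]
    simp only [Real.log_pow]
    rw [Real.log_mul (x := C) (by positivity) (by positivity), Real.log_pow]
  rw [hL, hRt] at hlog
  linarith

/-! ### Rational functions as power series, and independence over `ℚ(p)` -/

/-- The expansion at `0` of a rational function without pole at `0`. -/
def expansion (p : RatFunc ℚ) : ℚ⟦X⟧ := (p.num : ℚ⟦X⟧) * (p.denom : ℚ⟦X⟧)⁻¹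

lemma constantCoeff_denom_ne_zero {p : RatFunc ℚ} (hp : Polynomial.aeval (0 : ℂ) p.denom ≠ 0) :
    PowerSeries.constantCoeff (p.denom : ℚ⟦X⟧) ≠ 0 := by
  intro h
  apply hp
  rw [Polynomial.constantCoeff_coe] at h
  rw [← Polynomial.coeff_zero_eq_aeval_zero', h, map_zero]

lemma expansion_mul_denom {p : RatFunc ℚ} (hp : Polynomial.aeval (0 : ℂ) p.denom ≠ 0) :
    expansion p * (p.denom : ℚ⟦X⟧) = (p.num : ℚ⟦X⟧) := by
  rw [expansion, mul_assoc, PowerSeries.inv_mul_cancel _ (constantCoeff_denom_ne_zero hp), mul_one]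

lemma algebraMap_eq_expansion {p : RatFunc ℚ} (hp : Polynomial.aeval (0 : ℂ) p.denom ≠ 0) :
    algebraMap (RatFunc ℚ) ℚ⸨X⸩ p = (expansion p : ℚ⸨X⸩) := by
  have hd : ((p.denom : RatFunc ℚ) : ℚ⸨X⸩) ≠ 0 := by
    simpa using p.denom_ne_zero
  apply mul_right_cancel₀ hd
  rw [← RatFunc.coe_coe p.denom, ← PowerSeries.coe_mul, expansion_mul_denom hp]
  rw [RatFunc.coe_coe, RatFunc.coe_coe, ← map_mul]
  congr 1
  nth_rewrite 1 [← RatFunc.num_div_denom p]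
  exact div_mul_cancel₀ _ (RatFunc.algebraMap_ne_zero p.denom_ne_zero)

lemma expansion_subst {p : RatFunc ℚ} (hp : Polynomial.aeval (0 : ℂ) p.denom ≠ 0) {x : ℚ⟦X⟧}
    (hx : PowerSeries.coeff 0 x = 0) : (expansion p).subst x = pullback p x := by
  have hs := hasSubst_of_coeff_zero hx
  have h := congrArg (PowerSeries.subst x : ℚ⟦X⟧ → ℚ⟦X⟧) (expansion_mul_denom hp)
  rw [PowerSeries.subst_mul hs, PowerSeries.subst_coe hs, PowerSeries.subst_coe hs] at h
  have hc : PowerSeries.constantCoeff (Polynomial.aeval x p.denom) ≠ 0 := by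
    have h0 := constantCoeff_denom_ne_zero hp
    have hx0 : PowerSeries.constantCoeff x = 0 := by simpa using hx
    rw [Polynomial.constantCoeff_coe] at h0
    rwa [Polynomial.aeval_def, Polynomial.hom_eval₂, hx0, Polynomial.eval₂_at_zero,
      show (PowerSeries.constantCoeff (R := ℚ)).comp (algebraMap ℚ ℚ⟦X⟧) = RingHom.id ℚ from
        Subsingleton.elim _ _]
  rw [pullback, ← h, mul_assoc, PowerSeries.mul_inv_cancel _ hc, mul_one]

lemma analyticAt_ratFunc_eval {p : RatFunc ℚ} {α : ℂ} (hp : Polynomial.aeval α p.denom ≠ 0) :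
    AnalyticAt ℂ (fun z => p.eval (algebraMap ℚ ℂ) z) α := by
  simp only [RatFunc.eval, ← Polynomial.eval_map]
  refine (analyticAt_polynomial_eval _ α).fun_div (analyticAt_polynomial_eval _ α) ?_
  rwa [Polynomial.eval_map_algebraMap]

lemma taylor_ratFunc_eval {p : RatFunc ℚ} (hp : Polynomial.aeval (0 : ℂ) p.denom ≠ 0) :
    taylor (fun z => p.eval (algebraMap ℚ ℂ) z) 0 = (expansion p).map (algebraMap ℚ ℂ) := by
  have hd : ((p.denom.map (algebraMap ℚ ℂ) : Polynomial ℂ) : ℂ⟦X⟧) ≠ 0 := by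
    simpa using p.denom_ne_zero
  apply mul_right_cancel₀ hd
  have hne : ∀ᶠ z in 𝓝 (0 : ℂ), (p.denom.map (algebraMap ℚ ℂ)).eval z ≠ 0 :=
    (analyticAt_polynomial_eval _ 0).continuousAt.eventually_ne
      (by rwa [Polynomial.eval_map_algebraMap])
  rw [← taylor_polynomial_zero, ← taylor_mul (analyticAt_ratFunc_eval hp)
    (analyticAt_polynomial_eval _ 0), taylor_polynomial_zero, Polynomial.polynomial_map_coe,
    ← map_mul, expansion_mul_denom hp, ← Polynomial.polynomial_map_coe, ← taylor_polynomial_zero]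
  refine taylor_congr ?_
  filter_upwards [hne] with z hz
  rw [RatFunc.eval, ← Polynomial.eval_map, ← Polynomial.eval_map, div_mul_cancel₀ _ hz]

lemma linearIndependent_pow_of_transcendental {K A : Type*} [Field K] [CommRing A] [Algebra K A]
    {a : A} (ha : Transcendental K a) : LinearIndependent K fun n : ℕ => a ^ n := by
  have h := (Polynomial.basisMonomials K).linearIndependent.map' (Polynomial.aeval a).toLinearMap
    (LinearMap.ker_eq_bot.mpr (transcendental_iff_injective.mp ha))
  have he : (fun n : ℕ => a ^ n) =
      (Polynomial.aeval a).toLinearMap ∘ Polynomial.basisMonomials K := by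
    ext n
    simp
  rw [he]
  exact h

/-- The instance argument covers both algebra structures that Mathlib puts on `RatFunc ℚ`. -/
lemma transcendental_of_notMem_range [i : Algebra ℚ (RatFunc ℚ)] {p : RatFunc ℚ}
    (hpc : p ∉ Set.range (algebraMap ℚ (RatFunc ℚ))) : Transcendental ℚ p := by
  obtain rfl : i = RatFunc.instAlgebraOfPolynomial ℚ ℚ := Subsingleton.elim _ _
  exact p.transcendental_of_ne_C fun ⟨c, hc⟩ => hpc ⟨c, hc.symm⟩

/-- Since `p` is not constant, `x` is algebraic over `ℚ(p)`, so the ring `ℚ(p)[x]` is already the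
field `ℚ(x)`. -/
lemma mem_adjoin_X_of_notMem_range [i : Algebra ℚ (RatFunc ℚ)] {p : RatFunc ℚ}
    (hpc : p ∉ Set.range (algebraMap ℚ (RatFunc ℚ))) (r : RatFunc ℚ) :
    r ∈ Algebra.adjoin (IntermediateField.adjoin ℚ {p}) {(RatFunc.X : RatFunc ℚ)} := by
  obtain rfl : i = RatFunc.instAlgebraOfPolynomial ℚ ℚ := Subsingleton.elim _ _
  rw [← IntermediateField.adjoin_simple_toSubalgebra_of_isAlgebraic
    (p.isAlgebraic_adjoin_simple_X fun ⟨c, hc⟩ => hpc ⟨c, hc.symm⟩),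
    RatFunc.IntermediateField.adjoin_X]
  trivial

/-- The powers of the transcendental `p` are independent over `ℚ` and the `f i` over `ℚ(p)`, so the
products are independent over `ℚ` as in a tower of fields. -/
lemma linearIndependent_expansion_pow_mul {p : RatFunc ℚ}
    (hpc : p ∉ Set.range (algebraMap ℚ (RatFunc ℚ)))
    (hp : Polynomial.aeval (0 : ℂ) p.denom ≠ 0) {m : ℕ} {f : Fin m → ℚ⟦X⟧}
    (hf : LinearIndependent (Qp p) fun i => (f i : ℚ⸨X⸩)) :
    LinearIndependent ℚ fun s : Fin m × ℕ => expansion p ^ s.2 * f s.1 := by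
  have ht : Transcendental ℚ p := transcendental_of_notMem_range hpc
  have hb : LinearIndependent ℚ fun n : ℕ => (IntermediateField.AdjoinSimple.gen ℚ p) ^ n := by
    apply linearIndependent_pow_of_transcendental
    intro h
    exact ht (by simpa using h.algebraMap (A := RatFunc ℚ))
  have hmul := (linearIndependent_smul hb hf).comp Prod.swap Prod.swap_injective
  refine LinearIndependent.of_comp (HahnSeries.ofPowerSeries ℤ ℚ).toAddMonoidHom.toRatLinearMap ?_
  suffices he : (HahnSeries.ofPowerSeries ℤ ℚ).toAddMonoidHom.toRatLinearMap ∘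
      (fun s : Fin m × ℕ => expansion p ^ s.2 * f s.1) =
      (fun s : ℕ × Fin m => IntermediateField.AdjoinSimple.gen ℚ p ^ s.1 • (f s.2 : ℚ⸨X⸩)) ∘
        Prod.swap by
    rw [he]
    exact hmul
  funext s
  symm
  change algebraMap (RatFunc ℚ) ℚ⸨X⸩ (p ^ s.2) * (f s.1 : ℚ⸨X⸩) =
    ((expansion p ^ s.2 * f s.1 : ℚ⟦X⟧) : ℚ⸨X⸩)
  rw [map_pow, algebraMap_eq_expansion hp, PowerSeries.coe_mul, PowerSeries.coe_pow]

/-! ### Finite dimensionality of the spans -/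

/-- A basis of the span can be extracted from `s` itself, so only families of generators, for which
integrality is available, need a bound. -/
lemma finite_span_of_card_le {K V : Type*} [Field K] [AddCommGroup V] [Module K V] {s : Set V}
    {b : ℝ} (h : ∀ (m : ℕ) (v : Fin m → V), (∀ i, v i ∈ s) → LinearIndependent K v → (m : ℝ) ≤ b) :
    Module.Finite K (Submodule.span K s) ∧ (Module.finrank K (Submodule.span K s) : ℝ) ≤ b := by
  obtain ⟨t, hts, hspan, hli⟩ := exists_linearIndependent K s
  have hcard : ∀ u : Finset V, (u : Set V) ⊆ t → (u.card : ℝ) ≤ b := fun u hu => by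
    refine h u.card (fun i => (u.equivFin.symm i : V)) (fun i => hts (hu (u.equivFin.symm i).2)) ?_
    exact (hli.comp (fun i => (⟨(u.equivFin.symm i : V), hu (u.equivFin.symm i).2⟩ : t))
      fun i j hij => by simpa [Subtype.ext_iff] using hij)
  have hfin : t.Finite := by
    by_contra hinf
    obtain ⟨u, hu, huc⟩ := Set.Infinite.exists_subset_card_eq hinf (⌊b⌋₊ + 1)
    have h1 := hcard u hu
    rw [huc] at h1
    have h2 := Nat.lt_floor_add_one b
    push_cast at h1
    linarith
  rw [← hspan]
  refine ⟨Module.Finite.span_of_finite K hfin, ?_⟩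
  have := hfin.fintype
  rw [finrank_span_set_eq_card hli]
  exact hcard _ (by simp)

/-- The series `f` with `f(x(t))` integral that continue meromorphically along `φ`. -/
def integralContinuable (x : ℚ⟦X⟧) (φ : ℂ → ℂ) : Set ℚ⟦X⟧ :=
  {f | IsIntegralSeries (f.subst x) ∧ ContinuesAlong φ f}

/-- The `ℚ(p)`-span of `integralContinuable x φ`. -/
def continuableSpan (p : RatFunc ℚ) (x : ℚ⟦X⟧) (φ : ℂ → ℂ) : Submodule (Qp p) ℚ⸨X⸩ :=
  Submodule.span (Qp p) ((fun f : ℚ⟦X⟧ => (f : ℚ⸨X⸩)) '' integralContinuable x φ)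

lemma finite_continuableSpan {U : Set ℂ} {p : RatFunc ℚ} {φ : ℂ → ℂ} {x : ℚ⟦X⟧} (h0 : (0 : ℂ) ∈ U)
    (hpc : p ∉ Set.range (algebraMap ℚ (RatFunc ℚ)))
    (hp : ∀ α ∈ U, Polynomial.aeval α p.denom ≠ 0)
    (hφ : AnalyticOnNhd ℂ φ (Metric.closedBall 0 1))
    (hφU : Set.MapsTo φ (Metric.closedBall 0 1) U) (hφ0 : φ 0 = 0) (hφ' : 1 < ‖deriv φ 0‖)
    (hx0 : PowerSeries.coeff 0 x = 0) (hx1 : PowerSeries.coeff 1 x = 1)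
    (hpint : IsIntegralSeries (pullback p x)) :
    Module.Finite (Qp p) (continuableSpan p x φ) ∧
      (Module.finrank (Qp p) (continuableSpan p x φ) : ℝ) ≤ holonomyBound p φ := by
  refine finite_span_of_card_le fun m v hv hli => ?_
  choose f hf hfv using hv
  obtain rfl : (fun i => (f i : ℚ⸨X⸩)) = v := funext hfv
  rw [holonomyBound, le_div_iff₀ (Real.log_pos hφ')]
  exact card_mul_log_le (p := expansion p) (x := x) (P := fun z => p.eval (algebraMap ℚ ℂ) z)
    hφ hφ0 hφ' hx0 hx1 (fun i => (hf i).1) (by rwa [expansion_subst (hp 0 h0) hx0])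
    (fun i => (hf i).2) (analyticAt_ratFunc_eval (hp 0 h0)) (taylor_ratFunc_eval (hp 0 h0))
    (fun z hz => (analyticAt_ratFunc_eval (hp _ (hφU hz))).fun_comp (hφ z hz))
    (linearIndependent_expansion_pow_mul hpc (hp 0 h0) hli)

lemma H_subset_integralContinuable {U : Set ℂ} {φ : ℂ → ℂ} {x : ℚ⟦X⟧} (h0 : (0 : ℂ) ∈ U)
    (hφ : AnalyticOnNhd ℂ φ (Metric.closedBall 0 1))
    (hφU : Set.MapsTo φ (Metric.closedBall 0 1) U) (hφ0 : φ 0 = 0) :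
    H U x ⊆ integralContinuable x φ :=
  fun _ hf => ⟨hf.1, continuesAlong_of_mem_H h0 hf hφ hφU hφ0⟩

/-- Multiplication by `M X` becomes multiplication by the integral series `M x(t)` after
substitution, and by `M φ` on the disc. Working with continuable series rather than with `H` avoids
transforming differential operators. -/
lemma smul_X_mul_mem_integralContinuable {φ : ℂ → ℂ} {x f : ℚ⟦X⟧} {M : ℚ}
    (hφ : AnalyticOnNhd ℂ φ (Metric.closedBall 0 1)) (hx0 : PowerSeries.coeff 0 x = 0)
    (hM : IsIntegralSeries (M • x)) (hf : f ∈ integralContinuable x φ) :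
    M • PowerSeries.X * f ∈ integralContinuable x φ := by
  have hs := hasSubst_of_coeff_zero hx0
  obtain ⟨hintg, F, hF, hFt, Q, hQ, N, hN, hNF⟩ := hf
  refine ⟨?_, fun z => (M : ℂ) * z * F z, ?_, ?_, Q, hQ, fun z => (M : ℂ) * φ z * N z, ?_, ?_⟩
  · rw [PowerSeries.subst_mul hs, PowerSeries.subst_smul hs, PowerSeries.subst_X hs]
    exact hM.mul hintg
  · exact (analyticAt_const.fun_mul analyticAt_id).fun_mul hF
  · have hlin : AnalyticAt ℂ (fun z : ℂ => (M : ℂ) * z) 0 := analyticAt_const.fun_mul analyticAt_id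
    rw [taylor_mul hlin hF, taylor_const_mul (f := fun z => z), taylor_id_zero, hFt,
      map_mul, PowerSeries.smul_eq_C_mul, PowerSeries.smul_eq_C_mul, map_mul, PowerSeries.map_C,
      PowerSeries.map_X]
    simp
  · exact fun z hz => (analyticAt_const.fun_mul (hφ z hz)).fun_mul (hN z hz)
  · filter_upwards [hNF] with z hz
    rw [hz]
    ring

/-- Stability under `ℚ(p)` and `x` gives stability under `ℚ(p)[x] = ℚ(x)`. -/
lemma algebraMap_mul_mem_of_X_mul_mem {p : RatFunc ℚ} (hpc : p ∉ Set.range (algebraMap ℚ (RatFunc ℚ)))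
    (W : Submodule (Qp p) ℚ⸨X⸩) (hX : ∀ w ∈ W, algebraMap (RatFunc ℚ) ℚ⸨X⸩ RatFunc.X * w ∈ W)
    (r : RatFunc ℚ) {w : ℚ⸨X⸩} (hw : w ∈ W) :
    algebraMap (RatFunc ℚ) ℚ⸨X⸩ r * w ∈ W := by
  have hr := mem_adjoin_X_of_notMem_range hpc r
  induction hr using Algebra.adjoin_induction generalizing w with
  | mem y hy => obtain rfl := hy; exact hX w hw
  | algebraMap c => exact W.smul_mem c hw
  | add a b _ _ ha hb => rw [map_add, add_mul]; exact W.add_mem (ha hw) (hb hw)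
  | mul a b _ _ ha hb => rw [map_mul, mul_assoc]; exact ha (hb hw)

lemma X_mul_mem_continuableSpan {p : RatFunc ℚ} {φ : ℂ → ℂ} {x : ℚ⟦X⟧} {M : ℚ} (hM0 : M ≠ 0)
    (hφ : AnalyticOnNhd ℂ φ (Metric.closedBall 0 1)) (hx0 : PowerSeries.coeff 0 x = 0)
    (hM : IsIntegralSeries (M • x)) {w : ℚ⸨X⸩} (hw : w ∈ continuableSpan p x φ) :
    algebraMap (RatFunc ℚ) ℚ⸨X⸩ RatFunc.X * w ∈ continuableSpan p x φ := by
  induction hw using Submodule.span_induction with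
  | mem y hy =>
    obtain ⟨f, hf, rfl⟩ := hy
    have h := Submodule.subset_span (R := Qp p) (Set.mem_image_of_mem
      (fun f : ℚ⟦X⟧ => (f : ℚ⸨X⸩)) (smul_X_mul_mem_integralContinuable hφ hx0 hM hf))
    have h2 := Submodule.smul_mem _ (algebraMap ℚ (Qp p) M⁻¹) h
    refine Eq.mp (congrArg (· ∈ continuableSpan p x φ) ?_) h2
    change algebraMap (RatFunc ℚ) ℚ⸨X⸩ (algebraMap ℚ (RatFunc ℚ) M⁻¹) *
      ((M • PowerSeries.X * f : ℚ⟦X⟧) : ℚ⸨X⸩) = algebraMap (RatFunc ℚ) ℚ⸨X⸩ RatFunc.X * (f : ℚ⸨X⸩)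
    have hX : algebraMap (RatFunc ℚ) ℚ⸨X⸩ RatFunc.X = ((PowerSeries.X : ℚ⟦X⟧) : ℚ⸨X⸩) := by
      rw [RatFunc.coe_X, PowerSeries.coe_X]
    have hc : algebraMap (RatFunc ℚ) ℚ⸨X⸩ (algebraMap ℚ (RatFunc ℚ) M⁻¹) =
        ((PowerSeries.C M⁻¹ : ℚ⟦X⟧) : ℚ⸨X⸩) := by
      simp
    rw [hX, hc, ← PowerSeries.coe_mul, ← PowerSeries.coe_mul, PowerSeries.smul_eq_C_mul,
      ← mul_assoc, ← mul_assoc, ← map_mul, inv_mul_cancel₀ hM0, map_one, one_mul]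
  | zero => rw [mul_zero]; exact Submodule.zero_mem _
  | add a b _ _ ha hb => rw [mul_add]; exact Submodule.add_mem _ ha hb
  | smul c a _ ha => 
    have h := Submodule.smul_mem (continuableSpan p x φ) c ha
    change algebraMap (RatFunc ℚ) ℚ⸨X⸩ c * _ ∈ _ at h
    rwa [mul_left_comm] at h

/-- The `ℚ(p)`-span of the continuable series is stable under `ℚ(x)`, so it contains the whole
`ℚ(x)`-span of `H` and its bound is inherited. -/
lemma finite_V_and_finrank_le {U : Set ℂ} {p : RatFunc ℚ} {φ : ℂ → ℂ} {x : ℚ⟦X⟧}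
    (h0 : (0 : ℂ) ∈ U) (hpc : p ∉ Set.range (algebraMap ℚ (RatFunc ℚ)))
    (hp : ∀ α ∈ U, Polynomial.aeval α p.denom ≠ 0)
    (hφ : AnalyticOnNhd ℂ φ (Metric.closedBall 0 1))
    (hφU : Set.MapsTo φ (Metric.closedBall 0 1) U) (hφ0 : φ 0 = 0) (hφ' : 1 < ‖deriv φ 0‖)
    (hx0 : PowerSeries.coeff 0 x = 0) (hx1 : PowerSeries.coeff 1 x = 1)
    (hpint : IsIntegralSeries (pullback p x)) {M : ℚ} (hM0 : M ≠ 0)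
    (hM : IsIntegralSeries (M • x)) :
    Module.Finite (Qp p) (V U x) ∧ (Module.finrank (Qp p) (V U x) : ℝ) ≤ holonomyBound p φ := by
  obtain ⟨hfin, hle⟩ := finite_continuableSpan h0 hpc hp hφ hφU hφ0 hφ' hx0 hx1 hpint
  have hsub : ∀ v ∈ V U x, v ∈ continuableSpan p x φ := by
    intro v hv
    induction hv using Submodule.span_induction with
    | mem y hy =>
      exact Submodule.subset_span (Set.image_mono (H_subset_integralContinuable h0 hφ hφU hφ0) hy)
    | zero => exact Submodule.zero_mem _
    | add a b _ _ ha hb => exact Submodule.add_mem _ ha hb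
    | smul c a _ ha =>
      exact algebraMap_mul_mem_of_X_mul_mem hpc _
        (fun w hw => X_mul_mem_continuableSpan hM0 hφ hx0 hM hw) c ha
  let ι : V U x →ₗ[Qp p] continuableSpan p x φ :=
    { toFun := fun v => ⟨v.1, hsub v.1 v.2⟩
      map_add' := fun _ _ => rfl
      map_smul' := fun _ _ => rfl }
  have hι : Function.Injective ι := fun v w h =>
    Subtype.ext (congrArg (fun u : continuableSpan p x φ => (u : ℚ⸨X⸩)) h)
  exact ⟨Module.Finite.of_injective ι hι,
    le_trans (by exact_mod_cast LinearMap.finrank_le_finrank_of_injective hι) hle⟩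

lemma finite_Vp_and_finrank_le {U : Set ℂ} {p : RatFunc ℚ} {φ : ℂ → ℂ} {x : ℚ⟦X⟧}
    (h0 : (0 : ℂ) ∈ U) (hpc : p ∉ Set.range (algebraMap ℚ (RatFunc ℚ)))
    (hp : ∀ α ∈ U, Polynomial.aeval α p.denom ≠ 0)
    (hφ : AnalyticOnNhd ℂ φ (Metric.closedBall 0 1))
    (hφU : Set.MapsTo φ (Metric.closedBall 0 1) U) (hφ0 : φ 0 = 0) (hφ' : 1 < ‖deriv φ 0‖)
    (hx0 : PowerSeries.coeff 0 x = 0) (hx1 : PowerSeries.coeff 1 x = 1)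
    (hpint : IsIntegralSeries (pullback p x)) :
    Module.Finite (Qp p) (Vp p U x) ∧
      (Module.finrank (Qp p) (Vp p U x) : ℝ) ≤ holonomyBound p φ := by
  obtain ⟨hfin, hle⟩ := finite_continuableSpan h0 hpc hp hφ hφU hφ0 hφ' hx0 hx1 hpint
  have hsub : Vp p U x ≤ continuableSpan p x φ :=
    Submodule.span_mono (Set.image_mono (H_subset_integralContinuable h0 hφ hφU hφ0))
  have hι := Submodule.inclusion_injective hsub
  exact ⟨Module.Finite.of_injective _ hι,
    le_trans (by exact_mod_cast LinearMap.finrank_le_finrank_of_injective hι) hle⟩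

/-! ### The case of uniformization radius greater than `1` -/

lemma X_notMem_range_algebraMap [i : Algebra ℚ (RatFunc ℚ)] :
    (RatFunc.X : RatFunc ℚ) ∉ Set.range (algebraMap ℚ (RatFunc ℚ)) := by
  rintro ⟨c, hc⟩
  have h : IsAlgebraic ℚ (RatFunc.X : RatFunc ℚ) := hc ▸ isAlgebraic_algebraMap c
  obtain rfl : i = RatFunc.instAlgebraOfPolynomial ℚ ℚ := Subsingleton.elim _ _
  exact RatFunc.transcendental_X h

lemma IsIntegralSeries.X : IsIntegralSeries (PowerSeries.X : ℚ⟦X⟧) := fun n =>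
  ⟨if n = 1 then 1 else 0, by rw [PowerSeries.coeff_X]; split_ifs <;> simp⟩

/-- A disc of radius larger than `1` in a normalised uniformization, rescaled to the unit disc. -/
lemma exists_analytic_disc {U : Set ℂ} (h : 1 < uniformizationRadius U 0) :
    ∃ φ : ℂ → ℂ, AnalyticOnNhd ℂ φ (Metric.closedBall 0 1) ∧
      Set.MapsTo φ (Metric.closedBall 0 1) U ∧ φ 0 = 0 ∧ 1 < ‖deriv φ 0‖ := by
  obtain ⟨R, ⟨F, -, hF, hF0, hF', hmaps, -⟩, hR⟩ := lt_sSup_iff.mp h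
  obtain ⟨r, hr1, hrR⟩ := ENNReal.lt_iff_exists_nnreal_btwn.mp hR
  have hr : (1 : ℝ) < r := by exact_mod_cast hr1
  have hmem : ∀ z ∈ Metric.closedBall (0 : ℂ) 1, (r : ℂ) * z ∈ Metric.eball (0 : ℂ) R := by
    intro z hz
    refine lt_of_le_of_lt ?_ hrR
    rw [edist_zero_right, ← ofReal_norm, norm_mul, ENNReal.ofReal_le_iff_le_toReal (by simp)]
    have hz' : ‖z‖ ≤ 1 := by simpa using hz
    simpa using mul_le_of_le_one_right r.2 hz'
  have hlin : ∀ z : ℂ, AnalyticAt ℂ (fun z : ℂ => (r : ℂ) * z) z := fun z =>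
    analyticAt_const.fun_mul analyticAt_id
  have hFan : AnalyticOnNhd ℂ F (Metric.eball 0 R) := hF.analyticOnNhd Metric.isOpen_eball
  -- With `1 < r < R`, the rescaled map is holomorphic near the closed unit disc and its derivative
  -- at `0` has norm `r`.
  refine ⟨fun z => F (r * z), fun z hz => ?_, fun z hz => ?_, by simpa using hF0, ?_⟩
  · exact (hFan _ (hmem z hz)).fun_comp (hlin z)
  · exact connectedComponentIn_subset _ _ (hmaps (hmem z hz))
  · rw [deriv_comp_mul_left]
    simpa [hF'] using hr

lemma finite_V_of_one_lt_uniformizationRadius {U : Set ℂ} (h0 : (0 : ℂ) ∈ U)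
    (h : 1 < uniformizationRadius U 0) : Module.Finite (RatFunc ℚ) (V U PowerSeries.X) := by
  obtain ⟨φ, hφ, hφU, hφ0, hφ'⟩ := exists_analytic_disc h
  have hfin := (finite_V_and_finrank_le (p := RatFunc.X) (x := PowerSeries.X) (M := 1) h0
    X_notMem_range_algebraMap (by simp) hφ hφU hφ0 hφ' (by simp) (by simp)
    (by simpa [pullback] using IsIntegralSeries.X) one_ne_zero
    (by simpa using IsIntegralSeries.X)).1
  -- Generators over the subfield `ℚ(p)`, with `p = x`, also generate over `ℚ(x)`.
  exact Module.Finite.of_restrictScalars_finite (Qp RatFunc.X) (RatFunc ℚ) (V U PowerSeries.X)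

end Holonomy

end

end

theorem corollary2p3 (U : Set ℂ) (hU : IsOpen U) (h0 : (0 : ℂ) ∈ U) :
    (1 < Holonomy.uniformizationRadius U 0 →
      Module.Finite (RatFunc ℚ) (Holonomy.V U PowerSeries.X)) ∧
    ∀ (p : RatFunc ℚ) (φ : ℂ → ℂ) (x : PowerSeries ℚ),
      p ∉ Set.range (algebraMap ℚ (RatFunc ℚ)) →
      (∀ α ∈ U, Polynomial.aeval α p.denom ≠ 0) →
      AnalyticOnNhd ℂ φ (Metric.closedBall 0 1) →
      Set.MapsTo φ (Metric.closedBall 0 1) U →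
      φ 0 = 0 →
      1 < ‖deriv φ 0‖ →
      PowerSeries.coeff 0 x = 0 →
      PowerSeries.coeff 1 x = 1 →
      Holonomy.IsIntegralSeries (Holonomy.pullback p x) →
      (Module.Finite (Holonomy.Qp p) (Holonomy.Vp p U x) ∧
        (Module.finrank (Holonomy.Qp p) (Holonomy.Vp p U x) : ℝ) ≤ Holonomy.holonomyBound p φ) ∧
      ((∃ M : ℚ, M ≠ 0 ∧ Holonomy.IsIntegralSeries (M • x)) →
        Module.Finite (Holonomy.Qp p) (Holonomy.V U x) ∧
        (Module.finrank (Holonomy.Qp p) (Holonomy.V U x) : ℝ) ≤ Holonomy.holonomyBound p φ) := by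
  refine ⟨Holonomy.finite_V_of_one_lt_uniformizationRadius h0,
    fun p φ x hpc hp hφ hφU hφ0 hφ' hx0 hx1 hpint =>
      ⟨Holonomy.finite_Vp_and_finrank_le h0 hpc hp hφ hφU hφ0 hφ' hx0 hx1 hpint, ?_⟩⟩
  rintro ⟨M, hM0, hM⟩
  exact Holonomy.finite_V_and_finrank_le h0 hpc hp hφ hφU hφ0 hφ' hx0 hx1 hpint hM0 hM
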